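/- Let $(V,g)$ be an oriented Euclidean vector space of dimension $2n$, let $\epsilon_g=e_1\wedge\cdots\wedge e_{2n}$ be its unit volume element, where $(e_i)$ is any positively oriented orthonormal basis, and extend $g$ complex-bilinearly to $V^{\mathbb C}$. **The space of complex structures.** Let $\mathcal J_g$ be the space of linear complex structures $J$ on $V$ with $g(J\cdot,J\cdot)=g$ that induce the given orientation (a basis of the form $u_1,Ju_1,\dots,u_n,Ju_n$ is positive), with the Riemannian metric $\eta_g(A,B)=\tfrac14\operatorname{tr}(A^{T}B)$. The cut locus of $J_0\in\mathcal J_g$ is the set of points $\gamma(s)$, $s>0$, on geodesics $\gamma$ starting at $J_0$ such that $\gamma$ is length-minimising up to $\gamma(s)$ but not beyond. For $J\in\mathcal J_g$ let $V_J^{1,0},V_J^{0,1}\subset V^{\mathbb C}$ be the $\pm i$-eigenspaces of $J$, write $x=x_J^{1,0}+x_J^{0,1}$ for $x\in V^{\mathbb C}$, and put $\varpi_J=g(J\cdot,\cdot)$. **Fermionic functions.** Functions on the fermionic copy $\Pi V$ of $V$ are the elements of $\mathcal H_0=\bigwedge^\bullet(V^*)^{\mathbb C}$; functions of several fermionic vectors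 $\theta,\chi,\dots$ are the elements of the exterior algebra on the direct sum. Write $\varpi_J(\theta)=\varpi_J(\theta,\theta)=g(J\theta,\theta)$, so that $e^{\frac i4\varpi_J(\theta)}$ is the form $e^{\frac i2\varpi_J}$. The fermionic integral is taken with $\tilde\epsilon_g=i^n\epsilon_g$ and the convention $\int\chi^1\cdots\chi^{2n}\,d\chi^1\cdots d\chi^{2n}=(-1)^{n(2n-1)}$ for the coordinates of $\chi$ in the basis $(e_i)$. **The quantum Hilbert spaces.** Give $\mathcal H_0$ the Hermitian form $\langle\psi,\psi'\rangle_0=\int_{\Pi V}\bar\psi\wedge\star_0\psi'\,\epsilon_g$, where $\int_{\Pi V}\alpha\,\epsilon_g$ is the pairing of the top-degree part of $\alpha$ with $\epsilon_g$ (so $e^1\wedge\cdots\wedge e^{2n}$ has integral $1$, for the basis $(e^i)$ dual to $(e_i)$) and $\star_0$ is the Hodge star of the metric $\frac12g$. For $x\in V^{\mathbb C}$ let $\nabla_x=\iota_x-\frac12\,g(x,\cdot)\wedge\,\cdot\,$ on $\mathcal H_0$, and for $J\in\mathcal J_g$ let $$\mathcal H_J=\{\psi\in\mathcal H_0:\nabla_x\psi=0\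 \text{ for all }x\in V_J^{0,1}\}.$$ The bundle $\mathcal H\to\mathcal J_g$ with fibres $\mathcal H_J$ carries the connection obtained by orthogonal projection of the trivial one: a section $\psi_t\in\mathcal H_{J_t}$ along a curve $J_t$ is parallel if $\dot\psi_t\perp\mathcal H_{J_t}$ for all $t$. For a fermionic parameter $\alpha\in\Pi V_J^{1,0}$ the coherent state in $\mathcal H_J$ is $$c_J^\alpha(\theta)=\exp\big[g(\theta_J^{1,0},\bar\alpha)-\tfrac12\,g(\theta_J^{1,0},\theta_J^{0,1})\big];$$ its parallel transport is defined by linearity in the coefficients that depend on $\alpha$. **Theorem.** Let $J_0,J_1\in\mathcal J_g$ and let $\gamma=\{J_t\}_{0\le t\le1}$ be a geodesic in $\mathcal J_g$ from $J_0$ to $J_1$, parametrised proportionally to arc length, that lies completely in the complement of the cut locus of $J_0$. Then $\det\frac{J_0+J_1}2>0$, the parallel transport $U_{J_1J_0}\colon\mathcal H_{J_0}\to\mathcal H_{J_1}$ along $\gamma$ exists and is unique, and: 1. for the coherent state $c_{J_0}^\alpha$, $$(U_{J_1J_0}c_{J_0}^\alpha)(\theta)=\Big(\det\tfrac{J_0+J_1}2\Big)^{1/4}e^{\frac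 i4\varpi_{J_1}(\theta)}\exp\Big[\tfrac i2\,g\Big(\theta_{J_1}^{1,0}-\bar\alpha,\ \big(\tfrac{J_0+J_1}2\big)^{-1}(\theta_{J_1}^{1,0}-\bar\alpha)\Big)\Big];$$ 2. for every state $\psi=e^{\frac i2\varpi_{J_0}}\wedge\phi\in\mathcal H_{J_0}$, $$(U_{J_1J_0}\psi)(\theta)=\Big(\det\tfrac{J_0+J_1}2\Big)^{1/4}e^{\frac i4\varpi_{J_1}(\theta)}\int_{\Pi V}\exp\Big[\tfrac i2\,g\Big(\theta_{J_1}^{1,0}-\chi_{J_0}^{0,1},\ \big(\tfrac{J_0+J_1}2\big)^{-1}(\theta_{J_1}^{1,0}-\chi_{J_0}^{0,1})\Big)+\tfrac i2\,\varpi_{J_0}(\chi)\Big]\,\phi(\chi)\;\tilde\epsilon_g(\chi).$$ -/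

import Mathlib

open scoped TensorProduct

noncomputable section

namespace FermionicTransport

/-! ### Calculus of fermionic variables -/

section Grassmann

variable {W W' : Type*} [AddCommGroup W] [Module ℝ W] [AddCommGroup W'] [Module ℝ W']

/-- The algebra `⋀(W*)^ℂ = ℂ ⊗ ⋀(W*)` of functions on the fermionic copy `ΠW` of `W`. -/
abbrev FermFun (W : Type*) [AddCommGroup W] [Module ℝ W] : Type _ :=
  ℂ ⊗[ℝ] ExteriorAlgebra ℝ (Module.Dual ℝ W)

/-- A linear functional on `W`, as an odd function on `ΠW`. -/
def linFun : Module.Dual ℝ W →ₗ[ℝ] FermFun W :=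
  (TensorProduct.mk ℝ ℂ (ExteriorAlgebra ℝ (Module.Dual ℝ W)) 1) ∘ₗ
    ExteriorAlgebra.ι ℝ (M := Module.Dual ℝ W)

/-- Pull-back of fermionic functions along a linear map: `F ↦ F ∘ f`. -/
def pullback (f : W' →ₗ[ℝ] W) : FermFun W →ₐ[ℂ] FermFun W' :=
  Algebra.TensorProduct.map (AlgHom.id ℂ ℂ) (ExteriorAlgebra.map f.dualMap)

/-- The degree zero part of a fermionic function. -/
def body : FermFun W →ₐ[ℂ] ℂ :=
  Algebra.TensorProduct.lift (AlgHom.id ℂ ℂ)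
    ((Algebra.ofId ℝ ℂ).comp
      (ExteriorAlgebra.algebraMapInv (R := ℝ) (M := Module.Dual ℝ W)))
    (fun _ _ => Commute.all _ _)

/-- The contraction `ι_x` with a vector `x`, that is, the derivative along `x`. It is the
antiderivation with `ι_x α = α(x)` for linear functionals `α`. -/
def contract : W →ₗ[ℝ] Module.End ℂ (FermFun W) :=
  (LinearMap.baseChangeHom ℝ ℂ (ExteriorAlgebra ℝ (Module.Dual ℝ W))
      (ExteriorAlgebra ℝ (Module.Dual ℝ W))) ∘ₗ
    (CliffordAlgebra.contractLeft (Q := (0 : QuadraticForm ℝ (Module.Dual ℝ W)))) ∘ₗ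
      Module.Dual.eval ℝ W

/-- Exterior multiplication `α ∧ ·` by a linear functional. -/
def wedge : Module.Dual ℝ W →ₗ[ℝ] Module.End ℂ (FermFun W) :=
  ((LinearMap.mul ℂ (FermFun W)).restrictScalars ℝ) ∘ₗ linFun

/-- The composition `ι_{w_N} ∘ ⋯ ∘ ι_{w_1}`. On a function of degree `N` this is the evaluation
on `w_1 ∧ ⋯ ∧ w_N`, so `e^1 ∧ ⋯ ∧ e^N` is sent to `1` if `e^i` is dual to `w_i`. -/
def contractFrame {N : ℕ} (w : Fin N → W) : Module.End ℂ (FermFun W) :=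
  (List.ofFn fun i => contract (w i)).reverse.prod

end Grassmann

variable {V : Type*} [NormedAddCommGroup V] [InnerProductSpace ℝ V] [FiniteDimensional ℝ V]

section FermVectors

variable {W : Type*} [AddCommGroup W] [Module ℝ W]

/-- The generic fermionic vector `∑ e_i ⊗ (e^i ∘ f)`: an element of `V ⊗ ⋀(W*)^ℂ`, that is, a
vector of `V` whose coordinates are odd functions on `ΠW`. -/
def fermVec (f : W →ₗ[ℝ] V) : V ⊗[ℝ] FermFun W :=
  LinearMap.lTensor V (linFun ∘ₗ f.dualMap) (coevaluation ℝ V 1)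

/-- A linear operator on `V` acting on fermionic vectors. -/
def fermAct (A : V →L[ℝ] V) : V ⊗[ℝ] FermFun W →ₗ[ℝ] V ⊗[ℝ] FermFun W :=
  LinearMap.rTensor (FermFun W) (A : V →ₗ[ℝ] V)

/-- Multiplication of fermionic vectors by the imaginary unit. -/
def fermI : V ⊗[ℝ] FermFun W →ₗ[ℝ] V ⊗[ℝ] FermFun W :=
  LinearMap.lTensor V ((LinearMap.lsmul ℂ (FermFun W) Complex.I).restrictScalars ℝ)

/-- The metric on fermionic vectors, `g(x ⊗ a, y ⊗ b) = g(x, y) a b`. -/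
def fermInner : V ⊗[ℝ] FermFun W →ₗ[ℝ] V ⊗[ℝ] FermFun W →ₗ[ℝ] FermFun W :=
  (TensorProduct.map₂ (innerₗ V) (LinearMap.mul ℝ (FermFun W))).compr₂
    (TensorProduct.lid ℝ (FermFun W)).toLinearMap

/-- The `(1,0)`-part `(u - i J u) / 2` of a fermionic vector. -/
def part10 (J : V →L[ℝ] V) (u : V ⊗[ℝ] FermFun W) : V ⊗[ℝ] FermFun W :=
  (1 / 2 : ℝ) • (u - fermI (fermAct J u))

/-- The `(0,1)`-part `(u + i J u) / 2` of a fermionic vector. -/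
def part01 (J : V →L[ℝ] V) (u : V ⊗[ℝ] FermFun W) : V ⊗[ℝ] FermFun W :=
  (1 / 2 : ℝ) • (u + fermI (fermAct J u))

/-- The function `ϖ_J(u) = ϖ_J(u, u) = g(J u, u)` of a fermionic vector `u`. -/
def varpi (J : V →L[ℝ] V) (u : V ⊗[ℝ] FermFun W) : FermFun W :=
  fermInner (fermAct J u) u

end FermVectors

/-! ### The space of compatible complex structures, its geodesics and cut loci -/

/-- The complex structures on `V` compatible with the metric and with the orientation: the basis
`e_1, J e_1, …, e_n, J e_n` is positively oriented. -/
def compatibleJ {n : ℕ} (o : Orientation ℝ V (Fin (2 * n))) : Set (V →L[ℝ] V) :=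
  {J | (∀ x, J (J x) = -x) ∧ (∀ x y, inner ℝ (J x) (J y) = inner ℝ x y) ∧
    ∃ b : Module.Basis (Fin (2 * n)) ℝ V, b.orientation = o ∧
      ∀ k : Fin n, b ⟨2 * k + 1, by omega⟩ = J (b ⟨2 * k, by omega⟩)}

/-- The tangent space at `J` of the space of compatible complex structures: the skew-symmetric
operators that anti-commute with `J`. -/
def tangentJ (J : V →L[ℝ] V) : Set (V →L[ℝ] V) :=
  {A | (∀ x y, inner ℝ (A x) y = -inner ℝ x (A y)) ∧ ∀ x, A (J x) = -J (A x)}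

/-- The Kähler metric `η_g(A, B) = (1/4) tr(Aᵀ B)` on the space of compatible complex structures,
written on all operators. In terms of `δP = -(i/2) δJ` it is `2 tr(P (δP)† δP P)`. -/
def etaMetric (A B : V →L[ℝ] V) : ℝ :=
  (1 / 4) * LinearMap.trace ℝ V
    (LinearMap.adjoint (A : V →ₗ[ℝ] V) ∘ₗ (B : V →ₗ[ℝ] V))

/-- Geodesics, parametrised on `s` proportionally to arc length: `C²` curves of compatible complex
structures whose acceleration is normal to the tangent spaces. The metric is induced from the
Euclidean space of all operators, so this normality is the geodesic equation of the Levi-Civita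
connection. -/
def IsGeodesicOn {n : ℕ} (o : Orientation ℝ V (Fin (2 * n))) (γ : ℝ → V →L[ℝ] V)
    (s : Set ℝ) : Prop :=
  ContDiffOn ℝ 2 γ s ∧ (∀ t ∈ s, γ t ∈ compatibleJ o) ∧
    ∀ t ∈ s, ∀ A ∈ tangentJ (γ t), etaMetric (iteratedDerivWithin 2 γ s t) A = 0

/-- The length of a curve between the parameters `a` and `b`. -/
def curveLength (c : ℝ → V →L[ℝ] V) (a b : ℝ) : ℝ :=
  ∫ t in a..b, Real.sqrt (etaMetric (deriv c t) (deriv c t))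

/-- The curve `γ` is length-minimising, among `C¹` curves in the space of compatible complex
structures, between the parameters `0` and `s`. -/
def IsMinimizingUpTo {n : ℕ} (o : Orientation ℝ V (Fin (2 * n))) (γ : ℝ → V →L[ℝ] V)
    (s : ℝ) : Prop :=
  ∀ c : ℝ → V →L[ℝ] V, ContDiffOn ℝ 1 c (Set.Icc 0 1) →
    (∀ t ∈ Set.Icc (0 : ℝ) 1, c t ∈ compatibleJ o) → c 0 = γ 0 → c 1 = γ s →
      curveLength γ 0 s ≤ curveLength c 0 1

/-- The cut locus of `J₀`: the points `γ(s)`, `s > 0`, on geodesics `γ` from `J₀` such that `γ` is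
length-minimising up to `γ(s)` but fails to be so beyond `γ(s)`. -/
def cutLocus {n : ℕ} (o : Orientation ℝ V (Fin (2 * n))) (J₀ : V →L[ℝ] V) :
    Set (V →L[ℝ] V) :=
  {J | ∃ (γ : ℝ → V →L[ℝ] V) (s : ℝ), IsGeodesicOn o γ Set.univ ∧ γ 0 = J₀ ∧ 0 < s ∧ γ s = J ∧
    IsMinimizingUpTo o γ s ∧ ∀ t, s < t → ¬ IsMinimizingUpTo o γ t}

/-! ### Berezin integration -/

/-- The Berezin integral `∫ α ε_g` with `ε_g = e_1 ∧ ⋯ ∧ e_{2n}`: the pairing of the top degree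
component of `α` with `ε_g`. -/
def berezin {n : ℕ} (e : OrthonormalBasis (Fin (2 * n)) ℝ V) (α : FermFun V) : ℂ :=
  body (contractFrame (fun i => e i) α)

/-- The fermionic integral `∫ F(θ, χ) ε̃_g(χ)` over the second variable `χ`, for
`ε̃_g(χ) = iⁿ dχ^1 ⋯ dχ^{2n}`. With `N = 2n`, the convention is
`∫ χ^1 ⋯ χ^N dχ^1 ⋯ dχ^N = (-1)^{N(N-1)/2}`. -/
def fermIntegral {n : ℕ} (e : OrthonormalBasis (Fin (2 * n)) ℝ V) (F : FermFun (V × V)) :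
    FermFun V :=
  (Complex.I ^ n * (-1) ^ (2 * n * (2 * n - 1) / 2)) •
    pullback (LinearMap.inl ℝ V V) (contractFrame (fun i => ((0 : V), e i)) F)

/-! ### Pre-quantum and quantum Hilbert spaces -/

/-- The vector dual to a linear functional with respect to `g / 2`. -/
def sharpHalf : Module.Dual ℝ V →ₗ[ℝ] V :=
  (2 : ℝ) • ((InnerProductSpace.toDual ℝ V).symm.toLinearEquiv.toLinearMap ∘ₗ
    (LinearMap.toContinuousLinearMap : (V →ₗ[ℝ] ℝ) ≃ₗ[ℝ] (V →L[ℝ] ℝ)).toLinearMap)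

/-- The algebra homomorphism `α_1 ∧ ⋯ ∧ α_p ↦ ι_{α_1^♯} ∘ ⋯ ∘ ι_{α_p^♯}`, where `♯` is taken
with respect to `g / 2`. -/
def contractForm : ExteriorAlgebra ℝ (Module.Dual ℝ V) →ₐ[ℝ]
    Module.End ℝ (ExteriorAlgebra ℝ (Module.Dual ℝ V)) :=
  ExteriorAlgebra.lift ℝ
    ⟨(CliffordAlgebra.contractLeft (Q := (0 : QuadraticForm ℝ (Module.Dual ℝ V)))) ∘ₗ
        Module.Dual.eval ℝ V ∘ₗ sharpHalf,
      fun a => LinearMap.ext fun x =>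
        CliffordAlgebra.contractLeft_contractLeft (Module.Dual.eval ℝ V (sharpHalf a)) x⟩

/-- The Hodge star `⋆₀` of the metric `g / 2` and the orientation of `e`:
`⋆₀ (α_1 ∧ ⋯ ∧ α_p) = ι_{α_p^♯} ⋯ ι_{α_1^♯} vol`, where `vol = 2⁻ⁿ e^1 ∧ ⋯ ∧ e^{2n}` is the
volume form of `g / 2`. -/
def hodgeHalf {n : ℕ} (e : OrthonormalBasis (Fin (2 * n)) ℝ V) :
    FermFun V →ₗ[ℂ] FermFun V :=
  LinearMap.baseChange ℂ
    ((LinearMap.applyₗ ((1 / 2 : ℝ) ^ n •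
        ExteriorAlgebra.ιMulti ℝ (2 * n) (fun i => e.toBasis.coord i))) ∘ₗ
      contractForm.toLinearMap ∘ₗ
      (CliffordAlgebra.reverse (Q := (0 : QuadraticForm ℝ (Module.Dual ℝ V)))))

/-- Complex conjugation on `⋀(V*)^ℂ`. -/
def conjFun : FermFun V →ₗ[ℝ] FermFun V :=
  LinearMap.rTensor (ExteriorAlgebra ℝ (Module.Dual ℝ V)) Complex.conjAe.toLinearMap

/-- The Hermitian form `⟨ψ, ψ'⟩₀ = ∫ ψ̄ ∧ ⋆₀ψ' ε_g` on the pre-quantum Hilbert space `⋀(V*)^ℂ`. -/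
def herm {n : ℕ} (e : OrthonormalBasis (Fin (2 * n)) ℝ V) (ψ ψ' : FermFun V) : ℂ :=
  berezin e (conjFun ψ * hodgeHalf e ψ')

/-- The covariant derivative `∇_x = ι_x - ν(x)/2 ∧ ·`, `ν(x) = g(x, ·)`, for `x ∈ V`. -/
def nablaReal : V →ₗ[ℝ] Module.End ℂ (FermFun V) :=
  contract - (1 / 2 : ℝ) • (wedge ∘ₗ innerₗ V)

/-- The complex linear extension of `∇_x` to `x ∈ V^ℂ`. -/
def nabla : ℂ ⊗[ℝ] V →ₗ[ℂ] Module.End ℂ (FermFun V) :=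
  LinearMap.liftBaseChange ℂ nablaReal

/-- The subspace `V_J^{0,1}` of `V^ℂ` on which `J = -i`. -/
def V01 (J : V →L[ℝ] V) : Submodule ℂ (ℂ ⊗[ℝ] V) :=
  Module.End.eigenspace (LinearMap.baseChange ℂ (J : V →ₗ[ℝ] V)) (-Complex.I)

/-- The quantum Hilbert space `H_J`: all `ψ` with `∇_x ψ = 0` for `x ∈ V_J^{0,1}`. -/
def quantumSpace (J : V →L[ℝ] V) : Submodule ℂ (FermFun V) :=
  ⨅ x ∈ V01 J, LinearMap.ker (nabla x)

/-! ### Parallel transport -/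

/-- Parallel sections along `γ : [0,1] → compatibleJ o` of the bundle of the `H_J`, with the
connection given by orthogonal projection of the trivial connection: `ψ(t) ∈ H_{γ(t)}` and `ψ'(t)`
is orthogonal to `H_{γ(t)}`. The derivative in the finite-dimensional space `⋀(V*)^ℂ` is taken
componentwise, that is, after applying linear functionals. -/
def IsParallelAlong {n : ℕ} (e : OrthonormalBasis (Fin (2 * n)) ℝ V) (γ : ℝ → V →L[ℝ] V)
    (ψ : ℝ → FermFun V) : Prop :=
  ∀ t ∈ Set.Icc (0 : ℝ) 1, ψ t ∈ quantumSpace (γ t) ∧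
    ∃ ψ' : FermFun V,
      (∀ l : FermFun V →ₗ[ℂ] ℂ,
        HasDerivWithinAt (fun s => l (ψ s)) (l ψ') (Set.Icc 0 1) t) ∧
      ∀ φ ∈ quantumSpace (γ t), herm e φ ψ' = 0

/-- The linear map `U : H_{J₀} → H_{J₁}` is the parallel transport along `γ` from `J₀ = γ(0)` to
`J₁ = γ(1)`: through every `ψ₀ ∈ H_{J₀}` there is a parallel section, and `U ψ₀` is the only end
point of such sections. -/
def IsParallelTransport {n : ℕ} (e : OrthonormalBasis (Fin (2 * n)) ℝ V)
    (γ : ℝ → V →L[ℝ] V) {J₀ J₁ : V →L[ℝ] V}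
    (U : quantumSpace J₀ →ₗ[ℂ] quantumSpace J₁) : Prop :=
  ∀ (ψ₀ : quantumSpace J₀) (ψ₁ : FermFun V),
    (∃ ψ : ℝ → FermFun V, IsParallelAlong e γ ψ ∧ ψ 0 = ψ₀ ∧ ψ 1 = ψ₁) ↔ ψ₁ = U ψ₀

/-! ### States with fermionic parameters

Functions on `Π(V × V)` are functions `F(θ, χ)` of two independent fermionic vectors. The first is
the variable of the states and the second is a fermionic parameter. -/

/-- The fermionic vector `θ`. -/
def theta : V ⊗[ℝ] FermFun (V × V) := fermVec (LinearMap.fst ℝ V V)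

/-- The fermionic vector `χ`. -/
def chi : V ⊗[ℝ] FermFun (V × V) := fermVec (LinearMap.snd ℝ V V)

/-- The fermionic vector `θ` on its own, for functions of `θ` only. -/
def theta₁ : V ⊗[ℝ] FermFun V := fermVec LinearMap.id

/-- The map `ψ ⊗ a ↦ ψ(θ) a(χ)`, which identifies `H_J ⊗ ⋀(V*)^ℂ` with the states in `H_J`
depending on a fermionic parameter `χ`; it is injective. -/
def paramState (J : V →L[ℝ] V) :
    quantumSpace J ⊗[ℂ] FermFun V →ₗ[ℂ] FermFun (V × V) :=
  TensorProduct.lift ((LinearMap.mul ℂ (FermFun (V × V))).compl₁₂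
    ((pullback (LinearMap.fst ℝ V V)).toLinearMap ∘ₗ (quantumSpace J).subtype)
    (pullback (LinearMap.snd ℝ V V)).toLinearMap)

/-- The map `U`, extended linearly to states that depend on a fermionic parameter, sends `F`
to `F'`. -/
def SendsParamState {J₀ J₁ : V →L[ℝ] V} (U : quantumSpace J₀ →ₗ[ℂ] quantumSpace J₁)
    (F F' : FermFun (V × V)) : Prop :=
  (∃ T, paramState J₀ T = F) ∧
    ∀ T, paramState J₀ T = F → paramState J₁ (LinearMap.rTensor (FermFun V) U T) = F'

/-- The coherent state `c_J^α(θ) = exp[g(θ^{1,0}, ᾱ) - g(θ^{1,0}, θ^{0,1}) / 2]`, where the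
fermionic parameter `α ∈ ΠV_J^{1,0}` is written `α = χ_J^{1,0}`, so that `ᾱ = χ_J^{0,1}`. -/
def coherentState (J : V →L[ℝ] V) : FermFun (V × V) :=
  IsNilpotent.exp (fermInner (part10 J theta) (part01 J chi) -
    (1 / 2 : ℝ) • fermInner (part10 J theta) (part01 J theta))

/-- The exponent `(i/2) g(u, ((J₀ + J₁)/2)⁻¹ u)` for `u = θ_{J₁}^{1,0} - χ_{J₀}^{0,1}`. -/
def transportExponent (J₀ J₁ : V →L[ℝ] V) : FermFun (V × V) :=
  (Complex.I / 2) • fermInner (part10 J₁ theta - part01 J₀ chi)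
    (fermAct (Ring.inverse ((1 / 2 : ℝ) • (J₀ + J₁))) (part10 J₁ theta - part01 J₀ chi))

end FermionicTransport

end

open scoped TensorProduct

noncomputable section

namespace FermionicTransport

/-! ### Basic calculus of fermionic functions -/

section GrassmannLemmas

variable {W W' W'' : Type*} [AddCommGroup W] [Module ℝ W] [AddCommGroup W'] [Module ℝ W']
  [AddCommGroup W''] [Module ℝ W'']

/-! The following rules are instances of general ones, stated for fermionic functions so that
they can be used for rewriting. -/

/-! The operators ∇_x satisfy the Clifford relations {∇_x, ∇_y} = -g(x, y) and are skew-adjoint for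
the Hermitian form. Relative to J they split into creation operators c_x (the (1,0)-parts) and
annihilation operators d_x (the (0,1)-parts), with c_x adjoint to -d_x, and H_J is the space killed
by all d_x.

Geometry. The geodesic equation forces γ'γ⁻¹ to be constant, so J_t = exp(tB) J₀ with B skew and
anticommuting with J₀ (`geodesic_eq_flow`). Let β_i be the rotation angles of B. If some β_i were at
least π, put s = π / max β_i ≤ 1. Comparing angles on spheres shows that the geodesic minimises up
to s; beyond s a full turn can be subtracted from the fastest rotation, which gives a shorter curve
with the same end points. So γ(s) would be a cut point (`norm_lt_pi_of_notMem_cutLocus`). Hence all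
β_i < π, the operator 1 + exp(tB) is invertible for t in [0,1], and det((J₀ + J_t)/2) stays positive
by continuity.

Transport. Let T = tanh(tB/2). The space V^{0,1} of J_t is the graph of T over that of J₀, so
H_{J_t} is the space killed by all d_x + c_{Tx}, with c and d taken for J₀. For A(T) = ½ ∑ c(e_i)
c(T e_i) one has [d_x, A(T)] = -c_{Tx}, so e^{A(T)} maps H_{J₀} into H_{J_t}. Since T' = ½(1 - T²)B
and det^{1/4} has logarithmic derivative ⅛ tr(TB), the state ψ_t = det^{1/4} e^{A(T)} ψ solves ψ_t'
= G ψ_t with G = ¼ ∑ ∇(e_i) ∇(B e_i) (`hasWeakDeriv_transportOp`). In the splitting for J_t the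
mixed terms of G drop out, because B anticommutes with J_t; the dd-part kills H_{J_t} and the
cc-part maps it to its orthogonal complement (`herm_generator`). So ψ_t is parallel, and positivity
of the Hermitian form gives uniqueness (`IsParallelAlong.eq_of_eq`).

Formulas. On the coherent state, c_x acts as multiplication by -g(x^{1,0}, θ - χ), so e^{A(T)}
multiplies it by an explicit Gaussian (`exp_quadOp_coherent`), and `exponent_identity` brings the
exponent to the claimed form. The kernel exp g(θ - χ, χ^{0,1}) reproduces holomorphic functions
(`kernelOp_eq_self`), so every state in H_{J₀} is a fermionic superposition of coherent states, and
e^{A(T)} passes under the integral. -/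

@[simp]
theorem ferm_neg_mul (F G : FermFun W) : -F * G = -(F * G) := by exact neg_mul F G

@[simp]
theorem ferm_mul_neg (F G : FermFun W) : F * -G = -(F * G) := by exact mul_neg F G

@[simp]
theorem ferm_smul_mul (c : ℂ) (F G : FermFun W) : c • F * G = c • (F * G) := by
  exact smul_mul_assoc c F G

@[simp]
theorem ferm_mul_smul (c : ℂ) (F G : FermFun W) : F * c • G = c • (F * G) := by
  exact mul_smul_comm c F G

@[simp]
theorem ferm_real_smul_mul (c : ℝ) (F G : FermFun W) : c • F * G = c • (F * G) := by
  exact smul_mul_assoc c F G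

@[simp]
theorem ferm_mul_real_smul (c : ℝ) (F G : FermFun W) : F * c • G = c • (F * G) := by
  exact mul_smul_comm c F G

theorem ferm_coe_smul (r : ℝ) (F : FermFun W) : (r : ℂ) • F = r • F := by
  exact Complex.coe_smul r F

/-- The algebra is spanned over ℂ by words in linear functions. Contractions, pull-backs and the
Hodge star are all determined by one rule for multiplication by a linear function, so most
identities reduce to the last case. -/
theorem fermFun_induction {p : FermFun W → Prop} (one : p 1)
    (smul : ∀ (c : ℂ) x, p x → p (c • x)) (add : ∀ x y, p x → p y → p (x + y))
    (mul : ∀ α x, p x → p (linFun α * x)) (x : FermFun W) : p x := by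
  induction x using TensorProduct.induction_on with
  | zero => simpa using smul 0 1 one
  | add x y hx hy => exact add x y hx hy
  | tmul z F =>
    have key : ∀ F : ExteriorAlgebra ℝ (Module.Dual ℝ W), p ((1 : ℂ) ⊗ₜ F) := by
      intro F
      induction F using CliffordAlgebra.left_induction with
      | algebraMap r =>
        have h := smul (r : ℂ) 1 one
        rw [Algebra.TensorProduct.one_def, TensorProduct.smul_tmul', smul_eq_mul, mul_one] at h
        rw [Algebra.algebraMap_eq_smul_one, TensorProduct.tmul_smul, TensorProduct.smul_tmul']
        simpa using h
      | add x y hx hy => rw [TensorProduct.tmul_add]; exact add _ _ hx hy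
      | ι_mul x m hx =>
        have h := mul m _ hx
        have e : linFun m * ((1 : ℂ) ⊗ₜ[ℝ] x : FermFun W) =
          (1 : ℂ) ⊗ₜ[ℝ] (ExteriorAlgebra.ι ℝ m * x) := by
          change ((1 : ℂ) ⊗ₜ[ℝ] (ExteriorAlgebra.ι ℝ m) : FermFun W) * (1 : ℂ) ⊗ₜ[ℝ] x = _
          rw [Algebra.TensorProduct.tmul_mul_tmul, mul_one]
        rw [e] at h
        exact h
    have h := smul z _ (key F)
    rwa [TensorProduct.smul_tmul', smul_eq_mul, mul_one] at h

theorem linFun_apply (α : Module.Dual ℝ W) :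
    linFun α = ((1 : ℂ) ⊗ₜ[ℝ] (ExteriorAlgebra.ι ℝ α) : FermFun W) := rfl

theorem linFun_mul_tmul (α : Module.Dual ℝ W) (z : ℂ) (F : ExteriorAlgebra ℝ (Module.Dual ℝ W)) :
    linFun α * (z ⊗ₜ[ℝ] F : FermFun W) = z ⊗ₜ[ℝ] (ExteriorAlgebra.ι ℝ α * F) := by
  rw [linFun_apply, Algebra.TensorProduct.tmul_mul_tmul, one_mul]

theorem linFun_mul_self (α : Module.Dual ℝ W) : linFun α * linFun α = 0 := by
  rw [linFun_apply, Algebra.TensorProduct.tmul_mul_tmul, ExteriorAlgebra.ι_sq_zero,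
    TensorProduct.tmul_zero]

theorem linFun_mul_swap (α β : Module.Dual ℝ W) :
    linFun α * linFun β = -(linFun β * linFun α) := by
  have h := linFun_mul_self (α + β)
  rw [map_add, add_mul, mul_add, mul_add, linFun_mul_self, linFun_mul_self, zero_add,
    add_zero] at h
  exact eq_neg_of_add_eq_zero_left h

@[simp]
theorem pullback_linFun (f : W' →ₗ[ℝ] W) (α : Module.Dual ℝ W) :
    pullback f (linFun α) = linFun (α ∘ₗ f) := by
  rw [linFun_apply, pullback, Algebra.TensorProduct.map_tmul, ExteriorAlgebra.map_apply_ι]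
  rfl

theorem pullback_pullback (f : W' →ₗ[ℝ] W) (h : W'' →ₗ[ℝ] W') (F : FermFun W) :
    pullback h (pullback f F) = pullback (f ∘ₗ h) F := by
  induction F using fermFun_induction with
  | one => simp
  | smul c x hx => simp [hx]
  | add x y hx hy => simp [hx, hy]
  | mul α x hx => simp [hx, LinearMap.comp_assoc]

@[simp]
theorem pullback_id (F : FermFun W) : pullback LinearMap.id F = F := by
  induction F using fermFun_induction with
  | one => simp
  | smul c x hx => simp [hx]
  | add x y hx hy => simp [hx, hy]
  | mul α x hx => simp [hx]

/-- The grade involution of fermionic functions. -/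
def inv : FermFun W →ₐ[ℂ] FermFun W := pullback (-LinearMap.id)

@[simp]
theorem inv_linFun (α : Module.Dual ℝ W) : inv (linFun α) = -linFun α := by
  rw [inv, pullback_linFun, ← map_neg]
  congr 1
  ext x; simp

@[simp]
theorem inv_inv (F : FermFun W) : inv (inv F) = F := by
  rw [inv, pullback_pullback]
  convert pullback_id F
  ext x; simp

theorem pullback_inv (f : W' →ₗ[ℝ] W) (F : FermFun W) : pullback f (inv F) = inv (pullback f F) := by
  rw [inv, inv, pullback_pullback, pullback_pullback]
  congr 2
  ext x; simp

/-- Passing an odd generator costs one sign per degree of `F`, which the grade involution records.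
-/
theorem linFun_mul (α : Module.Dual ℝ W) (F : FermFun W) : linFun α * F = inv F * linFun α := by
  induction F using fermFun_induction with
  | one => simp
  | smul c x hx => simp [hx]
  | add x y hx hy => simp [mul_add, add_mul, hx, hy]
  | mul β x hx =>
    rw [map_mul, mul_assoc, ← hx, ← mul_assoc, linFun_mul_swap, inv_linFun, ferm_neg_mul,
      ferm_neg_mul, mul_assoc]

/-- Even elements pass every generator without a sign. This lets exponentials of quadratic functions
be treated as central factors. -/
theorem commute_of_inv_eq {F : FermFun W} (hF : inv F = F) (G : FermFun W) : Commute F G := by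
  induction G using fermFun_induction with
  | one => exact Commute.one_right _
  | smul c x hx => exact hx.smul_right c
  | add x y hx hy => exact hx.add_right hy
  | mul α x hx =>
    refine Commute.mul_right ?_ hx
    have := linFun_mul α F
    rw [hF] at this
    exact this.symm

theorem contract_tmul (w : W) (z : ℂ) (F : ExteriorAlgebra ℝ (Module.Dual ℝ W)) :
    contract w (z ⊗ₜ[ℝ] F : FermFun W) =
      z ⊗ₜ[ℝ] CliffordAlgebra.contractLeft (Q := (0 : QuadraticForm ℝ (Module.Dual ℝ W)))
        (Module.Dual.eval ℝ W w) F := rfl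

@[simp]
theorem contract_one (w : W) : contract w (1 : FermFun W) = 0 := by
  rw [Algebra.TensorProduct.one_def, contract_tmul, CliffordAlgebra.contractLeft_one,
    TensorProduct.tmul_zero]

theorem contract_linFun_mul (w : W) (α : Module.Dual ℝ W) (F : FermFun W) :
    contract w (linFun α * F) = α w • F - linFun α * contract w F := by
  induction F using TensorProduct.induction_on with
  | zero => simp
  | add x y hx hy => rw [mul_add, map_add, hx, hy, map_add, mul_add, smul_add]; abel
  | tmul z F =>
    rw [linFun_mul_tmul, contract_tmul, contract_tmul, linFun_mul_tmul]
    erw [CliffordAlgebra.contractLeft_ι_mul]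
    rw [TensorProduct.tmul_sub, TensorProduct.tmul_smul]
    rfl

@[simp]
theorem contract_linFun (w : W) (α : Module.Dual ℝ W) :
    contract w (linFun α) = α w • (1 : FermFun W) := by
  have := contract_linFun_mul w α 1
  simpa using this

@[simp]
theorem inv_real_smul (r : ℝ) (F : FermFun W) : inv (r • F) = r • inv F :=
  map_smul (inv.restrictScalars ℝ) r F

@[simp]
theorem pullback_real_smul (f : W' →ₗ[ℝ] W) (r : ℝ) (F : FermFun W) :
    pullback f (r • F) = r • pullback f F :=
  map_smul ((pullback f).restrictScalars ℝ) r F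

@[simp]
theorem contract_real_smul (w : W) (r : ℝ) (F : FermFun W) :
    contract w (r • F) = r • contract w F :=
  map_smul ((contract w).restrictScalars ℝ) r F

theorem contract_mul (w : W) (F G : FermFun W) :
    contract w (F * G) = contract w F * G + inv F * contract w G := by
  induction F using fermFun_induction with
  | one => simp
  | smul c x hx => simp [hx]
  | add x y hx hy => simp only [add_mul, map_add, hx, hy]; abel
  | mul α x hx =>
    rw [mul_assoc, contract_linFun_mul, hx, contract_linFun_mul, map_mul, inv_linFun, sub_mul,
      mul_add, ferm_real_smul_mul, mul_assoc, ferm_neg_mul, ferm_neg_mul, mul_assoc]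
    abel

theorem contract_pullback (f : W' →ₗ[ℝ] W) (w : W') (F : FermFun W) :
    contract w (pullback f F) = pullback f (contract (f w) F) := by
  induction F using fermFun_induction with
  | one => simp
  | smul c x hx => simp [hx]
  | add x y hx hy => simp [hx, hy]
  | mul α x hx =>
    rw [map_mul, pullback_linFun, contract_linFun_mul, hx, contract_linFun_mul, map_sub, map_mul,
      pullback_linFun, pullback_real_smul]
    rfl

theorem contract_inv (w : W) (F : FermFun W) : contract w (inv F) = -inv (contract w F) := by
  rw [inv, contract_pullback]
  simp

theorem contract_contract (v w : W) (F : FermFun W) :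
    contract v (contract w F) = -contract w (contract v F) := by
  induction F using fermFun_induction with
  | one => simp
  | smul c x hx => simp [hx]
  | add x y hx hy => simp only [map_add, hx, hy]; abel
  | mul α x hx =>
    simp only [contract_linFun_mul, map_sub, contract_real_smul, hx, ferm_mul_neg]
    abel

@[simp]
theorem contract_self (w : W) (F : FermFun W) : contract w (contract w F) = 0 := by
  have h := contract_contract w w F
  have h2 : (2 : ℂ) • contract w (contract w F) = 0 := by
    rw [two_smul]; nth_rewrite 1 [h]; exact neg_add_cancel _
  exact (smul_eq_zero.mp h2).resolve_left two_ne_zero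

@[simp]
theorem body_linFun (α : Module.Dual ℝ W) : body (linFun α) = 0 := by
  rw [linFun_apply, body, Algebra.TensorProduct.lift_tmul]
  simp [ExteriorAlgebra.algebraMapInv]

theorem body_pullback (f : W' →ₗ[ℝ] W) (F : FermFun W) : body (pullback f F) = body F := by
  induction F using fermFun_induction with
  | one => simp
  | smul c x hx => simp [hx]
  | add x y hx hy => simp [hx, hy]
  | mul α x hx => simp

theorem body_inv (F : FermFun W) : body (inv F) = body F := body_pullback _ F

/-- A function all of whose derivatives vanish is constant. -/
theorem eq_body_of_contract_eq_zero [FiniteDimensional ℝ W] {F : FermFun W}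
    (hF : ∀ w, contract w F = 0) : F = body F • 1 := by
  have h1 : pullback (0 : W →ₗ[ℝ] W) F = body F • 1 := by
    clear hF
    induction F using fermFun_induction with
    | one => simp
    | smul c x hx => simp [hx, mul_smul]
    | add x y hx hy => simp [hx, hy, add_smul]
    | mul α x hx => simp
  let b := Module.finBasis ℝ W
  -- each coordinate can be set to zero without changing the function
  have h2 : ∀ (F : FermFun W) (i), contract (b i) F = 0 →
      pullback (LinearMap.id - (LinearMap.toSpanSingleton ℝ W (b i)) ∘ₗ b.coord i) F = F := by
    intro F i
    -- Taylor expansion in one odd variable stops at first order: removing the coordinate `i`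
    -- subtracts only the term linear in it.
    have h3 : ∀ F : FermFun W,
        pullback (LinearMap.id - (LinearMap.toSpanSingleton ℝ W (b i)) ∘ₗ b.coord i) F =
          F - linFun (b.coord i) * contract (b i) F := by
      intro F
      induction F using fermFun_induction with
      | one => simp
      | smul c x hx => simp [hx, smul_sub]
      | add x y hx hy => simp only [map_add, hx, hy, mul_add]; abel
      | mul α x hx =>
        have : α ∘ₗ (LinearMap.id - (LinearMap.toSpanSingleton ℝ W (b i)) ∘ₗ b.coord i) =
            α - α (b i) • b.coord i := by
          ext x; simp [mul_comm]
        rw [map_mul, pullback_linFun, hx, this, contract_linFun_mul, map_sub, map_smul, sub_mul,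
          mul_sub, mul_sub, mul_sub, ferm_mul_real_smul, ferm_real_smul_mul,
          ferm_real_smul_mul, ← mul_assoc,
          ← mul_assoc (linFun (b.coord i)), ← mul_assoc (linFun (b.coord i)), linFun_mul_self,
          linFun_mul_swap (b.coord i) α, zero_mul, smul_zero, sub_zero, ferm_neg_mul]
        abel
    intro h
    rw [h3, h, mul_zero, sub_zero]
  have h4 : ∀ s : Finset (Fin (Module.finrank ℝ W)),
      pullback (LinearMap.id - ∑ i ∈ s, (LinearMap.toSpanSingleton ℝ W (b i)) ∘ₗ b.coord i) F
        = F := by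
    intro s
    induction s using Finset.induction_on with
    | empty => simp
    | insert i s hi ih =>
      rw [Finset.sum_insert hi]
      -- The coordinate projections annihilate each other, so erasing one more coordinate is a
      -- composition of substitutions.
      have : (LinearMap.id - (LinearMap.toSpanSingleton ℝ W (b i) ∘ₗ b.coord i +
            ∑ i ∈ s, LinearMap.toSpanSingleton ℝ W (b i) ∘ₗ b.coord i)) =
          (LinearMap.id - ∑ i ∈ s, LinearMap.toSpanSingleton ℝ W (b i) ∘ₗ b.coord i) ∘ₗ
          (LinearMap.id - (LinearMap.toSpanSingleton ℝ W (b i)) ∘ₗ b.coord i) := by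
        refine b.ext fun j => ?_
        have h5 : ∀ k, b.coord k (b i) = if k = i then 1 else 0 := fun k => by
          simp [Finsupp.single_apply, eq_comm]
        simp only [LinearMap.comp_apply, LinearMap.sub_apply, LinearMap.add_apply,
          LinearMap.id_apply, LinearMap.sum_apply, LinearMap.toSpanSingleton_apply, map_sub,
          map_smul, h5]
        have h6 : ∑ k ∈ s, (if k = i then (1 : ℝ) else 0) • b k = 0 := by
          refine Finset.sum_eq_zero fun k hk => ?_
          rw [if_neg (by rintro rfl; exact hi hk), zero_smul]
        rw [h6, sub_zero]; abel
      rw [this, ← pullback_pullback, ih, h2 F i (hF _)]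
  have h7 := (h4 Finset.univ).symm
  have h8 : (LinearMap.id - ∑ i, (LinearMap.toSpanSingleton ℝ W (b i)) ∘ₗ b.coord i) =
      (0 : W →ₗ[ℝ] W) := by
    ext x
    simp [LinearMap.sum_apply, b.sum_repr x]
  rw [h8, h1] at h7
  exact h7

/-- A linear operator that commutes with all derivatives on a subspace stable under derivatives
vanishes on it as soon as its body vanishes. -/
theorem eq_zero_of_commute_contract [FiniteDimensional ℝ W] (S : Submodule ℂ (FermFun W))
    (hS : ∀ w, ∀ F ∈ S, contract w F ∈ S)
    (D : FermFun W →ₗ[ℂ] FermFun W) (hD : ∀ w, ∀ F ∈ S, contract w (D F) = D (contract w F))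
    (hb : ∀ F ∈ S, body (D F) = 0) {F : FermFun W} (hF : F ∈ S) : D F = 0 := by
  let b := Module.finBasis ℝ W
  have step : ∀ F ∈ S, (∀ w, D (contract w F) = 0) → D F = 0 := by
    intro F hF h
    have := eq_body_of_contract_eq_zero (F := D F) (fun w => by rw [hD w F hF, h])
    rw [this, hb F hF, zero_smul]
  -- contraction with all basis vectors of a finite set
  have key : ∀ s : Finset (Fin (Module.finrank ℝ W)), ∀ F ∈ S,
      (∀ i ∉ s, contract (b i) F = 0) → D F = 0 := by
    intro s
    induction s using Finset.strongInduction with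
    | H s ih =>
      intro F hF h
      refine step F hF fun w => ?_
      have hb' : ∀ i, D (contract (b i) F) = 0 := by
        intro i
        by_cases hi : i ∈ s
        -- `s` collects the variables on which `F` may depend; a derivative along `b i` no longer
        -- depends on the variable `i`.
        · refine ih (s.erase i) (Finset.erase_ssubset hi) _ (hS _ _ hF) fun j hj => ?_
          by_cases hji : j = i
          · rw [hji, contract_self]
          · rw [contract_contract, h j (fun hjs => hj (Finset.mem_erase.mpr ⟨hji, hjs⟩)),
              map_zero, neg_zero]
        · rw [h i hi, map_zero]
      rw [← b.sum_repr w, map_sum, LinearMap.sum_apply, map_sum]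
      refine Finset.sum_eq_zero fun i _ => ?_
      rw [map_smul, LinearMap.smul_apply, ← ferm_coe_smul, map_smul, hb', smul_zero]
  exact key Finset.univ F hF fun i hi => absurd (Finset.mem_univ i) hi

end GrassmannLemmas

end FermionicTransport

end

open scoped TensorProduct

noncomputable section

set_option linter.unusedSectionVars false

namespace FermionicTransport

/-! ### Quadratic functions and their exponentials -/

section Quadratic

variable {W W' : Type*} [AddCommGroup W] [Module ℝ W] [AddCommGroup W'] [Module ℝ W']

/-- The fermionic functions of degree two. -/
def quad : Submodule ℂ (FermFun W) :=
  Submodule.span ℂ {F | ∃ α β : Module.Dual ℝ W, F = linFun α * linFun β}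

theorem linFun_mul_mem_quad (α β : Module.Dual ℝ W) : linFun α * linFun β ∈ quad :=
  Submodule.subset_span ⟨α, β, rfl⟩

@[elab_as_elim]
theorem quad_induction {p : (q : FermFun W) → q ∈ quad → Prop} (zero : p 0 quad.zero_mem)
    (mul : ∀ α β, p (linFun α * linFun β) (linFun_mul_mem_quad α β))
    (add : ∀ x (hx : x ∈ quad) y (hy : y ∈ quad), p x hx → p y hy → p (x + y) (quad.add_mem hx hy))
    (smul : ∀ (c : ℂ) x (hx : x ∈ quad), p x hx → p (c • x) (quad.smul_mem c hx))
    {q : FermFun W} (hq : q ∈ quad) : p q hq := by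
  induction hq using Submodule.span_induction with
  | mem x h => obtain ⟨α, β, rfl⟩ := h; exact mul α β
  | zero => exact zero
  | add x y hx hy h1 h2 => exact add x hx y hy h1 h2
  | smul c x hx h => exact smul c x hx h

theorem inv_quad {q : FermFun W} (hq : q ∈ quad) : inv q = q := by
  induction hq using quad_induction with
  | zero => simp
  | mul α β => simp
  | add x hx y hy h1 h2 => simp [h1, h2]
  | smul c x hx h => simp [h]

theorem commute_quad {q : FermFun W} (hq : q ∈ quad) (F : FermFun W) : Commute q F :=
  commute_of_inv_eq (inv_quad hq) F

/-- A product of two odd generators squares to zero, and quadratic functions are central, so sums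
remain nilpotent. All Gaussians below are therefore finite sums. -/
theorem isNilpotent_quad {q : FermFun W} (hq : q ∈ quad) : IsNilpotent q := by
  induction hq using quad_induction with
  | zero => exact IsNilpotent.zero
  | mul α β =>
    refine ⟨2, ?_⟩
    rw [pow_two, mul_assoc, ← mul_assoc (linFun β), linFun_mul_swap β α, ferm_neg_mul,
      ferm_mul_neg, mul_assoc, linFun_mul_self]
    simp
  | add x hx y hy h1 h2 => exact (commute_quad hx y).isNilpotent_add h1 h2
  | smul c x hx h => exact h.smul c

theorem pullback_mem_quad (f : W' →ₗ[ℝ] W) {q : FermFun W} (hq : q ∈ quad) :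
    pullback f q ∈ quad := by
  induction hq using quad_induction with
  | zero => simp
  | mul α β => rw [map_mul, pullback_linFun, pullback_linFun]; exact linFun_mul_mem_quad _ _
  | add x hx y hy h1 h2 => rw [map_add]; exact quad.add_mem h1 h2
  | smul c x hx h => rw [map_smul]; exact quad.smul_mem _ h

theorem body_quad {q : FermFun W} (hq : q ∈ quad) : body q = 0 := by
  induction hq using quad_induction with
  | zero => simp
  | mul α β => simp
  | add x hx y hy h1 h2 => simp [h1, h2]
  | smul c x hx h => simp [h]

theorem exp_add_quad {p q : FermFun W} (hp : p ∈ quad) (hq : q ∈ quad) :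
    IsNilpotent.exp (p + q) = IsNilpotent.exp p * IsNilpotent.exp q :=
  IsNilpotent.exp_add_of_commute (commute_quad hp q) (isNilpotent_quad hp) (isNilpotent_quad hq)

theorem pullback_exp (f : W' →ₗ[ℝ] W) {q : FermFun W} (hq : q ∈ quad) :
    pullback f (IsNilpotent.exp q) = IsNilpotent.exp (pullback f q) :=
  IsNilpotent.map_exp (isNilpotent_quad hq) (pullback f)

theorem inv_exp {q : FermFun W} (hq : q ∈ quad) : inv (IsNilpotent.exp q) = IsNilpotent.exp q := by
  rw [inv, pullback_exp _ hq]
  exact congrArg _ (inv_quad hq)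

theorem commute_exp_quad {q : FermFun W} (hq : q ∈ quad) (F : FermFun W) :
    Commute (IsNilpotent.exp q) F :=
  commute_of_inv_eq (inv_exp hq) F

theorem body_exp {q : FermFun W} (hq : q ∈ quad) : body (IsNilpotent.exp q) = 1 := by
  have h := IsNilpotent.map_exp (isNilpotent_quad hq) (body (W := W))
  rw [h, body_quad hq, IsNilpotent.exp_zero]

theorem contract_pow_quad (w : W) {q : FermFun W} (hq : q ∈ quad) (k : ℕ) :
    contract w (q ^ (k + 1)) = ((k : ℂ) + 1) • (contract w q * q ^ k) := by
  induction k with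
  | zero => simp
  | succ k ih =>
    rw [pow_succ', contract_mul, ih, inv_quad hq, ferm_mul_smul, ← mul_assoc,
      (commute_quad hq (contract w q)).eq, mul_assoc, ← pow_succ']
    push_cast
    module

/-- The nilpotent exponential has rational coefficients; complex ones are needed to apply ℂ-linear
maps term by term. Any exponent `k` that kills `a` may be used, so two series can be truncated
independently. -/
theorem exp_eq_sum_complex {A : Type*} [Ring A] [Algebra ℂ A] [Module ℚ A] {a : A} {k : ℕ}
    (h : a ^ k = 0) :
    IsNilpotent.exp a = ∑ i ∈ Finset.range k, ((i.factorial : ℂ)⁻¹) • a ^ i := by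
  rw [IsNilpotent.exp_eq_sum h]
  refine Finset.sum_congr rfl fun i _ => ?_
  rw [← Rat.cast_smul_eq_qsmul ℂ]
  push_cast
  rfl

theorem contract_exp_quad (w : W) {q : FermFun W} (hq : q ∈ quad) :
    contract w (IsNilpotent.exp q) = contract w q * IsNilpotent.exp q := by
  obtain ⟨k, hk⟩ := isNilpotent_quad hq
  -- The left series is cut one term later than the right one, because differentiation lowers the
  -- power by one.
  have hk' : q ^ (k + 1) = 0 := by rw [pow_succ, hk, zero_mul]
  have h1 : contract w (IsNilpotent.exp q) =
      contract w (∑ i ∈ Finset.range (k + 1), ((i.factorial : ℂ)⁻¹) • q ^ i) :=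
    congrArg _ (exp_eq_sum_complex hk')
  have h2 : IsNilpotent.exp q = ∑ i ∈ Finset.range k, ((i.factorial : ℂ)⁻¹) • q ^ i :=
    exp_eq_sum_complex hk
  rw [h1, h2, Finset.sum_range_succ', map_add, map_sum, Finset.mul_sum, pow_zero, map_smul,
    contract_one, smul_zero, add_zero]
  refine Finset.sum_congr rfl fun i _ => ?_
  rw [map_smul, contract_pow_quad w hq, smul_smul, ferm_mul_smul, Nat.factorial_succ]
  congr 1
  have : (i : ℂ) + 1 ≠ 0 := Nat.cast_add_one_ne_zero i
  push_cast
  field_simp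

theorem contract_exp_mul (w : W) {q : FermFun W} (hq : q ∈ quad) (F : FermFun W) :
    contract w (IsNilpotent.exp q * F) =
      IsNilpotent.exp q * (contract w q * F + contract w F) := by
  rw [contract_mul, contract_exp_quad w hq, inv_exp hq, mul_add, ← mul_assoc,
    (commute_exp_quad hq (contract w q)).eq]

end Quadratic

/-! ### Linear and quadratic functions of fermionic vectors -/

section Vectors

variable {V : Type*} [NormedAddCommGroup V] [InnerProductSpace ℝ V] [FiniteDimensional ℝ V]
variable {W W' : Type*} [AddCommGroup W] [Module ℝ W] [AddCommGroup W'] [Module ℝ W']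
variable {ι : Type*} [Fintype ι]

/-- The function `g(x, u)` of the fermionic vector `u` given by the linear map `f`. -/
def cov (f : W →ₗ[ℝ] V) : V →ₗ[ℝ] FermFun W :=
  linFun ∘ₗ f.dualMap ∘ₗ innerₗ V

theorem cov_apply (f : W →ₗ[ℝ] V) (x : V) : cov f x = linFun (innerₗ V x ∘ₗ f) := rfl

theorem cov_sub (f h : W →ₗ[ℝ] V) (x : V) : cov (f - h) x = cov f x - cov h x := by
  rw [cov_apply, cov_apply, cov_apply, ← map_sub, LinearMap.comp_sub]

@[simp]
theorem contract_cov (f : W →ₗ[ℝ] V) (w : W) (x : V) :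
    contract w (cov f x) = (inner ℝ x (f w)) • (1 : FermFun W) := by
  rw [cov_apply, contract_linFun]; rfl

theorem contract_cov_mul (f : W →ₗ[ℝ] V) (w : W) (x : V) (F : FermFun W) :
    contract w (cov f x * F) = (inner ℝ x (f w)) • F - cov f x * contract w F := by
  rw [cov_apply, contract_linFun_mul]; rfl

@[simp]
theorem pullback_cov (f : W →ₗ[ℝ] V) (h : W' →ₗ[ℝ] W) (x : V) :
    pullback h (cov f x) = cov (f ∘ₗ h) x := by
  rw [cov_apply, pullback_linFun, LinearMap.comp_assoc]; rfl

@[simp]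
theorem inv_cov (f : W →ₗ[ℝ] V) (x : V) : inv (cov f x) = -cov f x := by
  rw [cov_apply, inv_linFun]

@[simp]
theorem body_cov (f : W →ₗ[ℝ] V) (x : V) : body (cov f x) = 0 := by
  rw [cov_apply, body_linFun]

theorem cov_mul_swap (f h : W →ₗ[ℝ] V) (x y : V) : cov f x * cov h y = -(cov h y * cov f x) :=
  linFun_mul_swap _ _

/-- The coevaluation element does not depend on the basis. Expanding the arbitrary basis in its
definition in an orthonormal one leaves the coordinates g(b_i, ·). -/
theorem fermVec_eq_sum (b : OrthonormalBasis ι ℝ V) (f : W →ₗ[ℝ] V) :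
    fermVec f = ∑ i, b i ⊗ₜ[ℝ] cov f (b i) := by
  have hb : ∀ x : V, ∑ i, inner ℝ (b i) x • b i = x := fun x => b.sum_repr' x
  let v := Module.Basis.ofVectorSpace ℝ V
  rw [fermVec, coevaluation_apply_one, map_sum]
  have : ∀ j, LinearMap.lTensor V (linFun ∘ₗ f.dualMap) (v j ⊗ₜ[ℝ] v.coord j) =
      ∑ i, b i ⊗ₜ[ℝ] (inner ℝ (b i) (v j) • linFun (v.coord j ∘ₗ f)) := by
    intro j
    rw [LinearMap.lTensor_tmul]
    nth_rewrite 1 [← hb (v j)]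
    rw [TensorProduct.sum_tmul]
    refine Finset.sum_congr rfl fun i _ => ?_
    rw [TensorProduct.smul_tmul]
    rfl
  refine (Finset.sum_congr rfl fun j _ => this j).trans ?_
  rw [Finset.sum_comm]
  refine Finset.sum_congr rfl fun i _ => ?_
  rw [← TensorProduct.tmul_sum, cov_apply]
  congr 1
  rw [← Finset.sum_congr rfl fun j _ => map_smul linFun (inner ℝ (b i) (v j)) (v.coord j ∘ₗ f),
    ← map_sum]
  congr 1
  ext w
  simp only [LinearMap.sum_apply, LinearMap.smul_apply, LinearMap.comp_apply, innerₗ_apply_apply]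
  conv_rhs => rw [← v.sum_repr (f w), inner_sum]
  refine Finset.sum_congr rfl fun j _ => ?_
  rw [inner_smul_right, smul_eq_mul, mul_comm]
  rfl

/-- The bilinear function `g(u, M u')` of the fermionic vectors given by `f` and `h`. -/
def gform (f h : W →ₗ[ℝ] V) (M : V →L[ℝ] V) : FermFun W :=
  fermInner (fermVec f) (fermAct M (fermVec h))

theorem fermInner_tmul (x y : V) (F G : FermFun W) :
    fermInner (x ⊗ₜ[ℝ] F) (y ⊗ₜ[ℝ] G) = inner ℝ x y • (F * G) := rfl

theorem gform_eq_sum (b : OrthonormalBasis ι ℝ V) (f h : W →ₗ[ℝ] V) (M : V →L[ℝ] V) :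
    gform f h M = ∑ i, cov f (M (b i)) * cov h (b i) := by
  have hb : ∀ x : V, ∑ i, inner ℝ (b i) x • b i = x := fun x => b.sum_repr' x
  rw [gform, fermVec_eq_sum b, fermVec_eq_sum b, map_sum, map_sum, map_sum]
  refine Finset.sum_congr rfl fun j _ => ?_
  have : fermAct (W := W) M (b j ⊗ₜ[ℝ] cov h (b j)) = M (b j) ⊗ₜ[ℝ] cov h (b j) := rfl
  rw [this, LinearMap.sum_apply]
  simp only [fermInner_tmul]
  nth_rewrite 2 [← hb (M (b j))]
  rw [map_sum, Finset.sum_mul]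
  refine Finset.sum_congr rfl fun i _ => ?_
  rw [map_smul, ferm_real_smul_mul]

theorem gform_mem_quad (f h : W →ₗ[ℝ] V) (M : V →L[ℝ] V) : gform f h M ∈ quad := by
  rw [gform_eq_sum (stdOrthonormalBasis ℝ V)]
  exact Submodule.sum_mem _ fun i _ => linFun_mul_mem_quad _ _

theorem gform_add (f h : W →ₗ[ℝ] V) (M N : V →L[ℝ] V) :
    gform f h (M + N) = gform f h M + gform f h N := by
  simp only [gform_eq_sum (stdOrthonormalBasis ℝ V), add_apply, map_add,
    add_mul, Finset.sum_add_distrib]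

theorem gform_neg (f h : W →ₗ[ℝ] V) (M : V →L[ℝ] V) : gform f h (-M) = -gform f h M := by
  simp only [gform_eq_sum (stdOrthonormalBasis ℝ V), neg_apply, map_neg,
    ferm_neg_mul, Finset.sum_neg_distrib]

theorem gform_sub (f h : W →ₗ[ℝ] V) (M N : V →L[ℝ] V) :
    gform f h (M - N) = gform f h M - gform f h N := by
  rw [sub_eq_add_neg, gform_add, gform_neg, ← sub_eq_add_neg]

/-- In the tensor ∑ b_i ⊗ b_i an operator may change slots at the price of becoming its adjoint. The
basis sums of this file, both traces and quadratic operators, are manipulated by this rule. -/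
theorem sum_adjoint {E : Type*} [AddCommGroup E] [Module ℝ E] (b : OrthonormalBasis ι ℝ V)
    (φ : V →ₗ[ℝ] V →ₗ[ℝ] E) {A B : V →L[ℝ] V} (h : ∀ x y, inner ℝ (A x) y = inner ℝ x (B y)) :
    ∑ i, φ (b i) (A (b i)) = ∑ i, φ (B (b i)) (b i) := by
  have hb : ∀ x : V, ∑ i, inner ℝ (b i) x • b i = x := fun x => b.sum_repr' x
  have h1 : ∀ i, φ (b i) (A (b i)) = ∑ j, inner ℝ (b j) (A (b i)) • φ (b i) (b j) := by
    intro i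
    nth_rewrite 1 [← hb (A (b i))]
    rw [map_sum]
    simp only [map_smul]
  have h2 : ∀ i, φ (B (b i)) (b i) = ∑ j, inner ℝ (b j) (B (b i)) • φ (b j) (b i) := by
    intro i
    nth_rewrite 1 [← hb (B (b i))]
    rw [map_sum, LinearMap.sum_apply]
    simp only [map_smul, LinearMap.smul_apply]
  rw [Finset.sum_congr rfl fun i _ => h1 i, Finset.sum_congr rfl fun i _ => h2 i,
    Finset.sum_comm]
  refine Finset.sum_congr rfl fun i _ => Finset.sum_congr rfl fun j _ => ?_
  rw [real_inner_comm, h]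

theorem fermAct_fermAct (A B : V →L[ℝ] V) (u : V ⊗[ℝ] FermFun W) :
    fermAct A (fermAct B u) = fermAct (A * B) u := by
  rw [fermAct, fermAct, ← LinearMap.comp_apply, ← LinearMap.rTensor_comp]; rfl

theorem fermAct_fermI (A : V →L[ℝ] V) (u : V ⊗[ℝ] FermFun W) :
    fermAct A (fermI u) = fermI (fermAct A u) := by
  rw [fermAct, fermI, ← LinearMap.comp_apply, ← LinearMap.comp_apply,
    LinearMap.rTensor_comp_lTensor, LinearMap.lTensor_comp_rTensor]

theorem fermInner_fermI_left (u v : V ⊗[ℝ] FermFun W) :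
    fermInner (fermI u) v = Complex.I • fermInner u v := by
  induction u using TensorProduct.induction_on with
  | zero => simp
  | add x y hx hy => simp only [map_add, LinearMap.add_apply, hx, hy, smul_add]
  | tmul x F =>
    induction v using TensorProduct.induction_on with
    | zero => simp
    | add x y hx hy => simp only [map_add, hx, hy, smul_add]
    | tmul y G =>
      have : fermI (x ⊗ₜ[ℝ] F) = x ⊗ₜ[ℝ] (Complex.I • F) := rfl
      rw [this, fermInner_tmul, fermInner_tmul, ferm_smul_mul, ← ferm_coe_smul, ← ferm_coe_smul,
        smul_smul, smul_smul, mul_comm]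

theorem fermInner_fermI_right (u v : V ⊗[ℝ] FermFun W) :
    fermInner u (fermI v) = Complex.I • fermInner u v := by
  induction u using TensorProduct.induction_on with
  | zero => simp
  | add x y hx hy => simp only [map_add, LinearMap.add_apply, hx, hy, smul_add]
  | tmul x F =>
    induction v using TensorProduct.induction_on with
    | zero => simp
    | add x y hx hy => simp only [map_add, hx, hy, smul_add]
    | tmul y G =>
      have : fermI (y ⊗ₜ[ℝ] G) = y ⊗ₜ[ℝ] (Complex.I • G) := rfl
      rw [this, fermInner_tmul, fermInner_tmul, ferm_mul_smul, ← ferm_coe_smul, ← ferm_coe_smul,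
        smul_smul, smul_smul, mul_comm]

theorem fermInner_fermAct_left {A B : V →L[ℝ] V} (h : ∀ x y, inner ℝ (A x) y = inner ℝ x (B y))
    (u v : V ⊗[ℝ] FermFun W) : fermInner (fermAct A u) v = fermInner u (fermAct B v) := by
  induction u using TensorProduct.induction_on with
  | zero => simp
  | add x y hx hy => simp only [map_add, LinearMap.add_apply, hx, hy]
  | tmul x F =>
    induction v using TensorProduct.induction_on with
    | zero => simp
    | add x y hx hy => simp only [map_add, hx, hy]
    | tmul y G =>
      change fermInner (A x ⊗ₜ[ℝ] F) (y ⊗ₜ[ℝ] G) = fermInner (x ⊗ₜ[ℝ] F) (B y ⊗ₜ[ℝ] G)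
      rw [fermInner_tmul, fermInner_tmul, h]

/-- Exchanging two odd vectors transposes the operator and costs a sign. Hence skew operators give
symmetric pairings of odd vectors, and symmetric operators give antisymmetric ones. -/
theorem gform_swap {A B : V →L[ℝ] V} (h : ∀ x y, inner ℝ (A x) y = inner ℝ x (B y))
    (f k : W →ₗ[ℝ] V) : gform f k A = -gform k f B := by
  let b := stdOrthonormalBasis ℝ V
  let φ : V →ₗ[ℝ] V →ₗ[ℝ] FermFun W :=
    ((LinearMap.mul ℝ (FermFun W)).compl₁₂ (cov k) (cov f))
  have h1 := sum_adjoint b φ h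
  rw [gform_eq_sum b, gform_eq_sum b]
  change ∑ i, cov k (b i) * cov f (A (b i)) = ∑ i, cov k (B (b i)) * cov f (b i) at h1
  rw [← h1, ← Finset.sum_neg_distrib]
  exact Finset.sum_congr rfl fun i _ => cov_mul_swap _ _ _ _

theorem pullback_gform (f h : W →ₗ[ℝ] V) (k : W' →ₗ[ℝ] W) (M : V →L[ℝ] V) :
    pullback k (gform f h M) = gform (f ∘ₗ k) (h ∘ₗ k) M := by
  simp only [gform_eq_sum (stdOrthonormalBasis ℝ V), map_sum, map_mul, pullback_cov]

theorem gform_sub_sub (f h : W →ₗ[ℝ] V) (M : V →L[ℝ] V) :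
    gform (f - h) (f - h) M =
      gform f f M - gform f h M - gform h f M + gform h h M := by
  simp only [gform_eq_sum (stdOrthonormalBasis ℝ V), cov_sub, sub_mul, mul_sub,
    Finset.sum_sub_distrib]
  abel

theorem sum_cov_mul_cov {A B C : V →L[ℝ] V} (b : OrthonormalBasis ι ℝ V)
    (h : ∀ x y, inner ℝ (B x) y = inner ℝ x (C y)) (f k : W →ₗ[ℝ] V) :
    ∑ i, cov f (A (b i)) * cov k (B (b i)) = gform f k (A * C) := by
  let φ : V →ₗ[ℝ] V →ₗ[ℝ] FermFun W :=
    ((LinearMap.mul ℝ (FermFun W)).compl₁₂ (cov f ∘ₗ (A : V →ₗ[ℝ] V)) (cov k))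
  have h1 := sum_adjoint b φ h
  change ∑ i, cov f (A (b i)) * cov k (B (b i)) = ∑ i, cov f (A (C (b i))) * cov k (b i) at h1
  rw [h1, gform_eq_sum b]
  rfl

/-- The derivative of `g(u, M u')` along `w`. -/
theorem contract_gform {A B : V →L[ℝ] V} (h : ∀ x y, inner ℝ (A x) y = inner ℝ x (B y))
    (f k : W →ₗ[ℝ] V) (w : W) :
    contract w (gform f k A) = cov k (B (f w)) - cov f (A (k w)) := by
  let b := stdOrthonormalBasis ℝ V
  have hb : ∀ x : V, ∑ i, inner ℝ (b i) x • b i = x := fun x => b.sum_repr' x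
  rw [gform_eq_sum b, map_sum]
  have : ∀ i, contract w (cov f (A (b i)) * cov k (b i)) =
      cov k (inner ℝ (b i) (B (f w)) • b i) - cov f (A (inner ℝ (b i) (k w) • b i)) := by
    intro i
    rw [contract_cov_mul, contract_cov, h, map_smul, map_smul, map_smul, ferm_mul_real_smul,
      mul_one]
  rw [Finset.sum_congr rfl fun i _ => this i, Finset.sum_sub_distrib, ← map_sum, ← map_sum,
    ← map_sum, hb, hb]

end Vectors

end FermionicTransport

end

open scoped TensorProduct

noncomputable section

set_option linter.unusedSectionVars false

namespace FermionicTransport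

/-! ### Creation and annihilation operators -/

/-- If the commutator `r` of `d` with `a` commutes with `a`, then the commutator with `d` acts on
power series in `a` as differentiation times `r`. -/
theorem mul_exp_of_mul_eq {E : Type*} [Ring E] [Algebra ℂ E] [Module ℚ E] {a d r : E}
    (ha : IsNilpotent a) (hr : Commute r a) (h : d * a = a * d + r) :
    d * IsNilpotent.exp a = IsNilpotent.exp a * d + r * IsNilpotent.exp a := by
  obtain ⟨k, hk⟩ := ha
  have hk' : a ^ (k + 1) = 0 := by rw [pow_succ, hk, zero_mul]
  have hp : ∀ n : ℕ, d * a ^ (n + 1) = a ^ (n + 1) * d + ((n : ℂ) + 1) • (r * a ^ n) := by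
    intro n
    induction n with
    | zero => simp [h]
    | succ n ih =>
      have e : d * a ^ (n + 1 + 1) = d * a ^ (n + 1) * a := by rw [pow_succ _ (n + 1), mul_assoc]
      rw [e, ih, add_mul, mul_assoc, h, mul_add, ← mul_assoc, smul_mul_assoc,
        mul_assoc r, ← pow_succ, ← pow_succ, ← (hr.pow_right (n + 1)).eq]
      push_cast
      module
  have h1 : IsNilpotent.exp a =
      ∑ i ∈ Finset.range (k + 1), ((i.factorial : ℂ)⁻¹) • a ^ i := exp_eq_sum_complex hk'
  have h2 : IsNilpotent.exp a = ∑ i ∈ Finset.range k, ((i.factorial : ℂ)⁻¹) • a ^ i :=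
    exp_eq_sum_complex hk
  have h3 : r * IsNilpotent.exp a = ∑ i ∈ Finset.range k, ((i.factorial : ℂ)⁻¹) • (r * a ^ i) := by
    rw [h2, Finset.mul_sum]
    exact Finset.sum_congr rfl fun i _ => mul_smul_comm _ _ _
  rw [h3, h1, Finset.mul_sum, Finset.sum_mul, Finset.sum_range_succ',
    Finset.sum_range_succ' (n := k), add_right_comm, ← Finset.sum_add_distrib]
  congr 1
  · refine Finset.sum_congr rfl fun i _ => ?_
    rw [mul_smul_comm, hp, smul_add, smul_mul_assoc, smul_smul, Nat.factorial_succ]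
    congr 2
    have : (i : ℂ) + 1 ≠ 0 := Nat.cast_add_one_ne_zero i
    push_cast
    field_simp
  · simp

section Operators

-- `E` comes with its own real structure, tied to the complex one by a scalar tower; the derived
-- structure would compete with it.
attribute [-instance] Module.complexToReal Algebra.complexToReal

variable {V : Type*} [NormedAddCommGroup V] [InnerProductSpace ℝ V] [FiniteDimensional ℝ V]
variable {E : Type*} [Ring E] [Algebra ℂ E] [Module ℝ E] [IsScalarTower ℝ ℂ E]
variable {ι : Type*} [Fintype ι]

theorem coe_smul_eq (r : ℝ) (a : E) : (r : ℂ) • a = r • a :=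
  algebraMap_smul ℂ r a

/-- The combination `x ↦ (N x + z N (J x)) / 2`. -/
def halfOp (z : ℂ) (N : V →ₗ[ℝ] E) (J : V →L[ℝ] V) : V →ₗ[ℝ] E where
  toFun x := (1 / 2 : ℂ) • (N x + z • N (J x))
  map_add' x y := by simp only [map_add]; module
  map_smul' r x := by
    simp only [map_smul, ← coe_smul_eq, RingHom.id_apply]; module

/-- The `(1,0)`-part of a family of operators: `x ↦ N (x - i J x) / 2`. -/
def creat (N : V →ₗ[ℝ] E) (J : V →L[ℝ] V) : V →ₗ[ℝ] E := halfOp (-Complex.I) N J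

/-- The `(0,1)`-part of a family of operators: `x ↦ N (x + i J x) / 2`. -/
def annih (N : V →ₗ[ℝ] E) (J : V →L[ℝ] V) : V →ₗ[ℝ] E := halfOp Complex.I N J

theorem creat_apply (N : V →ₗ[ℝ] E) (J : V →L[ℝ] V) (x : V) :
    creat N J x = (1 / 2 : ℂ) • (N x + (-Complex.I) • N (J x)) := rfl

theorem annih_apply (N : V →ₗ[ℝ] E) (J : V →L[ℝ] V) (x : V) :
    annih N J x = (1 / 2 : ℂ) • (N x + Complex.I • N (J x)) := rfl

/-- The bilinear map `(x, y) ↦ φ(x) ψ(y)`. -/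
def mulForm (φ ψ : V →ₗ[ℝ] E) : V →ₗ[ℝ] V →ₗ[ℝ] E :=
  LinearMap.mk₂ ℝ (fun x y => φ x * ψ y) (fun x y z => by rw [map_add, add_mul])
    (fun r x y => by rw [map_smul, ← coe_smul_eq, ← coe_smul_eq, smul_mul_assoc])
    (fun x y z => by rw [map_add, mul_add])
    (fun r x y => by rw [map_smul, ← coe_smul_eq, ← coe_smul_eq, mul_smul_comm])

theorem creat_add_annih (N : V →ₗ[ℝ] E) (J : V →L[ℝ] V) (x : V) :
    creat N J x + annih N J x = N x := by
  rw [creat_apply, annih_apply]; module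

theorem creat_J (N : V →ₗ[ℝ] E) {J : V →L[ℝ] V} (hJ : ∀ x, J (J x) = -x) (x : V) :
    creat N J (J x) = Complex.I • creat N J x := by
  rw [creat_apply, creat_apply, hJ, map_neg]
  match_scalars
  · linear_combination (1 / 2 : ℂ) * Complex.I_mul_I
  · ring

theorem annih_J (N : V →ₗ[ℝ] E) {J : V →L[ℝ] V} (hJ : ∀ x, J (J x) = -x) (x : V) :
    annih N J (J x) = -(Complex.I • annih N J x) := by
  rw [annih_apply, annih_apply, hJ, map_neg]
  match_scalars
  · linear_combination (1 / 2 : ℂ) * Complex.I_mul_I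
  · ring

/-- The scalar `g(x, y_J^{1,0})`. -/
def inner10 (J : V →L[ℝ] V) (x y : V) : ℂ :=
  (1 / 2) * ((inner ℝ x y : ℂ) - Complex.I * (inner ℝ x (J y) : ℂ))

/-- The Clifford relations of the covariant derivatives. -/
def IsClifford (N : V →ₗ[ℝ] E) : Prop :=
  ∀ x y, N x * N y + N y * N x = -((inner ℝ x y : ℂ) • (1 : E))

/-- Skew-symmetric operators. -/
def IsSkew (A : V →L[ℝ] V) : Prop := ∀ x y, inner ℝ (A x) y = -inner ℝ x (A y)

theorem IsSkew.right {A : V →L[ℝ] V} (h : IsSkew A) (x y : V) :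
    inner ℝ x (A y) = -inner ℝ (A x) y := by rw [h x y, neg_neg]

variable {N : V →ₗ[ℝ] E} {J : V →L[ℝ] V}

theorem anticomm_expand {a b c d : E} {p q r s : ℂ} (u v : ℂ) (h1 : a * c + c * a = p • (1 : E))
    (h2 : a * d + d * a = q • (1 : E)) (h3 : b * c + c * b = r • (1 : E))
    (h4 : b * d + d * b = s • (1 : E)) :
    (a + u • b) * (c + v • d) + (c + v • d) * (a + u • b) =
      (p + v * q + u * r + u * v * s) • (1 : E) := by
  have e : (a + u • b) * (c + v • d) + (c + v • d) * (a + u • b) =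
      (a * c + c * a) + v • (a * d + d * a) + u • (b * c + c * b) +
        (u * v) • (b * d + d * b) := by
    simp only [add_mul, mul_add, smul_mul_assoc, mul_smul_comm]
    module
  rw [e, h1, h2, h3, h4]
  module

/-- The bracket is -g(x^{0,1}, y^{1,0}), and x^{0,1} may be replaced by x because V^{1,0} is
isotropic. -/
theorem IsClifford.annih_creat (hN : IsClifford N) (hJ : ∀ x, J (J x) = -x) (hs : IsSkew J)
    (x y : V) :
    annih N J x * creat N J y + creat N J y * annih N J x = -(inner10 J x y • (1 : E)) := by
  have h : ∀ x y, N x * N y + N y * N x = (-(inner ℝ x y : ℂ)) • (1 : E) := fun x y => by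
    rw [hN x y, neg_smul]
  have := anticomm_expand (E := E) Complex.I (-Complex.I) (h x y) (h x (J y)) (h (J x) y)
    (h (J x) (J y))
  rw [annih_apply, creat_apply, smul_mul_smul_comm,
    smul_mul_smul_comm, ← smul_add, this, hs x y, hs x (J y), hJ, inner_neg_right, ← neg_smul,
    smul_smul]
  congr 1
  simp only [inner10]
  push_cast
  ring_nf
  rw [Complex.I_sq]
  ring

/-- V^{1,0} is isotropic, so the Clifford relation has no scalar term on it. -/
theorem IsClifford.creat_creat (hN : IsClifford N) (hJ : ∀ x, J (J x) = -x) (hs : IsSkew J)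
    (x y : V) : creat N J x * creat N J y = -(creat N J y * creat N J x) := by
  have h : ∀ x y, N x * N y + N y * N x = (-(inner ℝ x y : ℂ)) • (1 : E) := fun x y => by
    rw [hN x y, neg_smul]
  have := anticomm_expand (E := E) (-Complex.I) (-Complex.I) (h x y) (h x (J y)) (h (J x) y)
    (h (J x) (J y))
  rw [eq_neg_iff_add_eq_zero, creat_apply, creat_apply, smul_mul_smul_comm,
    smul_mul_smul_comm, ← smul_add, this, hs x y, hs x (J y), hJ, inner_neg_right]
  have : ((-(inner ℝ x y : ℂ)) + -Complex.I * -((inner ℝ x (J y) : ℝ) : ℂ) +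
      -Complex.I * -((-inner ℝ x (J y) : ℝ) : ℂ) +
      -Complex.I * -Complex.I * -((- -inner ℝ x y : ℝ) : ℂ)) = 0 := by
    push_cast
    ring_nf
    rw [Complex.I_sq]
    ring
  rw [this, zero_smul, smul_zero]

/-- The operator `½ ∑ c(e_i) c(M e_i)`, where `c` are the creation operators. -/
def quadOp (b : OrthonormalBasis ι ℝ V) (N : V →ₗ[ℝ] E) (J M : V →L[ℝ] V) : E :=
  (1 / 2 : ℂ) • ∑ i, creat N J (b i) * creat N J (M (b i))

theorem IsClifford.commute_creat_mul (hN : IsClifford N) (hJ : ∀ x, J (J x) = -x) (hs : IsSkew J)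
    (x y z : V) : Commute (creat N J x) (creat N J y * creat N J z) := by
  rw [commute_iff_eq, ← mul_assoc, hN.creat_creat hJ hs x y, neg_mul, mul_assoc,
    hN.creat_creat hJ hs x z, mul_neg, neg_neg, mul_assoc]

theorem IsClifford.commute_creat_quadOp (hN : IsClifford N) (hJ : ∀ x, J (J x) = -x)
    (hs : IsSkew J) (b : OrthonormalBasis ι ℝ V) (M : V →L[ℝ] V) (x : V) :
    Commute (creat N J x) (quadOp b N J M) :=
  (Commute.sum_right _ _ _ fun _ _ => hN.commute_creat_mul hJ hs _ _ _).smul_right _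

theorem IsClifford.commute_quadOp (hN : IsClifford N) (hJ : ∀ x, J (J x) = -x)
    (hs : IsSkew J) (b : OrthonormalBasis ι ℝ V) (M M' : V →L[ℝ] V) :
    Commute (quadOp b N J M) (quadOp b N J M') :=
  (Commute.sum_left _ _ _ fun _ _ => (hN.commute_creat_quadOp hJ hs b M' _).mul_left
    (hN.commute_creat_quadOp hJ hs b M' _)).smul_left _

/-- Creation operators square to zero and products of two of them commute, so the sum consists of
commuting square-zero terms. -/
theorem IsClifford.isNilpotent_quadOp (hN : IsClifford N) (hJ : ∀ x, J (J x) = -x)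
    (hs : IsSkew J) (b : OrthonormalBasis ι ℝ V) (M : V →L[ℝ] V) :
    IsNilpotent (quadOp b N J M) := by
  refine IsNilpotent.smul (Commute.isNilpotent_sum (fun i _ => ⟨2, ?_⟩) fun i j _ _ =>
    (hN.commute_creat_mul hJ hs _ _ _).mul_left (hN.commute_creat_mul hJ hs _ _ _)) _
  have h0 : creat N J (b i) * creat N J (b i) = 0 := by
    have h := hN.creat_creat hJ hs (b i) (b i)
    have h2 : (2 : ℂ) • (creat N J (b i) * creat N J (b i)) = 0 := by
      rw [two_smul]; nth_rewrite 1 [h]; exact neg_add_cancel _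
    have h3 := congrArg (fun z => (2 : ℂ)⁻¹ • z) h2
    simpa [smul_smul] using h3
  rw [pow_two, ← mul_assoc, mul_assoc (creat N J (b i)),
    hN.creat_creat hJ hs (M (b i)) (b i), mul_neg, ← mul_assoc, h0]
  simp

theorem sum_inner_smul (b : OrthonormalBasis ι ℝ V) (φ : V →ₗ[ℝ] E) (x : V) :
    ∑ i, (inner ℝ x (b i) : ℂ) • φ (b i) = φ x := by
  nth_rewrite 2 [← b.sum_repr' x]
  rw [map_sum]
  refine Finset.sum_congr rfl fun i _ => ?_
  rw [map_smul, real_inner_comm, coe_smul_eq]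

/-- `[d_x, A(T)] = -c_{Tx}`. -/
theorem IsClifford.annih_mul_quadOp (hN : IsClifford N) (hJ : ∀ x, J (J x) = -x)
    (hs : IsSkew J) (b : OrthonormalBasis ι ℝ V) {T : V →L[ℝ] V} (hT : IsSkew T)
    (hTJ : ∀ x, T (J x) = -J (T x)) (x : V) :
    annih N J x * quadOp b N J T = quadOp b N J T * annih N J x + -creat N J (T x) := by
  have h1 : ∀ i, annih N J x * (creat N J (b i) * creat N J (T (b i))) =
      creat N J (b i) * creat N J (T (b i)) * annih N J x
        - inner10 J x (b i) • creat N J (T (b i))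
        + inner10 J x (T (b i)) • creat N J (b i) := by
    intro i
    have e1 : annih N J x * creat N J (b i) =
        -(inner10 J x (b i) • (1 : E)) - creat N J (b i) * annih N J x :=
      eq_sub_of_add_eq (hN.annih_creat hJ hs x (b i))
    have e2 : annih N J x * creat N J (T (b i)) =
        -(inner10 J x (T (b i)) • (1 : E)) - creat N J (T (b i)) * annih N J x :=
      eq_sub_of_add_eq (hN.annih_creat hJ hs x (T (b i)))
    rw [← mul_assoc, e1, sub_mul, mul_assoc, e2, mul_sub, mul_neg, mul_smul_comm, mul_one,
      neg_mul, smul_mul_assoc, one_mul, mul_assoc]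
    abel
  have hTJ' : creat N J (T (J x)) = -(Complex.I • creat N J (T x)) := by
    rw [hTJ, map_neg, creat_J N hJ]
  -- The coefficients pair with x^{0,1}. As T exchanges types, T x^{0,1} = (Tx)^{1,0}, on which c
  -- has the same value as on Tx.
  have h2 : ∑ i, inner10 J x (b i) • creat N J (T (b i)) = creat N J (T x) := by
    have e : ∀ i, inner10 J x (b i) • creat N J (T (b i)) =
        (1 / 2 : ℂ) • ((inner ℝ x (b i) : ℂ) • (creat N J ∘ₗ (T : V →ₗ[ℝ] V)) (b i)) +
        (Complex.I / 2) • ((inner ℝ (J x) (b i) : ℂ) • (creat N J ∘ₗ (T : V →ₗ[ℝ] V)) (b i)) := by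
      intro i
      rw [inner10, hs.right, smul_smul, smul_smul, ← add_smul]
      congr 1
      push_cast; ring
    rw [Finset.sum_congr rfl fun i _ => e i, Finset.sum_add_distrib, ← Finset.smul_sum,
      ← Finset.smul_sum, sum_inner_smul, sum_inner_smul]
    simp only [LinearMap.comp_apply, ContinuousLinearMap.coe_coe, hTJ', smul_neg, smul_smul]
    rw [div_mul_eq_mul_div, Complex.I_mul_I]
    module
  -- Transposing the skew `T` reduces this to the previous sum up to sign. The two contributions add
  -- up, and the factor ½ in `quadOp` compensates.
  have h3 : ∑ i, inner10 J x (T (b i)) • creat N J (b i) = -creat N J (T x) := by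
    have e : ∀ i, inner10 J x (T (b i)) • creat N J (b i) =
        (-1 / 2 : ℂ) • ((inner ℝ (T x) (b i) : ℂ) • creat N J (b i)) -
        (Complex.I / 2) • ((inner ℝ (T (J x)) (b i) : ℂ) • creat N J (b i)) := by
      intro i
      rw [inner10, hT.right, hs.right, hT.right, smul_smul, smul_smul, ← sub_smul]
      congr 1
      push_cast; ring
    rw [Finset.sum_congr rfl fun i _ => e i, Finset.sum_sub_distrib, ← Finset.smul_sum,
      ← Finset.smul_sum, sum_inner_smul, sum_inner_smul, hTJ', smul_neg, smul_smul,
      div_mul_eq_mul_div, Complex.I_mul_I]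
    module
  rw [quadOp, mul_smul_comm, Finset.mul_sum, Finset.sum_congr rfl fun i _ => h1 i,
    Finset.sum_add_distrib, Finset.sum_sub_distrib, h2, h3, ← Finset.sum_mul, smul_mul_assoc]
  module

/-- Equivalently (d_x + c_{Tx}) e^{A(T)} = e^{A(T)} d_x: the exponential is a Bogoliubov
transformation carrying the kernel of d_x into that of d_x + c_{Tx}. -/
theorem IsClifford.annih_mul_exp (hN : IsClifford N) [Module ℚ E] (hJ : ∀ x, J (J x) = -x)
    (hs : IsSkew J) (b : OrthonormalBasis ι ℝ V) {T : V →L[ℝ] V} (hT : IsSkew T)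
    (hTJ : ∀ x, T (J x) = -J (T x)) (x : V) :
    annih N J x * IsNilpotent.exp (quadOp b N J T) =
      IsNilpotent.exp (quadOp b N J T) * annih N J x
        + -creat N J (T x) * IsNilpotent.exp (quadOp b N J T) :=
  mul_exp_of_mul_eq (hN.isNilpotent_quadOp hJ hs b T)
    (hN.commute_creat_quadOp hJ hs b T _).neg_left (hN.annih_mul_quadOp hJ hs b hT hTJ x)

/-- The infinitesimal generator `¼ ∑ N(e_i) N(B e_i)` of parallel transport. -/
def generator (b : OrthonormalBasis ι ℝ V) (N : V →ₗ[ℝ] E) (B : V →L[ℝ] V) : E :=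
  (1 / 4 : ℂ) • ∑ i, N (b i) * N (B (b i))

/-- Replacing the basis by its image under J leaves the sum unchanged, but multiplies each term by
-zw = -1, the sign coming from `B` anticommuting with `J`. -/
theorem sum_eq_zero_of_J (b : OrthonormalBasis ι ℝ V) (hJ : ∀ x, J (J x) = -x) (hs : IsSkew J)
    {B : V →L[ℝ] V} (hBJ : ∀ x, B (J x) = -J (B x)) (φ ψ : V →ₗ[ℝ] E) {z w : ℂ}
    (hφ : ∀ x, φ (J x) = z • φ x) (hψ : ∀ x, ψ (J x) = w • ψ x) (hzw : z * w = 1) :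
    ∑ i, φ (b i) * ψ (B (b i)) = 0 := by
  let Φ : V →ₗ[ℝ] V →ₗ[ℝ] E :=
    mulForm (φ ∘ₗ (J : V →ₗ[ℝ] V)) (ψ ∘ₗ (B : V →ₗ[ℝ] V))
  have h := sum_adjoint b Φ (A := J) (B := -J) (fun x y => by simp [hs x y])
  have h1 : ∀ i, Φ (b i) (J (b i)) = -(φ (b i) * ψ (B (b i))) := by
    intro i
    change φ (J (b i)) * ψ (B (J (b i))) = _
    rw [hφ, hBJ, map_neg, hψ, mul_neg, smul_mul_smul_comm, hzw, one_smul]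
  have h2 : ∀ i, Φ ((-J) (b i)) (b i) = φ (b i) * ψ (B (b i)) := by
    intro i
    change φ (J ((-J) (b i))) * ψ (B (b i)) = _
    rw [neg_apply, map_neg, hJ, neg_neg]
  rw [Finset.sum_congr rfl fun i _ => h1 i, Finset.sum_congr rfl fun i _ => h2 i,
    Finset.sum_neg_distrib] at h
  have h2 : (2 : ℂ) • ∑ i, φ (b i) * ψ (B (b i)) = 0 := by
    rw [two_smul]; nth_rewrite 1 [← h]; exact neg_add_cancel _
  have h3 := congrArg (fun z => (2 : ℂ)⁻¹ • z) h2
  simpa [smul_smul] using h3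

/-- Since `B` exchanges the types, the products of one creation and one annihilation operator cancel
in the sum. It is applied with J₀ to compute the derivative, and with J_t to prove orthogonality. -/
theorem generator_eq (b : OrthonormalBasis ι ℝ V) (hJ : ∀ x, J (J x) = -x) (hs : IsSkew J)
    {B : V →L[ℝ] V} (hBJ : ∀ x, B (J x) = -J (B x)) :
    generator b N B = (1 / 4 : ℂ) • (∑ i, creat N J (b i) * creat N J (B (b i)) +
      ∑ i, annih N J (b i) * annih N J (B (b i))) := by
  have hc : ∀ x, creat N J (J x) = Complex.I • creat N J x := creat_J N hJ
  have hd : ∀ x, annih N J (J x) = (-Complex.I) • annih N J x := fun x => by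
    rw [annih_J N hJ, neg_smul]
  have h1 := sum_eq_zero_of_J b hJ hs hBJ (creat N J) (annih N J) hc hd
    (by rw [mul_neg, Complex.I_mul_I, neg_neg])
  have h2 := sum_eq_zero_of_J b hJ hs hBJ (annih N J) (creat N J) hd hc
    (by rw [neg_mul, Complex.I_mul_I, neg_neg])
  have h3 : ∀ i, N (b i) * N (B (b i)) = (creat N J (b i) * creat N J (B (b i)) +
      annih N J (b i) * annih N J (B (b i))) + (creat N J (b i) * annih N J (B (b i)) +
      annih N J (b i) * creat N J (B (b i))) := by
    intro i
    rw [← creat_add_annih N J (b i), ← creat_add_annih N J (B (b i))]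
    noncomm_ring
  rw [generator, Finset.sum_congr rfl fun i _ => h3 i, Finset.sum_add_distrib,
    Finset.sum_add_distrib, Finset.sum_add_distrib, h1, h2, add_zero, add_zero]

/-- Action of the generator on a state that is annihilated by all `d_x + c_{Tx}`. -/
theorem IsClifford.generator_mul (hN : IsClifford N) (hJ : ∀ x, J (J x) = -x)
    (hs : IsSkew J) (b : OrthonormalBasis ι ℝ V) {T B : V →L[ℝ] V} (hT : IsSkew T)
    (hTJ : ∀ x, T (J x) = -J (T x)) (hB : IsSkew B) (hBJ : ∀ x, B (J x) = -J (B x))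
    (hTB : ∀ x, T (B x) = B (T x)) {L : Submodule ℂ E} (hL : ∀ a, ∀ z ∈ L, a * z ∈ L) {P : E}
    (hP : ∀ x, annih N J x * P + creat N J (T x) * P ∈ L) :
    generator b N B * P - (((1 / 8 * ∑ i, inner ℝ (b i) (T (B (b i))) : ℝ) : ℂ) • P +
      (1 / 2 : ℂ) • (quadOp b N J (B - T * T * B) * P)) ∈ L := by
  -- Normal ordering modulo `L`: an annihilation operator next to `P` is replaced by -c_{T·}, then
  -- the remaining one is moved to the right and replaced in turn.
  have h1 : ∀ i, annih N J (b i) * annih N J (B (b i)) * P - (inner10 J (b i) (T (B (b i))) • P -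
      creat N J (T (B (b i))) * creat N J (T (b i)) * P) ∈ L := by
    intro i
    have e1 : annih N J (b i) * creat N J (T (B (b i))) =
        -(inner10 J (b i) (T (B (b i))) • (1 : E)) - creat N J (T (B (b i))) * annih N J (b i) :=
      eq_sub_of_add_eq (hN.annih_creat hJ hs _ _)
    have e2 : annih N J (b i) * annih N J (B (b i)) * P - (inner10 J (b i) (T (B (b i))) • P -
      creat N J (T (B (b i))) * creat N J (T (b i)) * P) =
        annih N J (b i) * (annih N J (B (b i)) * P + creat N J (T (B (b i))) * P) +
        creat N J (T (B (b i))) * (annih N J (b i) * P + creat N J (T (b i)) * P) := by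
      rw [mul_add, ← mul_assoc, ← mul_assoc (annih N J (b i)) (creat N J _), e1, sub_mul, neg_mul,
        smul_mul_assoc, one_mul, mul_add, ← mul_assoc, ← mul_assoc]
      abel
    rw [e2]
    exact L.add_mem (hL _ _ (hP _)) (hL _ _ (hP _))
  have h2 := L.sum_mem fun i (_ : i ∈ Finset.univ) => h1 i
  rw [Finset.sum_sub_distrib, Finset.sum_sub_distrib, ← Finset.sum_smul, ← Finset.sum_mul,
    ← Finset.sum_mul] at h2
  have h3 : ∑ i, inner10 J (b i) (T (B (b i))) =
      ((1 / 2 * ∑ i, inner ℝ (b i) (T (B (b i))) : ℝ) : ℂ) := by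
    have : ∀ i, inner10 J (b i) (T (B (b i))) =
        (1 / 2 : ℂ) * ((inner ℝ (b i) (T (B (b i))) : ℝ) : ℂ) := by
      intro i
      -- TB = BT commutes with J, so JTB is skew and its diagonal entries vanish; the scalar is
      -- real.
      have h0 : inner ℝ (b i) (J (T (B (b i)))) = 0 := by
        have e : inner ℝ (b i) (J (T (B (b i)))) = -inner ℝ (b i) (J (T (B (b i)))) := by
          conv_lhs => rw [hs.right, hT.right, hB.right, neg_neg, ← hTB, hBJ, map_neg, hTJ, neg_neg,
            real_inner_comm]
        linarith
      rw [inner10, h0]; push_cast; ring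
    rw [Finset.sum_congr rfl fun i _ => this i, ← Finset.mul_sum]
    push_cast
    rfl
  -- Transposing `T` and exchanging the two creation operators give two signs, which cancel.
  have h4 : ∑ i, creat N J (T (B (b i))) * creat N J (T (b i)) =
      ∑ i, creat N J (b i) * creat N J ((T * T * B) (b i)) := by
    let Φ : V →ₗ[ℝ] V →ₗ[ℝ] E :=
      mulForm (creat N J ∘ₗ ((T * B : V →L[ℝ] V) : V →ₗ[ℝ] V)) (creat N J)
    have h := sum_adjoint b Φ (A := T) (B := -T) (fun x y => by simp [hT x y])
    change ∑ i, creat N J (T (B (b i))) * creat N J (T (b i)) =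
      ∑ i, creat N J (T (B ((-T) (b i)))) * creat N J (b i) at h
    rw [h]
    refine Finset.sum_congr rfl fun i _ => ?_
    rw [neg_apply, map_neg, map_neg, map_neg, neg_mul, hN.creat_creat hJ hs, neg_neg, ← hTB]
    rfl
  rw [h3, h4] at h2
  have h5 : generator b N B * P - (((1 / 8 * ∑ i, inner ℝ (b i) (T (B (b i))) : ℝ) : ℂ) • P +
      (1 / 2 : ℂ) • (quadOp b N J (B - T * T * B) * P)) =
      (1 / 4 : ℂ) • ((∑ i, annih N J (b i) * annih N J (B (b i))) * P -
        (((1 / 2 * ∑ i, inner ℝ (b i) (T (B (b i))) : ℝ) : ℂ) • P -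
          (∑ i, creat N J (b i) * creat N J ((T * T * B) (b i))) * P)) := by
    have e : quadOp b N J (B - T * T * B) = (1 / 2 : ℂ) •
        (∑ i, creat N J (b i) * creat N J (B (b i)) -
          ∑ i, creat N J (b i) * creat N J ((T * T * B) (b i))) := by
      rw [quadOp, ← Finset.sum_sub_distrib]
      simp only [sub_apply, map_sub, mul_sub]
    rw [generator_eq b hJ hs hBJ, e, smul_mul_assoc, smul_mul_assoc, add_mul, sub_mul]
    push_cast
    module
  rw [h5]
  exact L.smul_mem _ h2

end Operators

end FermionicTransport

end

open scoped TensorProduct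

noncomputable section

set_option linter.unusedSectionVars false

namespace FermionicTransport

/-! ### Iterated contractions and the Berezin integral -/

section Frames

variable {W : Type*} [AddCommGroup W] [Module ℝ W] {N : ℕ}

theorem contractFrame_zero (w : Fin 0 → W) : contractFrame w = 1 := by
  simp [contractFrame]

theorem contractFrame_succ (w : Fin (N + 1) → W) (F : FermFun W) :
    contractFrame w F = contractFrame (fun i => w i.succ) (contract (w 0) F) := by
  rw [contractFrame, List.ofFn_succ, List.reverse_cons, List.prod_append, List.prod_singleton]
  rfl

theorem contractFrame_anticomm (w : Fin N → W) (D : FermFun W →ₗ[ℂ] FermFun W)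
    (h : ∀ i F, contract (w i) (D F) = -D (contract (w i) F)) (F : FermFun W) :
    contractFrame w (D F) = (-1 : ℂ) ^ N • D (contractFrame w F) := by
  induction N generalizing F with
  | zero => simp [contractFrame_zero]
  | succ N ih =>
    rw [contractFrame_succ, h, map_neg, ih _ (fun i => h i.succ), contractFrame_succ, pow_succ]
    simp

/-- The frame has even length, so the signs of the single contractions cancel. This is where the
even dimension makes the fermionic integral an even operation. -/
theorem contractFrame_comm {n : ℕ} (w : Fin (2 * n) → W) (D : FermFun W →ₗ[ℂ] FermFun W)
    (h : ∀ i F, contract (w i) (D F) = -D (contract (w i) F)) (F : FermFun W) :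
    contractFrame w (D F) = D (contractFrame w F) := by
  rw [contractFrame_anticomm w D h, pow_mul]
  simp

theorem contractFrame_inv {n : ℕ} (w : Fin (2 * n) → W) (F : FermFun W) :
    contractFrame w (inv F) = inv (contractFrame w F) :=
  contractFrame_comm w inv.toLinearMap (fun i F => contract_inv (w i) F) F

theorem contract_contractFrame_self (w : Fin N → W) (i : Fin N) (F : FermFun W) :
    contract (w i) (contractFrame w F) = 0 := by
  induction N generalizing F with
  | zero => exact i.elim0
  | succ N ih =>
    rw [contractFrame_succ]
    refine Fin.cases ?_ (fun j => ih (fun k => w k.succ) j _) i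
    have h := contractFrame_anticomm (fun k => w k.succ) (contract (w 0))
      (fun i F => contract_contract _ _ F) F
    rw [h, map_smul, contract_self, smul_zero]

theorem contract_prod_eq_zero (w : W) (α : Fin N → Module.Dual ℝ W) (h : ∀ i, α i w = 0) :
    contract w (List.ofFn fun i => linFun (α i)).prod = 0 := by
  induction N with
  | zero => simp
  | succ N ih =>
    rw [List.ofFn_succ, List.prod_cons, contract_linFun_mul, h, ih _ (fun i => h i.succ)]
    simp

theorem contractFrame_prod (w : Fin N → W) (α : Fin N → Module.Dual ℝ W)
    (h : ∀ i j, α i (w j) = if i = j then 1 else 0) :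
    contractFrame w (List.ofFn fun i => linFun (α i)).prod = 1 := by
  induction N with
  | zero => simp [contractFrame_zero]
  | succ N ih =>
    rw [contractFrame_succ, List.ofFn_succ, List.prod_cons, contract_linFun_mul, h, if_pos rfl,
      contract_prod_eq_zero (w 0) (fun i => α i.succ) (fun i => by
        rw [h, if_neg (Fin.succ_ne_zero i)]), mul_zero, sub_zero, one_smul]
    exact ih _ _ fun i j => by rw [h]; simp

theorem contractFrame_pullback {W' : Type*} [AddCommGroup W'] [Module ℝ W'] (f : W →ₗ[ℝ] W')
    (w : Fin N → W) (F : FermFun W') :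
    contractFrame w (pullback f F) = pullback f (contractFrame (fun i => f (w i)) F) := by
  induction N generalizing F with
  | zero => simp [contractFrame_zero]
  | succ N ih => rw [contractFrame_succ, contract_pullback, ih, contractFrame_succ]

end Frames

variable {V : Type*} [NormedAddCommGroup V] [InnerProductSpace ℝ V] [FiniteDimensional ℝ V]
variable {n : ℕ} (e : OrthonormalBasis (Fin (2 * n)) ℝ V)

theorem contract_contractFrame (x : V) (F : FermFun V) :
    contract x (contractFrame (fun i => e i) F) = 0 := by
  rw [← e.sum_repr' x, map_sum, LinearMap.sum_apply]
  refine Finset.sum_eq_zero fun i _ => ?_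
  rw [map_smul, LinearMap.smul_apply, contract_contractFrame_self (fun i => e i) i, smul_zero]

/-- A derivative has no top-degree part. This is integration by parts for the fermionic integral. -/
theorem berezin_contract (x : V) (F : FermFun V) : berezin e (contract x F) = 0 := by
  rw [berezin, contractFrame_comm _ (contract x) (fun i F => contract_contract _ _ F),
    contract_contractFrame, map_zero]

theorem berezin_inv (F : FermFun V) : berezin e (inv F) = berezin e F := by
  rw [berezin, berezin, contractFrame_inv, body_inv]

theorem berezin_add (F G : FermFun V) : berezin e (F + G) = berezin e F + berezin e G := by
  rw [berezin, map_add, map_add]; rfl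

theorem berezin_smul (c : ℂ) (F : FermFun V) : berezin e (c • F) = c * berezin e F := by
  rw [berezin, map_smul, map_smul]; rfl

/-! ### The Hodge star and complex conjugation -/

theorem inv_tmul (z : ℂ) (F : ExteriorAlgebra ℝ (Module.Dual ℝ V)) :
    inv (z ⊗ₜ[ℝ] F : FermFun V) = z ⊗ₜ[ℝ] CliffordAlgebra.involute F := by
  have h : ExteriorAlgebra.map (-LinearMap.id : V →ₗ[ℝ] V).dualMap =
      CliffordAlgebra.involute (Q := (0 : QuadraticForm ℝ (Module.Dual ℝ V))) := by
    refine ExteriorAlgebra.hom_ext (LinearMap.ext fun α => ?_)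
    change ExteriorAlgebra.map _ (ExteriorAlgebra.ι ℝ α) =
      CliffordAlgebra.involute (CliffordAlgebra.ι _ α)
    rw [ExteriorAlgebra.map_apply_ι, CliffordAlgebra.involute_ι]
    have : (-LinearMap.id : V →ₗ[ℝ] V).dualMap α = -α := by ext; simp
    rw [this, map_neg]
  rw [inv, pullback, Algebra.TensorProduct.map_tmul, h]
  rfl

/-- Contractions anticommute, so moving one past the contraction with `F` costs a sign per factor of
`F`. -/
theorem contractForm_contractLeft (d : Module.Dual ℝ (Module.Dual ℝ V))
    (F G : ExteriorAlgebra ℝ (Module.Dual ℝ V)) :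
    contractForm F
      (CliffordAlgebra.contractLeft (Q := (0 : QuadraticForm ℝ (Module.Dual ℝ V))) d G) =
      CliffordAlgebra.contractLeft (Q := (0 : QuadraticForm ℝ (Module.Dual ℝ V))) d
        (contractForm (CliffordAlgebra.involute F) G) := by
  induction F using CliffordAlgebra.left_induction generalizing G with
  | algebraMap r =>
    rw [AlgHom.commutes, AlgHom.commutes, AlgHom.commutes]
    simp [Algebra.algebraMap_eq_smul_one]
  | add x y hx hy => simp only [map_add, LinearMap.add_apply, hx, hy]
  | ι_mul x m hx =>
    have h1 : contractForm (CliffordAlgebra.ι (0 : QuadraticForm ℝ (Module.Dual ℝ V)) m) =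
        CliffordAlgebra.contractLeft (Q := (0 : QuadraticForm ℝ (Module.Dual ℝ V)))
          (Module.Dual.eval ℝ V (sharpHalf m)) :=
      ExteriorAlgebra.lift_ι_apply ℝ _ _ m
    rw [map_mul, map_mul, map_mul, CliffordAlgebra.involute_ι, map_neg, h1]
    simp only [Module.End.mul_apply, LinearMap.neg_apply]
    rw [hx, CliffordAlgebra.contractLeft_comm, map_neg]

/-- The star turns multiplication into contraction, up to the grade involution caused by the
reversal in its definition. All adjointness relations come from this. -/
theorem hodgeHalf_linFun_mul (α : Module.Dual ℝ V) (F : FermFun V) :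
    hodgeHalf e (linFun α * F) = contract (sharpHalf α) (hodgeHalf e (inv F)) := by
  induction F using TensorProduct.induction_on with
  | zero => simp
  | add x y hx hy => simp only [mul_add, map_add, hx, hy]
  | tmul z F =>
    rw [linFun_mul_tmul, inv_tmul]
    change z ⊗ₜ[ℝ] (contractForm (CliffordAlgebra.reverse
      (CliffordAlgebra.ι (0 : QuadraticForm ℝ (Module.Dual ℝ V)) α * F)) _) =
      z ⊗ₜ[ℝ] CliffordAlgebra.contractLeft (Q := (0 : QuadraticForm ℝ (Module.Dual ℝ V)))
        (Module.Dual.eval ℝ V (sharpHalf α)) (contractForm (CliffordAlgebra.reverse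
          (CliffordAlgebra.involute F)) _)
    rw [CliffordAlgebra.reverse.map_mul, CliffordAlgebra.reverse_ι, map_mul,
      CliffordAlgebra.reverse_involute, ← contractForm_contractLeft, Module.End.mul_apply]
    congr 2
    exact congrArg (fun T : Module.End ℝ (ExteriorAlgebra ℝ (Module.Dual ℝ V)) => T _)
      (ExteriorAlgebra.lift_ι_apply ℝ _ _ α)

theorem hodgeHalf_one : hodgeHalf e (1 : FermFun V) =
    ((1 / 2 : ℝ) ^ n) • (List.ofFn fun i => linFun (e.toBasis.coord i)).prod := by
  have h : ∀ (N : ℕ) (α : Fin N → Module.Dual ℝ V),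
      (List.ofFn fun i => linFun (α i)).prod =
        ((1 : ℂ) ⊗ₜ[ℝ] ExteriorAlgebra.ιMulti ℝ N α : FermFun V) := by
    intro N α
    induction N with
    | zero => simp [Algebra.TensorProduct.one_def]
    | succ N ih =>
      rw [List.ofFn_succ, List.prod_cons, ih, linFun_mul_tmul, ExteriorAlgebra.ιMulti_succ_apply]
      rfl
  rw [h]
  change (1 : ℂ) ⊗ₜ[ℝ] (contractForm (CliffordAlgebra.reverse (1 : CliffordAlgebra _)) _) = _
  rw [CliffordAlgebra.reverse.map_one, map_one, ← TensorProduct.tmul_smul]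
  rfl

theorem hodgeHalf_inv (F : FermFun V) : hodgeHalf e (inv F) = inv (hodgeHalf e F) := by
  induction F using fermFun_induction with
  | one =>
    have h : ∀ (N : ℕ) (α : Fin N → Module.Dual ℝ V),
        inv (List.ofFn fun i => linFun (α i)).prod =
          (-1 : ℂ) ^ N • (List.ofFn fun i => linFun (α i)).prod := by
      intro N α
      induction N with
      | zero => simp
      | succ N ih =>
        rw [List.ofFn_succ, List.prod_cons, map_mul, ih, inv_linFun, pow_succ]
        simp
    rw [map_one, hodgeHalf_one, inv_real_smul, h, pow_mul]
    simp
  | smul c x hx => simp [hx]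
  | add x y hx hy => simp [hx, hy]
  | mul α x hx =>
    rw [map_mul, inv_linFun, ferm_neg_mul, map_neg, hodgeHalf_linFun_mul, inv_inv,
      hodgeHalf_linFun_mul, hx, ← neg_neg (inv (contract _ _)), ← contract_inv,
      inv_inv]

theorem conjFun_tmul (z : ℂ) (F : ExteriorAlgebra ℝ (Module.Dual ℝ V)) :
    conjFun (z ⊗ₜ[ℝ] F : FermFun V) = (starRingEnd ℂ z) ⊗ₜ[ℝ] F := rfl

theorem conjFun_linFun_mul (α : Module.Dual ℝ V) (F : FermFun V) :
    conjFun (linFun α * F) = linFun α * conjFun F := by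
  induction F using TensorProduct.induction_on with
  | zero => simp
  | add x y hx hy => simp only [mul_add, map_add, hx, hy]
  | tmul z F => rw [linFun_mul_tmul, conjFun_tmul, conjFun_tmul, linFun_mul_tmul]

theorem conjFun_contract (w : V) (F : FermFun V) :
    conjFun (contract w F) = contract w (conjFun F) := by
  induction F using TensorProduct.induction_on with
  | zero => simp
  | add x y hx hy => simp only [map_add, hx, hy]
  | tmul z F => rw [contract_tmul, conjFun_tmul, conjFun_tmul, contract_tmul]

theorem conjFun_smul (c : ℂ) (F : FermFun V) :
    conjFun (c • F) = (starRingEnd ℂ c) • conjFun F := by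
  induction F using TensorProduct.induction_on with
  | zero => simp
  | add x y hx hy => simp only [smul_add, map_add, hx, hy]
  | tmul z F =>
    rw [TensorProduct.smul_tmul', conjFun_tmul, conjFun_tmul, TensorProduct.smul_tmul', smul_eq_mul,
      smul_eq_mul, map_mul]

@[simp]
theorem conjFun_one : conjFun (1 : FermFun V) = 1 := by
  rw [Algebra.TensorProduct.one_def, conjFun_tmul, map_one]

/-! ### The Hermitian form -/

theorem herm_add_right (φ ψ ψ' : FermFun V) :
    herm e φ (ψ + ψ') = herm e φ ψ + herm e φ ψ' := by
  rw [herm, map_add, mul_add, berezin_add]; rfl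

theorem herm_add_left (φ φ' ψ : FermFun V) :
    herm e (φ + φ') ψ = herm e φ ψ + herm e φ' ψ := by
  rw [herm, map_add, add_mul, berezin_add]; rfl

theorem herm_smul_right (c : ℂ) (φ ψ : FermFun V) : herm e φ (c • ψ) = c * herm e φ ψ := by
  rw [herm, map_smul, ferm_mul_smul, berezin_smul]; rfl

theorem herm_smul_left (c : ℂ) (φ ψ : FermFun V) :
    herm e (c • φ) ψ = starRingEnd ℂ c * herm e φ ψ := by
  rw [herm, conjFun_smul, ferm_smul_mul, berezin_smul]; rfl

@[simp]
theorem herm_zero_right (φ : FermFun V) : herm e φ 0 = 0 := by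
  simpa using herm_smul_right e 0 φ 0

@[simp]
theorem herm_zero_left (φ : FermFun V) : herm e 0 φ = 0 := by
  simpa using herm_smul_left e 0 0 φ

/-- The Hermitian form as a real bilinear map. -/
def hermBilin : FermFun V →ₗ[ℝ] FermFun V →ₗ[ℝ] ℂ :=
  LinearMap.mk₂ ℝ (herm e) (herm_add_left e)
    (fun r x y => by rw [← ferm_coe_smul, herm_smul_left, Complex.conj_ofReal]; simp)
    (herm_add_right e)
    (fun r x y => by rw [← ferm_coe_smul, herm_smul_right]; simp)

theorem hermBilin_apply (φ ψ : FermFun V) : hermBilin e φ ψ = herm e φ ψ := rfl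

/-- The star converts the factor into a contraction, which integration by parts moves to the other
argument. -/
theorem herm_linFun_mul_right (α : Module.Dual ℝ V) (φ ψ : FermFun V) :
    herm e φ (linFun α * ψ) = herm e (contract (sharpHalf α) φ) ψ := by
  have h := berezin_contract e (sharpHalf α) (inv (conjFun φ) * inv (hodgeHalf e ψ))
  rw [contract_mul, inv_inv, contract_inv, berezin_add] at h
  rw [herm, hodgeHalf_linFun_mul, hodgeHalf_inv, herm, conjFun_contract,
    ← berezin_inv e (contract _ _ * _), map_mul, ← neg_eq_iff_add_eq_zero.mpr h, ferm_neg_mul,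
    ← neg_one_smul ℂ (inv _ * inv _), berezin_smul]
  ring

theorem linFun_mul_hodgeHalf_one (α : Module.Dual ℝ V) :
    linFun α * hodgeHalf e (1 : FermFun V) = 0 := by
  have h : ∀ (N : ℕ) (β : Fin N → Module.Dual ℝ V) (i : Fin N),
      linFun (β i) * (List.ofFn fun i => linFun (β i)).prod = 0 := by
    intro N β i
    induction N with
    | zero => exact i.elim0
    | succ N ih =>
      rw [List.ofFn_succ, List.prod_cons]
      refine Fin.cases ?_ (fun j => ?_) i
      · rw [← mul_assoc, linFun_mul_self, zero_mul]
      · rw [← mul_assoc, linFun_mul_swap, ferm_neg_mul, mul_assoc, ih (fun i => β i.succ) j,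
          mul_zero, neg_zero]
  have hα : α = ∑ i, α (e i) • e.toBasis.coord i := by
    refine e.toBasis.ext fun j => ?_
    simp only [LinearMap.sum_apply, LinearMap.smul_apply, Module.Basis.coord_apply,
      Module.Basis.repr_self, Finsupp.single_apply]
    simp
  rw [hodgeHalf_one, hα, map_sum, Finset.sum_mul]
  refine Finset.sum_eq_zero fun i _ => ?_
  rw [map_smul, ferm_real_smul_mul, ferm_mul_real_smul, h _ (fun i => e.toBasis.coord i) i]
  simp

theorem herm_linFun_mul_one (α : Module.Dual ℝ V) (φ : FermFun V) :
    herm e (linFun α * φ) 1 = 0 := by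
  rw [herm, conjFun_linFun_mul, linFun_mul, mul_assoc, linFun_mul_hodgeHalf_one, mul_zero, berezin,
    map_zero, map_zero]

theorem apply_sharpHalf_comm (α β : Module.Dual ℝ V) : α (sharpHalf β) = β (sharpHalf α) := by
  have h : ∀ α β : Module.Dual ℝ V, α (sharpHalf β) =
      2 * inner ℝ ((InnerProductSpace.toDual ℝ V).symm (LinearMap.toContinuousLinearMap α))
        ((InnerProductSpace.toDual ℝ V).symm (LinearMap.toContinuousLinearMap β)) := by
    intro α β
    rw [InnerProductSpace.toDual_symm_apply]
    change α ((2 : ℝ) • _) = _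
    rw [map_smul]
    rfl
  rw [h, h, real_inner_comm]

/-- Hermitian symmetry is deduced from this and cannot be used here. The induction on `ψ` relies
instead on the other adjointness and on the symmetry of the metric on covectors. -/
theorem herm_linFun_mul_left (α : Module.Dual ℝ V) (φ ψ : FermFun V) :
    herm e (linFun α * φ) ψ = herm e φ (contract (sharpHalf α) ψ) := by
  induction ψ using fermFun_induction generalizing φ with
  | one => rw [herm_linFun_mul_one, contract_one, herm_zero_right]
  | smul c x hx => rw [herm_smul_right, hx, map_smul, herm_smul_right]
  | add x y hx hy => rw [herm_add_right, hx, hy, map_add, herm_add_right]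
  | mul β x hx =>
    rw [herm_linFun_mul_right, contract_linFun_mul, contract_linFun_mul, sub_eq_add_neg,
      ← neg_one_smul ℂ, herm_add_left, herm_smul_left, hx, sub_eq_add_neg,
      ← neg_one_smul ℂ (linFun β * _), herm_add_right, herm_smul_right, herm_linFun_mul_right,
      ← ferm_coe_smul, ← ferm_coe_smul, herm_smul_left, herm_smul_right, Complex.conj_ofReal,
      apply_sharpHalf_comm]
    simp

theorem herm_one_one : herm e (1 : FermFun V) 1 = (((1 / 2 : ℝ) ^ n : ℝ) : ℂ) := by
  rw [herm, conjFun_one, one_mul, hodgeHalf_one, ← ferm_coe_smul, berezin_smul, berezin,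
    contractFrame_prod, map_one, mul_one]
  intro i j
  rw [← e.coe_toBasis, Module.Basis.coord_apply, Module.Basis.repr_self, Finsupp.single_apply]
  simp only [eq_comm]

theorem herm_symm (φ ψ : FermFun V) : herm e φ ψ = starRingEnd ℂ (herm e ψ φ) := by
  induction ψ using fermFun_induction generalizing φ with
  | one =>
    induction φ using fermFun_induction with
    | one => rw [herm_one_one, Complex.conj_ofReal]
    | smul c x hx => rw [herm_smul_right, herm_smul_left, map_mul, hx]
    | add x y hx hy => rw [herm_add_right, herm_add_left, hx, hy, map_add]
    | mul α x hx =>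
      rw [herm_linFun_mul_one, herm_linFun_mul_right, contract_one, herm_zero_left, map_zero]
  | smul c x hx => rw [herm_smul_right, hx, herm_smul_left, map_mul, Complex.conj_conj]
  | add x y hx hy => rw [herm_add_right, hx, hy, herm_add_left, map_add]
  | mul α x hx => rw [herm_linFun_mul_right, hx, herm_linFun_mul_left]

theorem sharpHalf_innerₗ (x : V) : sharpHalf (innerₗ V x) = (2 : ℝ) • x := by
  have h : (InnerProductSpace.toDual ℝ V).symm
      (LinearMap.toContinuousLinearMap (innerₗ V x)) = x := by
    rw [LinearIsometryEquiv.symm_apply_eq]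
    rfl
  exact congrArg (fun y : V => (2 : ℝ) • y) h

theorem herm_cov_mul_left (x : V) (φ ψ : FermFun V) :
    herm e (linFun (innerₗ V x) * φ) ψ = 2 * herm e φ (contract x ψ) := by
  rw [herm_linFun_mul_left, sharpHalf_innerₗ, map_smul, LinearMap.smul_apply, ← ferm_coe_smul,
    herm_smul_right]
  simp

theorem herm_cov_mul_right (x : V) (φ ψ : FermFun V) :
    herm e φ (linFun (innerₗ V x) * ψ) = 2 * herm e (contract x φ) ψ := by
  rw [herm_linFun_mul_right, sharpHalf_innerₗ, map_smul, LinearMap.smul_apply, ← ferm_coe_smul,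
    herm_smul_left, Complex.conj_ofReal]
  simp

/-- Split ψ = a + e^i ∧ b with a and b free of the i-th variable. The two parts are orthogonal and
the square of ψ is that of a plus twice that of b, so one variable can be removed at a time. -/
theorem herm_self_pos (ψ : FermFun V) :
    0 ≤ (herm e ψ ψ).re ∧ ((herm e ψ ψ).re = 0 → ψ = 0) := by
  have key : ∀ s : Finset (Fin (2 * n)), ∀ ψ : FermFun V, (∀ i ∉ s, contract (e i) ψ = 0) →
      0 ≤ (herm e ψ ψ).re ∧ ((herm e ψ ψ).re = 0 → ψ = 0) := by
    intro s
    induction s using Finset.induction_on with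
    | empty =>
      intro ψ h
      have h1 : ∀ x, contract x ψ = 0 := by
        intro x
        rw [← e.sum_repr' x, map_sum, LinearMap.sum_apply]
        refine Finset.sum_eq_zero fun i _ => ?_
        rw [map_smul, LinearMap.smul_apply, h i (Finset.notMem_empty i), smul_zero]
      have h2 := eq_body_of_contract_eq_zero h1
      have h3 : (herm e ψ ψ).re = Complex.normSq (body ψ) * (1 / 2 : ℝ) ^ n := by
        rw [h2, herm_smul_left, herm_smul_right, herm_one_one, ← mul_assoc, ← Complex.normSq_eq_conj_mul_self,
          map_smul, map_one, smul_eq_mul, mul_one, ← Complex.ofReal_mul, Complex.ofReal_re]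
      rw [h3]
      refine ⟨mul_nonneg (Complex.normSq_nonneg _) (by positivity), fun h => ?_⟩
      have h4 := (mul_eq_zero.mp h).resolve_right (by positivity)
      rw [h2, Complex.normSq_eq_zero.mp h4, zero_smul]
    | insert i s hi ih =>
      intro ψ h
      -- ι_{e_i}(e^i ∧ ψ) is the part of ψ without the i-th variable.
      have e1 : contract (e i) (linFun (innerₗ V (e i)) * ψ) =
          ψ - linFun (innerₗ V (e i)) * contract (e i) ψ := by
        rw [contract_linFun_mul]
        simp
      set a := contract (e i) (linFun (innerₗ V (e i)) * ψ) with ha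
      set b := contract (e i) ψ with hb
      have hψ : ψ = a + linFun (innerₗ V (e i)) * b := by rw [e1]; abel
      have hka : ∀ j ∉ s, contract (e j) a = 0 := by
        intro j hj
        by_cases hji : j = i
        · rw [hji, ha, contract_self]
        · have hj' : contract (e j) ψ = 0 := h j (by simp [hji, hj])
          have : (innerₗ V (e i)) (e j) = 0 := by
            rw [innerₗ_apply_apply, e.inner_eq_zero (Ne.symm hji)]
          rw [ha, contract_contract, contract_linFun_mul, hj', this]
          simp
      have hkb : ∀ j ∉ s, contract (e j) b = 0 := by
        intro j hj
        by_cases hji : j = i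
        · rw [hji, hb, contract_self]
        · rw [hb, contract_contract, h j (by simp [hji, hj]), map_zero, neg_zero]
      have hA := ih a hka
      have hB := ih b hkb
      have haz : contract (e i) a = 0 := by rw [ha, contract_self]
      have e2 : contract (e i) (linFun (innerₗ V (e i)) * b) = b := by
        rw [contract_linFun_mul, hb, contract_self]
        simp
      have e3 : herm e ψ ψ = herm e a a + 2 * herm e b b := by
        rw [hψ, herm_add_right, herm_add_left, herm_add_left, herm_cov_mul_left, haz,
          herm_cov_mul_right, haz, herm_cov_mul_left, e2]
        simp
      have e4 : (herm e ψ ψ).re = (herm e a a).re + 2 * (herm e b b).re := by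
        rw [e3]; simp
      rw [e4]
      refine ⟨by linarith [hA.1, hB.1], fun h0 => ?_⟩
      rw [hψ, hA.2 (by linarith [hA.1, hB.1]), hB.2 (by linarith [hA.1, hB.1])]
      simp
  exact key Finset.univ ψ fun i hi => absurd (Finset.mem_univ i) hi

theorem nablaReal_apply (x : V) (ψ : FermFun V) :
    nablaReal x ψ = contract x ψ - (1 / 2 : ℝ) • (linFun (innerₗ V x) * ψ) := rfl

/-- The factor ½ in ∇ cancels the factor 2 from raising indices with g/2, so ι_x and ½ g(x, ·)∧ are
adjoint to each other and their difference is skew-adjoint. This explains the choice of g/2 in the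
Hodge star. -/
theorem herm_nablaReal (x : V) (φ ψ : FermFun V) :
    herm e φ (nablaReal x ψ) = -herm e (nablaReal x φ) ψ := by
  rw [nablaReal_apply, nablaReal_apply, sub_eq_add_neg, sub_eq_add_neg, herm_add_left,
    herm_add_right, ← neg_smul, ← neg_smul, ← ferm_coe_smul, ← ferm_coe_smul, herm_smul_left,
    herm_smul_right, herm_cov_mul_left, herm_cov_mul_right, Complex.conj_ofReal]
  push_cast
  ring

end FermionicTransport

end

noncomputable section

set_option linter.unusedSectionVars false

namespace FermionicTransport

/-! ### One-parameter groups and geodesics -/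

section Geodesics

variable {V : Type*} [NormedAddCommGroup V] [InnerProductSpace ℝ V] [FiniteDimensional ℝ V]

/-- Identities for one-parameter groups are proved by showing that a suitable combination has
derivative zero and evaluating at time zero. -/
theorem eq_of_deriv_zero {F : Type*} [NormedAddCommGroup F] [NormedSpace ℝ F] {f : ℝ → F}
    (h : ∀ t, HasDerivAt f 0 t) (t : ℝ) : f t = f 0 :=
  is_const_of_deriv_eq_zero (fun t => (h t).differentiableAt) (fun t => (h t).deriv) t 0

/-- The one-parameter group `exp(tB)`. -/
def flow (B : V →L[ℝ] V) (t : ℝ) : V →L[ℝ] V := NormedSpace.exp (t • B)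

theorem hasDerivAt_flow (B : V →L[ℝ] V) (t : ℝ) : HasDerivAt (flow B) (B * flow B t) t := by
  have := FiniteDimensional.complete ℝ V
  exact hasDerivAt_exp_smul_const' B t

theorem flow_comm (B : V →L[ℝ] V) (t : ℝ) : flow B t * B = B * flow B t := by
  have := FiniteDimensional.complete ℝ V
  have h1 := hasDerivAt_exp_smul_const B t
  exact h1.unique (hasDerivAt_flow B t)

@[simp]
theorem flow_zero (B : V →L[ℝ] V) : flow B 0 = 1 := by
  rw [flow, zero_smul, NormedSpace.exp_zero]

theorem hasDerivAt_flow_neg (B : V →L[ℝ] V) (t : ℝ) :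
    HasDerivAt (fun t => flow B (-t)) (-(B * flow B (-t))) t := by
  have h := (hasDerivAt_flow B (-t)).scomp t (hasDerivAt_neg t)
  exact h.congr_deriv (neg_one_smul ℝ _)

theorem flow_neg_mul (B : V →L[ℝ] V) (t : ℝ) : flow B (-t) * flow B t = 1 := by
  have h := eq_of_deriv_zero (f := fun t => flow B (-t) * flow B t) (fun t => by
    have h := (hasDerivAt_flow_neg B t).mul (hasDerivAt_flow B t)
    refine h.congr_deriv ?_
    rw [← mul_assoc, flow_comm, neg_mul, neg_add_cancel]) t
  simpa using h

theorem flow_mul_neg (B : V →L[ℝ] V) (t : ℝ) : flow B t * flow B (-t) = 1 := by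
  have := flow_neg_mul B (-t)
  rwa [neg_neg] at this

theorem flow_half (B : V →L[ℝ] V) (t : ℝ) : flow B (t / 2) * flow B (t / 2) = flow B t := by
  have hd : ∀ t : ℝ, HasDerivAt (fun t => flow B (t / 2)) ((1 / 2 : ℝ) • (B * flow B (t / 2))) t := by
    intro t
    exact (hasDerivAt_flow B (t / 2)).scomp t ((hasDerivAt_id t).div_const 2)
  have h := eq_of_deriv_zero (f := fun t => flow B (-t) * (flow B (t / 2) * flow B (t / 2)))
    (fun t => by
    have h := (hasDerivAt_flow_neg B t).mul ((hd t).mul (hd t))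
    refine h.congr_deriv ?_
    simp only [Pi.mul_apply]
    have e : flow B (t / 2) * B = B * flow B (t / 2) := flow_comm B (t / 2)
    have e1 : flow B (-t) * B = B * flow B (-t) := flow_comm B (-t)
    rw [mul_smul_comm, ← mul_assoc (flow B (t / 2)), e, smul_mul_assoc, ← add_smul, mul_smul_comm,
      mul_assoc B, ← mul_assoc (flow B (-t)), e1]
    norm_num) t
  simp only [neg_zero, flow_zero, zero_div, mul_one] at h
  have h2 := congrArg (fun z => flow B t * z) h
  simp only [← mul_assoc, flow_mul_neg, one_mul, mul_one] at h2
  exact h2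

theorem inner_flow {B : V →L[ℝ] V} (hB : IsSkew B) (t : ℝ) (x y : V) :
    inner ℝ (flow B t x) (flow B t y) = inner ℝ x y := by
  have h := eq_of_deriv_zero (f := fun t => inner ℝ (flow B t x) (flow B t y)) (fun t => by
    have h1 := (hasDerivAt_flow B t).clm_apply (hasDerivAt_const t x)
    have h2 := (hasDerivAt_flow B t).clm_apply (hasDerivAt_const t y)
    have h := h1.inner ℝ h2
    refine h.congr_deriv ?_
    simp [hB _ (flow B t y)]) t
  simpa using h

theorem norm_flow {B : V →L[ℝ] V} (hB : IsSkew B) (t : ℝ) (x : V) : ‖flow B t x‖ = ‖x‖ := by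
  rw [norm_eq_sqrt_real_inner, inner_flow hB, ← norm_eq_sqrt_real_inner]

/-- Moving `J` across the exponential reverses time, because `B` anticommutes with `J`. -/
theorem flow_mul_mul_flow {B J : V →L[ℝ] V} (hBJ : B * J = -(J * B)) (t : ℝ) :
    flow B t * J * flow B t = J := by
  have h := eq_of_deriv_zero (f := fun t => flow B t * J * flow B t) (fun t => by
    have h := ((hasDerivAt_flow B t).mul_const J).mul (hasDerivAt_flow B t)
    refine h.congr_deriv ?_
    rw [← flow_comm B t, mul_assoc (flow B t) B J, hBJ, mul_neg, neg_mul, ← mul_assoc,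
      mul_assoc _ B, flow_comm, neg_add_cancel]) t
  simpa using h

theorem mul_flow {B J : V →L[ℝ] V} (hBJ : B * J = -(J * B)) (t : ℝ) :
    J * flow B t = flow B (-t) * J := by
  have h := congrArg (fun z => flow B (-t) * z) (flow_mul_mul_flow hBJ t)
  simpa only [← mul_assoc, flow_neg_mul, one_mul] using h

theorem det_mul (A B : V →L[ℝ] V) : (A * B).det = A.det * B.det :=
  LinearMap.det_comp (A : V →ₗ[ℝ] V) (B : V →ₗ[ℝ] V)

theorem det_one' : (1 : V →L[ℝ] V).det = 1 := LinearMap.det_id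

theorem det_flow_pos (B : V →L[ℝ] V) (t : ℝ) : 0 < (flow B t).det := by
  have h : (flow B t).det = (flow B (t / 2)).det * (flow B (t / 2)).det := by
    rw [← det_mul, flow_half]
  have h0 : (flow B t).det ≠ 0 := by
    intro h0
    have h1 := congrArg ContinuousLinearMap.det (flow_mul_neg B t)
    rw [det_mul, h0, zero_mul, det_one'] at h1
    exact zero_ne_one h1
  rw [h] at h0 ⊢
  exact mul_self_pos.mpr (left_ne_zero_of_mul h0)

theorem compatibleJ_sq {n : ℕ} {o : Orientation ℝ V (Fin (2 * n))} {J : V →L[ℝ] V}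
    (hJ : J ∈ compatibleJ o) : J * J = -1 := by
  ext x; exact hJ.1 x

theorem compatibleJ_skew {n : ℕ} {o : Orientation ℝ V (Fin (2 * n))} {J : V →L[ℝ] V}
    (hJ : J ∈ compatibleJ o) : IsSkew J := by
  intro x y
  rw [← hJ.2.1 (J x) y, hJ.1, inner_neg_left]

/-- With R = exp(tB) one has RJ = R^{1/2} J R^{-1/2}. An adapted basis is transported by R^{1/2},
whose determinant is positive, so the orientation is preserved. -/
theorem compatibleJ_flow {n : ℕ} {o : Orientation ℝ V (Fin (2 * n))} {J B : V →L[ℝ] V}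
    (hJ : J ∈ compatibleJ o) (hB : IsSkew B) (hBJ : B * J = -(J * B)) (t : ℝ) :
    flow B t * J ∈ compatibleJ o := by
  refine ⟨fun x => ?_, fun x y => ?_, ?_⟩
  · have h : flow B t * J * (flow B t * J) = -1 := by
      rw [← mul_assoc, flow_mul_mul_flow hBJ, compatibleJ_sq hJ]
    exact congrArg (fun A : V →L[ℝ] V => A x) h
  · exact (inner_flow hB t _ _).trans (hJ.2.1 x y)
  · obtain ⟨b, hb, hbJ⟩ := hJ.2.2
    have hdet := det_flow_pos B (t / 2)
    let f : V ≃ₗ[ℝ] V := LinearEquiv.ofLinearMap (flow B (t / 2) : V →ₗ[ℝ] V)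
      (flow B (-(t / 2)) : V →ₗ[ℝ] V)
      (by ext x; exact congrArg (fun A : V →L[ℝ] V => A x) (flow_mul_neg B (t / 2)))
      (by ext x; exact congrArg (fun A : V →L[ℝ] V => A x) (flow_neg_mul B (t / 2)))
    refine ⟨b.map f, ?_, fun k => ?_⟩
    · rw [← hb]
      exact (Module.Basis.orientation_comp_linearEquiv_eq_iff_det_pos b f).mpr hdet
    · rw [Module.Basis.map_apply, Module.Basis.map_apply, hbJ]
      have h : flow B t * J * flow B (t / 2) = flow B (t / 2) * J := by
        rw [mul_assoc, mul_flow hBJ, ← mul_assoc, ← flow_half B t, mul_assoc (flow B (t / 2)),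
          flow_mul_neg, mul_one]
      exact (congrArg (fun A : V →L[ℝ] V => A (b ⟨2 * k, by omega⟩)) h).symm

/-! ### The trace metric and the geodesic equation -/

variable {ι : Type*} [Fintype ι]

theorem etaMetric_eq_sum (b : OrthonormalBasis ι ℝ V) (A B : V →L[ℝ] V) :
    etaMetric A B = (1 / 4) * ∑ i, inner ℝ (A (b i)) (B (b i)) := by
  rw [etaMetric, LinearMap.trace_eq_sum_inner _ b]
  congr 1
  refine Finset.sum_congr rfl fun i _ => ?_
  rw [LinearMap.comp_apply, LinearMap.adjoint_inner_right]
  rfl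

theorem etaMetric_self (b : OrthonormalBasis ι ℝ V) (A : V →L[ℝ] V) :
    etaMetric A A = (1 / 4) * ∑ i, ‖A (b i)‖ ^ 2 := by
  rw [etaMetric_eq_sum b]
  simp only [real_inner_self_eq_norm_sq]

theorem sum_J_J {E : Type*} [AddCommGroup E] [Module ℝ E] (b : OrthonormalBasis ι ℝ V)
    {J : V →L[ℝ] V} (hJ : ∀ x, J (J x) = -x) (hs : IsSkew J) (φ : V →ₗ[ℝ] V →ₗ[ℝ] E) :
    ∑ i, φ (J (b i)) (J (b i)) = ∑ i, φ (b i) (b i) := by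
  have h := sum_adjoint b (φ ∘ₗ (J : V →ₗ[ℝ] V)) (A := J) (B := -J) (fun x y => by simp [hs x y])
  simpa [hJ] using h

theorem etaMetric_mul_J (b : OrthonormalBasis ι ℝ V) {J : V →L[ℝ] V} (hJ : ∀ x, J (J x) = -x)
    (hs : IsSkew J) (A B : V →L[ℝ] V) : etaMetric (A * J) (B * J) = etaMetric A B := by
  rw [etaMetric_eq_sum b, etaMetric_eq_sum b]
  congr 1
  exact sum_J_J b hJ hs ((innerₗ V).compl₁₂ (A : V →ₗ[ℝ] V) (B : V →ₗ[ℝ] V))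

theorem etaMetric_add_left (A B C : V →L[ℝ] V) :
    etaMetric (A + B) C = etaMetric A C + etaMetric B C := by
  simp only [etaMetric_eq_sum (stdOrthonormalBasis ℝ V), add_apply, inner_add_left,
    Finset.sum_add_distrib, mul_add]

theorem etaMetric_self_eq_zero {A : V →L[ℝ] V} (h : etaMetric A A = 0) : A = 0 := by
  rw [etaMetric_self (stdOrthonormalBasis ℝ V)] at h
  have h1 : ∑ i, ‖A (stdOrthonormalBasis ℝ V i)‖ ^ 2 = 0 := by linarith
  rw [Finset.sum_eq_zero_iff_of_nonneg (fun i _ => by positivity)] at h1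
  have h2 : (A : V →ₗ[ℝ] V) = 0 := (stdOrthonormalBasis ℝ V).toBasis.ext fun i => by
    have := h1 i (Finset.mem_univ i)
    simpa using this
  ext x
  exact congrArg (fun f : V →ₗ[ℝ] V => f x) h2

theorem IsSkew.of_hasDerivWithinAt {s : Set ℝ} {γ : ℝ → V →L[ℝ] V} {D : V →L[ℝ] V} {t : ℝ}
    (hu : UniqueDiffWithinAt ℝ s t) (ht : t ∈ s) (hγ : ∀ t ∈ s, IsSkew (γ t))
    (h : HasDerivWithinAt γ D s t) : IsSkew D := by
  intro x y
  have h1 : HasDerivWithinAt (fun t => inner ℝ (γ t x) y + inner ℝ x (γ t y))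
      (inner ℝ (D x) y + inner ℝ x (D y)) s t := by
    have hx := h.clm_apply (hasDerivWithinAt_const t s x)
    have hy := h.clm_apply (hasDerivWithinAt_const t s y)
    have h2 := (hx.inner ℝ (hasDerivWithinAt_const t s y)).add
      ((hasDerivWithinAt_const t s x).inner ℝ hy)
    refine h2.congr_deriv ?_
    simp
  have h2 : HasDerivWithinAt (fun t => inner ℝ (γ t x) y + inner ℝ x (γ t y)) 0 s t :=
    (hasDerivWithinAt_const t s (0 : ℝ)).congr (fun t ht => by rw [hγ t ht]; simp)
      (by rw [hγ t ht]; simp)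
  have h3 := UniqueDiffWithinAt.eq_deriv s hu h1 h2
  linarith

/-- Geodesics in the space of compatible complex structures are orbits of one-parameter groups. -/
theorem geodesic_eq_flow {n : ℕ} {o : Orientation ℝ V (Fin (2 * n))} {γ : ℝ → V →L[ℝ] V}
    (hγ : IsGeodesicOn o γ (Set.Icc 0 1)) :
    ∃ B : V →L[ℝ] V, IsSkew B ∧ B * γ 0 = -(γ 0 * B) ∧
      ∀ t ∈ Set.Icc (0 : ℝ) 1, γ t = flow B t * γ 0 := by
  set I := Set.Icc (0 : ℝ) 1 with hI
  obtain ⟨hC, hJ, hG⟩ := hγ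
  have hu : UniqueDiffOn ℝ I := uniqueDiffOn_Icc zero_lt_one
  set D := derivWithin γ I with hD
  have hC1 : ContDiffOn ℝ 1 D I := hC.derivWithin hu (by norm_num)
  have d1 : ∀ t ∈ I, HasDerivWithinAt γ (D t) I t := fun t ht =>
    ((hC.differentiableOn (by norm_num)) t ht).hasDerivWithinAt
  set D2 := derivWithin D I with hD2
  have d2 : ∀ t ∈ I, HasDerivWithinAt D (D2 t) I t := fun t ht =>
    ((hC1.differentiableOn (by norm_num)) t ht).hasDerivWithinAt
  have hit : ∀ t, iteratedDerivWithin 2 γ I t = D2 t := by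
    intro t
    have : iteratedDerivWithin 1 γ I = D := iteratedDerivWithin_one
    rw [iteratedDerivWithin_succ, this]
  have hsq : ∀ t ∈ I, γ t * γ t = -1 := fun t ht => compatibleJ_sq (hJ t ht)
  have sJ : ∀ t ∈ I, IsSkew (γ t) := fun t ht => compatibleJ_skew (hJ t ht)
  have sD : ∀ t ∈ I, IsSkew (D t) := fun t ht =>
    IsSkew.of_hasDerivWithinAt (hu t ht) ht sJ (d1 t ht)
  have sD2 : ∀ t ∈ I, IsSkew (D2 t) := fun t ht =>
    IsSkew.of_hasDerivWithinAt (hu t ht) ht sD (d2 t ht)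
  have e1 : ∀ t ∈ I, D t * γ t + γ t * D t = 0 := fun t ht =>
    UniqueDiffWithinAt.eq_deriv I (hu t ht) ((d1 t ht).mul (d1 t ht))
      ((hasDerivWithinAt_const t I (-1)).congr (fun t ht => hsq t ht) (hsq t ht))
  have e2 : ∀ t ∈ I, D2 t * γ t + D t * D t + (D t * D t + γ t * D2 t) = 0 := fun t ht =>
    UniqueDiffWithinAt.eq_deriv I (hu t ht)
      (((d2 t ht).mul (d1 t ht)).add ((d1 t ht).mul (d2 t ht)))
      ((hasDerivWithinAt_const t I 0).congr (fun t ht => e1 t ht) (e1 t ht))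
  have e3 : ∀ t ∈ I, D2 t + γ t * D2 t * γ t = 0 := by
    intro t ht
    set J := γ t
    -- Twice the tangential component of the acceleration. The geodesic equation makes it orthogonal
    -- to both summands, hence to itself.
    set A := D2 t + J * D2 t * J with hA
    have hAJ : A * J = -(J * A) := by
      rw [hA, add_mul, mul_add, mul_assoc (J * D2 t), hsq t ht, ← mul_assoc J (J * D2 t),
        ← mul_assoc J J, hsq t ht]
      noncomm_ring
    have hAt : A ∈ tangentJ J := by
      refine ⟨fun x y => ?_, fun x => ?_⟩
      · change inner ℝ (D2 t x + J (D2 t (J x))) y = -inner ℝ x (D2 t y + J (D2 t (J y)))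
        rw [inner_add_left, inner_add_right, sD2 t ht, sJ t ht, sD2 t ht, sJ t ht]
        ring
      · exact congrArg (fun A : V →L[ℝ] V => A x) hAJ
    have h1 : etaMetric (D2 t) A = 0 := by rw [← hit t]; exact hG t ht A hAt
    have hJJ : ∀ x, J (J x) = -x := (hJ t ht).1
    have h2 : etaMetric (J * D2 t * J) A = 0 := by
      have h3 : etaMetric (J * D2 t * J * J) (A * J) = etaMetric (D2 t) A := by
        rw [mul_assoc (J * D2 t), hsq t ht, hAJ,
          etaMetric_eq_sum (stdOrthonormalBasis ℝ V), etaMetric_eq_sum (stdOrthonormalBasis ℝ V)]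
        congr 1
        refine Finset.sum_congr rfl fun i _ => ?_
        simp [(hJ t ht).2.1, J]
      rw [← etaMetric_mul_J (stdOrthonormalBasis ℝ V) hJJ (sJ t ht), h3, h1]
    have h4 : etaMetric A A = 0 := by
      nth_rewrite 1 [hA]
      rw [etaMetric_add_left, h1, h2, add_zero]
    exact etaMetric_self_eq_zero h4
  -- The acceleration now commutes with γ, so differentiating γ² = -1 twice gives half of `e2`. The
  -- left side is the derivative of γ'γ, which is therefore constant.
  have e4 : ∀ t ∈ I, D2 t * γ t + D t * D t = 0 := by
    intro t ht
    have h1 : γ t * D2 t = D2 t * γ t := by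
      have h := congrArg (fun z => γ t * z) (e3 t ht)
      simp only [mul_add, mul_zero, ← mul_assoc, hsq t ht] at h
      rw [← sub_eq_zero]
      simpa [sub_eq_add_neg] using h
    have h2 := e2 t ht
    rw [h1] at h2
    have h3 : (2 : ℝ) • (D2 t * γ t + D t * D t) = 0 := by rw [two_smul, ← h2]; abel
    exact (smul_eq_zero.mp h3).resolve_left two_ne_zero
  -- This is γ'γ⁻¹ at time 0, as γ⁻¹ = -γ; its constancy is the linear equation γ' = Bγ.
  set B := -(D 0 * γ 0) with hB
  have h0 : (0 : ℝ) ∈ I := Set.left_mem_Icc.mpr zero_le_one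
  have hconst : ∀ t ∈ I, -(D t * γ t) = B := by
    have hd : ∀ t ∈ I, HasDerivWithinAt (fun t => -(D t * γ t)) 0 I t := by
      intro t ht
      have h := ((d2 t ht).mul (d1 t ht)).neg
      rw [e4 t ht, neg_zero] at h
      exact h
    exact constant_of_derivWithin_zero (fun t ht => (hd t ht).differentiableWithinAt)
      (fun t ht => (hd t (Set.Ico_subset_Icc_self ht)).derivWithin
        (hu t (Set.Ico_subset_Icc_self ht)))
  have hDB : ∀ t ∈ I, D t = B * γ t := by
    intro t ht
    rw [← hconst t ht, neg_mul, mul_assoc, hsq t ht]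
    simp
  have anti : ∀ t ∈ I, γ t * D t = -(D t * γ t) := fun t ht => by
    rw [eq_neg_iff_add_eq_zero, add_comm]; exact e1 t ht
  refine ⟨B, ?_, ?_, ?_⟩
  · intro x y
    have h : ∀ x, B x = γ 0 (D 0 x) := by
      intro x
      have := congrArg (fun A : V →L[ℝ] V => A x) (anti 0 h0)
      exact this.symm
    have h' : ∀ x, B x = -(D 0 (γ 0 x)) := fun x => rfl
    rw [h x, sJ 0 h0, sD 0 h0, h', inner_neg_right]
  · rw [← hDB 0 h0, hB, mul_neg, neg_neg, ← mul_assoc, anti 0 h0, neg_mul, mul_assoc, hsq 0 h0]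
    simp
  · intro t ht
    have hd : ∀ t ∈ I, HasDerivWithinAt (fun t => flow B (-t) * γ t) 0 I t := by
      intro t ht
      have h := (hasDerivAt_flow_neg B t).hasDerivWithinAt (s := I) |>.mul (d1 t ht)
      refine h.congr_deriv ?_
      rw [hDB t ht, ← mul_assoc, flow_comm, neg_mul, neg_add_cancel]
    have h := constant_of_derivWithin_zero (fun t ht => (hd t ht).differentiableWithinAt)
      (fun t ht => (hd t (Set.Ico_subset_Icc_self ht)).derivWithin
        (hu t (Set.Ico_subset_Icc_self ht))) t ht
    have h2 := congrArg (fun z => flow B t * z) h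
    simpa only [← mul_assoc, flow_mul_neg, one_mul, neg_zero, flow_zero, mul_one] using h2

end Geodesics

end FermionicTransport

end

noncomputable section

set_option linter.unusedSectionVars false

namespace FermionicTransport

/-! ### Minimising geodesics and the cut locus -/

section CutLocus

open Real

variable {V : Type*} [NormedAddCommGroup V] [InnerProductSpace ℝ V] [FiniteDimensional ℝ V]
variable {ι : Type*} [Fintype ι]

/-- Orthonormal bases of eigenvectors of the square of a skew-symmetric operator. -/
def IsEigenbasis (b : OrthonormalBasis ι ℝ V) (B : V →L[ℝ] V) : Prop :=
  ∀ i, B (B (b i)) = -(‖B (b i)‖ ^ 2) • b i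

theorem exists_eigenbasis {B : V →L[ℝ] V} (hB : IsSkew B) :
    ∃ b : OrthonormalBasis (Fin (Module.finrank ℝ V)) ℝ V, IsEigenbasis b B := by
  have hs : ((B * B : V →L[ℝ] V) : V →ₗ[ℝ] V).IsSymmetric := by
    intro x y
    change inner ℝ (B (B x)) y = inner ℝ x (B (B y))
    rw [hB, hB, neg_neg]
  refine ⟨hs.eigenvectorBasis rfl, fun i => ?_⟩
  have h := hs.apply_eigenvectorBasis rfl i
  set v := hs.eigenvectorBasis rfl i
  have h1 : B (B v) = hs.eigenvalues rfl i • v := h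
  have hv : ‖v‖ = 1 := (hs.eigenvectorBasis rfl).orthonormal.1 i
  have h2 : inner ℝ v (B (B v)) = hs.eigenvalues rfl i := by
    rw [h1, inner_smul_right, real_inner_self_eq_norm_sq, hv]; ring
  rw [hB.right, real_inner_self_eq_norm_sq] at h2
  rw [h1, ← h2]

/-- For β ≠ 0 the flow rotates the plane of v and Bv with angular speed β. For β = 0 the quotient by
zero is harmless, since it multiplies Bv = 0. -/
theorem flow_apply_eigenvector {B : V →L[ℝ] V} {v : V} {β : ℝ} (hβ : β = ‖B v‖)
    (h : B (B v) = -(β ^ 2) • v) (t : ℝ) :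
    flow B t v = cos (t * β) • v + (sin (t * β) / β) • B v := by
  by_cases h0 : β = 0
  · have hv : B v = 0 := by rw [← norm_eq_zero, ← hβ, h0]
    have h1 := eq_of_deriv_zero (f := fun t => flow B t v) (fun t => by
      have h := (hasDerivAt_flow B t).clm_apply (hasDerivAt_const t v)
      refine h.congr_deriv ?_
      rw [← flow_comm]
      simp [hv]) t
    simp only [flow_zero] at h1
    rw [h1, h0, hv]; simp
  · have hu : ∀ t, HasDerivAt (fun t => cos (t * β) • v + (sin (t * β) / β) • B v)
        ((-sin (t * β) * β) • v + (cos (t * β)) • B v) t := by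
      intro t
      have hm : HasDerivAt (fun t : ℝ => t * β) β t := by
        simpa using (hasDerivAt_id t).mul_const β
      have h1 := (hm.cos.smul_const v).add ((hm.sin.div_const β).smul_const (B v))
      refine h1.congr_deriv ?_
      rw [mul_div_assoc, div_self h0, mul_one]
    have h1 := eq_of_deriv_zero
      (f := fun t => flow B (-t) (cos (t * β) • v + (sin (t * β) / β) • B v)) (fun t => by
      have h2 := (hasDerivAt_flow_neg B t).clm_apply (hu t)
      refine h2.congr_deriv ?_
      rw [← flow_comm]
      change -(flow B (-t) (B (cos (t * β) • v + (sin (t * β) / β) • B v))) + _ = 0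
      have e : B (cos (t * β) • v + (sin (t * β) / β) • B v) =
          (-sin (t * β) * β) • v + cos (t * β) • B v := by
        rw [map_add, map_smul, map_smul, h, smul_smul, add_comm]
        congr 2
        field_simp
      rw [e, neg_add_cancel]) t
    simp only [neg_zero, flow_zero, zero_mul, cos_zero, sin_zero, zero_div, zero_smul, add_zero,
      one_smul] at h1
    have h2 := congrArg (flow B t) h1
    have h3 : ∀ x, flow B t (flow B (-t) x) = x := fun x =>
      congrArg (fun A : V →L[ℝ] V => A x) (flow_mul_neg B t)
    rw [h3] at h2
    exact h2.symm

theorem inner_flow_eigenvector {B : V →L[ℝ] V} (hB : IsSkew B) {v : V} (hv : ‖v‖ = 1)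
    (h : B (B v) = -(‖B v‖ ^ 2) • v) (t : ℝ) : inner ℝ v (flow B t v) = cos (t * ‖B v‖) := by
  have h0 : inner ℝ v (B v) = 0 := by
    have h1 := hB v v
    rw [real_inner_comm] at h1
    linarith
  rw [flow_apply_eigenvector rfl h, inner_add_right, inner_smul_right, inner_smul_right, h0,
    real_inner_self_eq_norm_sq, hv]
  ring

theorem hasDerivAt_flow_mul (B J : V →L[ℝ] V) (t : ℝ) :
    HasDerivAt (fun t => flow B t * J) (B * (flow B t * J)) t :=
  ((hasDerivAt_flow B t).mul_const J).congr_deriv (mul_assoc _ _ _)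

theorem contDiff_flow_mul (B J : V →L[ℝ] V) (k : ℕ) : ContDiff ℝ k (fun t => flow B t * J) := by
  have hd : deriv (fun t => flow B t * J) = fun t => B * (flow B t * J) :=
    funext fun t => (hasDerivAt_flow_mul B J t).deriv
  have hdiff : Differentiable ℝ (fun t => flow B t * J) :=
    fun t => (hasDerivAt_flow_mul B J t).differentiableAt
  induction k with
  | zero => exact contDiff_zero.mpr hdiff.continuous
  | succ k ih =>
    have : ((k + 1 : ℕ) : WithTop ℕ∞) = (k : WithTop ℕ∞) + 1 := by push_cast; rfl
    rw [this, contDiff_succ_iff_deriv]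
    refine ⟨hdiff, by simp, ?_⟩
    rw [hd]
    exact contDiff_const.mul ih

/-- The acceleration B²J_t commutes with J_t, whereas tangent vectors anticommute with it. As J_t
acts isometrically from either side, the pairing of the two equals its own negative. -/
theorem isGeodesicOn_flow {n : ℕ} {o : Orientation ℝ V (Fin (2 * n))} {J B : V →L[ℝ] V}
    (hJ : J ∈ compatibleJ o) (hB : IsSkew B) (hBJ : B * J = -(J * B)) :
    IsGeodesicOn o (fun t => flow B t * J) Set.univ := by
  refine ⟨(contDiff_flow_mul B J 2).contDiffOn, fun t _ => compatibleJ_flow hJ hB hBJ t,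
    fun t _ A hA => ?_⟩
  have hd : deriv (fun t => flow B t * J) = fun t => B * (flow B t * J) :=
    funext fun t => (hasDerivAt_flow_mul B J t).deriv
  have h2 : iteratedDerivWithin 2 (fun t => flow B t * J) Set.univ t =
      B * (B * (flow B t * J)) := by
    rw [iteratedDerivWithin_univ, iteratedDeriv_succ, iteratedDeriv_one, hd]
    exact ((hasDerivAt_flow_mul B J t).const_mul B).deriv
  set Jt := flow B t * J with hJt
  have hJt' : Jt ∈ compatibleJ o := compatibleJ_flow hJ hB hBJ t
  have hBt : B * Jt = -(Jt * B) := by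
    rw [hJt, ← mul_assoc, ← flow_comm, mul_assoc, hBJ, mul_neg, mul_assoc]
  rw [h2]
  let b := stdOrthonormalBasis ℝ V
  have h3 := etaMetric_mul_J b hJt'.1 (compatibleJ_skew hJt') (B * (B * Jt)) A
  have e1 : B * (B * Jt) * Jt = Jt * (B * (B * Jt)) := by
    rw [← mul_assoc B B Jt, ← mul_assoc Jt, ← mul_assoc Jt B B, ← neg_eq_iff_eq_neg.mpr hBt,
      neg_mul, mul_assoc B Jt B, ← neg_eq_iff_eq_neg.mpr hBt]
    noncomm_ring
  have e2 : A * Jt = -(Jt * A) := by ext x; exact hA.2 x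
  have e3 : etaMetric (Jt * (B * (B * Jt))) (-(Jt * A)) = -etaMetric (B * (B * Jt)) A := by
    have h4 : ∑ i, inner ℝ ((Jt * (B * (B * Jt))) (b i)) ((-(Jt * A)) (b i)) =
        -∑ i, inner ℝ ((B * (B * Jt)) (b i)) (A (b i)) := by
      rw [← Finset.sum_neg_distrib]
      refine Finset.sum_congr rfl fun i _ => ?_
      rw [neg_apply, inner_neg_right]
      congr 1
      exact hJt'.2.1 _ _
    rw [etaMetric_eq_sum b, etaMetric_eq_sum b, h4, mul_neg]
  rw [e1, e2, e3] at h3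
  linarith

theorem curveLength_flow {n : ℕ} {o : Orientation ℝ V (Fin (2 * n))} {J B : V →L[ℝ] V}
    (hJ : J ∈ compatibleJ o) (hB : IsSkew B) (b : OrthonormalBasis ι ℝ V) (s : ℝ) :
    curveLength (fun t => flow B t * J) 0 s = s * (1 / 2 * √(∑ i, ‖B (b i)‖ ^ 2)) := by
  have h : ∀ t, √(etaMetric (deriv (fun t => flow B t * J) t)
      (deriv (fun t => flow B t * J) t)) = 1 / 2 * √(∑ i, ‖B (b i)‖ ^ 2) := by
    intro t
    rw [(hasDerivAt_flow_mul B J t).deriv, ← mul_assoc,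
      etaMetric_mul_J b hJ.1 (compatibleJ_skew hJ), etaMetric_self b]
    have h1 : ∀ i, ‖(B * flow B t) (b i)‖ = ‖B (b i)‖ := by
      intro i
      rw [← flow_comm]
      exact norm_flow hB t _
    simp only [h1]
    rw [sqrt_mul (by norm_num)]
    congr 1
    rw [show (1 / 4 : ℝ) = (1 / 2) ^ 2 by norm_num, sqrt_sq (by norm_num)]
  simp only [curveLength, h]
  rw [intervalIntegral.integral_const, sub_zero, smul_eq_mul]

/-- The spherical distance from a fixed unit vector grows no faster than arc length. The factor r <
1 keeps the argument away from ±1, where arccos is not differentiable, and only slows the growth. -/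
theorem exists_hasDerivAt_arccos {v : ℝ → V} {v' : V} {t r : ℝ} (hr0 : 0 ≤ r) (hr : r < 1) {w : V}
    (hw : ‖w‖ = 1) (hv : HasDerivAt v v' t) (hn : ∀ᶠ s in nhds t, ‖v s‖ = 1) :
    ∃ g', HasDerivAt (fun s => arccos (r * inner ℝ w (v s))) g' t ∧ g' ≤ ‖v'‖ := by
  have hvt : ‖v t‖ = 1 := hn.self_of_nhds
  have hort : inner ℝ (v t) v' = 0 := by
    have h1 : HasDerivAt (fun s => inner ℝ (v s) (v s)) (inner ℝ (v t) v' + inner ℝ v' (v t)) t :=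
      hv.inner ℝ hv
    have h2 : HasDerivAt (fun s => inner ℝ (v s) (v s)) 0 t :=
      (hasDerivAt_const t (1 : ℝ)).congr_of_eventuallyEq (hn.mono fun s hs => by
        simp only [real_inner_self_eq_norm_sq, hs]; norm_num)
    have h3 := h1.unique h2
    rw [real_inner_comm (v t) v'] at h3
    linarith
  set x := inner ℝ w (v t) with hx
  have hx1 : |x| ≤ 1 := by
    have := abs_real_inner_le_norm w (v t)
    rwa [hw, hvt, mul_one] at this
  have hx2 : x ^ 2 ≤ 1 := by rw [← sq_abs]; exact pow_le_one₀ (abs_nonneg _) hx1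
  have hrx : (r * x) ^ 2 < 1 := by
    rw [mul_pow]
    calc r ^ 2 * x ^ 2 ≤ r ^ 2 * 1 := mul_le_mul_of_nonneg_left hx2 (sq_nonneg r)
      _ < 1 := by rw [mul_one]; exact pow_lt_one₀ hr0 hr two_ne_zero
  have hd : HasDerivAt (fun s => r * inner ℝ w (v s)) (r * inner ℝ w v') t := by
    have h := ((hasDerivAt_const t w).inner ℝ hv).const_mul r
    refine h.congr_deriv ?_
    simp
  refine ⟨_, HasDerivAt.comp (h₂ := arccos) t
    (hasDerivAt_arccos (x := r * inner ℝ w (v t)) ?_ ?_) hd, ?_⟩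
  · intro h; rw [← hx] at h; rw [h] at hrx; norm_num at hrx
  · intro h; rw [← hx] at h; rw [h] at hrx; norm_num at hrx
  · have h1 : inner ℝ w v' = inner ℝ (w - x • v t) v' := by
      rw [inner_sub_left, inner_smul_left, hort]; simp
    have h2 : ‖w - x • v t‖ ^ 2 = 1 - x ^ 2 := by
      rw [norm_sub_sq_real, inner_smul_right, ← hx, norm_smul, hw, hvt, norm_eq_abs, mul_one,
        sq_abs]
      ring
    have h3 : |inner ℝ w v'| ≤ √(1 - x ^ 2) * ‖v'‖ := by
      rw [h1, ← h2, sqrt_sq (norm_nonneg _)]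
      exact abs_real_inner_le_norm _ _
    have hs : 0 < √(1 - (r * x) ^ 2) := sqrt_pos.mpr (by linarith)
    have h4 : r * √(1 - x ^ 2) ≤ √(1 - (r * x) ^ 2) := by
      refine le_sqrt_of_sq_le ?_
      rw [mul_pow, sq_sqrt (by linarith)]
      nlinarith
    have h5 : -(r * inner ℝ w v') ≤ ‖v'‖ * √(1 - (r * x) ^ 2) := by
      have h6 : -(r * inner ℝ w v') ≤ r * |inner ℝ w v'| := by
        have := neg_abs_le (inner ℝ w v')
        nlinarith
      have h7 : r * |inner ℝ w v'| ≤ r * (√(1 - x ^ 2) * ‖v'‖) :=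
        mul_le_mul_of_nonneg_left h3 hr0
      nlinarith [norm_nonneg v']
    have h8 : -(1 / √(1 - (r * x) ^ 2)) * (r * inner ℝ w v') =
        -(r * inner ℝ w v') / √(1 - (r * x) ^ 2) := by ring
    rw [← hx, h8, div_le_iff₀ hs]
    exact h5

theorem curveLength_nonneg (c : ℝ → V →L[ℝ] V) : 0 ≤ curveLength c 0 1 :=
  intervalIntegral.integral_nonneg zero_le_one fun _ _ => sqrt_nonneg _

/-- A calibration: along any competitor c the weighted sum ∑ β_i ∠(b_i, c(t)w_i), with β_i = ‖B
b_i‖, grows at most at the rate (∑ β_i²)^{1/2} (∑ ‖c'w_i‖²)^{1/2}, a multiple of the speed of c. At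
the end it equals s ∑ β_i², because angles sβ_i ≤ π are recovered exactly from their cosines. -/
theorem isMinimizingUpTo_flow {n : ℕ} {o : Orientation ℝ V (Fin (2 * n))} {J B : V →L[ℝ] V}
    (hJ : J ∈ compatibleJ o) (hB : IsSkew B) {b : OrthonormalBasis ι ℝ V}
    (hb : IsEigenbasis b B) {s : ℝ} (hs : 0 ≤ s) (hsb : ∀ i, s * ‖B (b i)‖ ≤ π) :
    IsMinimizingUpTo o (fun t => flow B t * J) s := by
  intro c hc hcJ hc0 hc1
  rw [curveLength_flow hJ hB b]
  set R := √(∑ i, ‖B (b i)‖ ^ 2) with hR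
  have hR0 : 0 ≤ R := sqrt_nonneg _
  have hR2 : R ^ 2 = ∑ i, ‖B (b i)‖ ^ 2 := sq_sqrt (Finset.sum_nonneg fun i _ => by positivity)
  set I := Set.Icc (0 : ℝ) 1 with hI
  have hu : UniqueDiffOn ℝ I := uniqueDiffOn_Icc zero_lt_one
  set D := derivWithin c I with hD
  have hDc : ContinuousOn D I := hc.continuousOn_derivWithin hu le_rfl
  have hderiv : ∀ t ∈ Set.Ioo (0 : ℝ) 1, HasDerivAt c (D t) t := fun t ht =>
    (((hc.differentiableOn one_ne_zero) t (Set.Ioo_subset_Icc_self ht)).hasDerivWithinAt).hasDerivAt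
      (Icc_mem_nhds ht.1 ht.2)
  -- w_i = J⁻¹ b_i, so that the geodesic moves w_i along the rotation orbit of b_i.
  set w : ι → V := fun i => -J (b i) with hw
  have hJw : ∀ i, J (w i) = b i := fun i => by rw [hw]; simp [hJ.1]
  have hwn : ∀ i, ‖w i‖ = 1 := by
    intro i
    have h := hJ.2.1 (b i) (b i)
    rw [real_inner_self_eq_norm_sq, real_inner_self_eq_norm_sq, b.orthonormal.1 i] at h
    rw [hw, norm_neg]
    nlinarith [norm_nonneg (J (b i))]
  have hcw : ∀ i, ∀ t ∈ I, ‖c t (w i)‖ = 1 := by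
    intro i t ht
    have h := (hcJ t ht).2.1 (w i) (w i)
    rw [real_inner_self_eq_norm_sq, real_inner_self_eq_norm_sq, hwn i] at h
    nlinarith [norm_nonneg (c t (w i))]
  have heta : ∀ A : V →L[ℝ] V, etaMetric A A = 1 / 4 * ∑ i, ‖A (w i)‖ ^ 2 := by
    intro A
    rw [← etaMetric_mul_J b hJ.1 (compatibleJ_skew hJ), etaMetric_self b]
    congr 1
    refine Finset.sum_congr rfl fun i _ => ?_
    rw [hw, map_neg, norm_neg]
    rfl
  set φ : ℝ → ℝ := fun t => 2 * R * √(etaMetric (D t) (D t)) with hφ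
  have hφc : ContinuousOn φ I := by
    refine continuousOn_const.mul (ContinuousOn.sqrt ?_)
    simp only [heta]
    refine continuousOn_const.mul (continuousOn_finsetSum _ fun i _ => ?_)
    exact ((hDc.clm_apply continuousOn_const).norm).pow 2
  -- The length uses two-sided derivatives and `D` is one-sided at the ends; they agree in the
  -- interior, which suffices for the integral.
  have hL : ∫ t in (0 : ℝ)..1, φ t = 2 * R * curveLength c 0 1 := by
    rw [hφ, intervalIntegral.integral_const_mul, curveLength]
    congr 1
    refine intervalIntegral.integral_congr_Ioo_of_le zero_le_one fun t ht => ?_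
    simp only [(hderiv t ht).deriv]
  have key : ∀ r : ℝ, 0 ≤ r → r < 1 →
      ∑ i, ‖B (b i)‖ * (arccos (r * cos (s * ‖B (b i)‖)) - arccos (r * 1)) ≤
        2 * R * curveLength c 0 1 := by
    intro r hr0 hr
    set G : ℝ → ℝ := fun t => ∑ i, ‖B (b i)‖ * arccos (r * inner ℝ (b i) (c t (w i))) with hG
    have hGc : ContinuousOn G I := by
      refine continuousOn_finsetSum _ fun i _ => continuousOn_const.mul ?_
      refine continuous_arccos.comp_continuousOn (continuousOn_const.mul ?_)
      exact continuousOn_const.inner ((hc.continuousOn).clm_apply continuousOn_const)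
    have hGd : ∀ t ∈ Set.Ioo (0 : ℝ) 1, ∃ g', HasDerivAt G g' t ∧ g' ≤ φ t := by
      intro t ht
      have h1 : ∀ i, ∃ g', HasDerivAt (fun t => arccos (r * inner ℝ (b i) (c t (w i)))) g' t ∧
          g' ≤ ‖D t (w i)‖ := by
        intro i
        refine exists_hasDerivAt_arccos hr0 hr (b.orthonormal.1 i) (v := fun t => c t (w i)) ?_ ?_
        · have h := (hderiv t ht).clm_apply (hasDerivAt_const t (w i))
          refine h.congr_deriv ?_
          simp
        · filter_upwards [Icc_mem_nhds ht.1 ht.2] with τ hτ using hcw i τ hτ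
      choose g' hg' hle using h1
      refine ⟨∑ i, ‖B (b i)‖ * g' i, ?_, ?_⟩
      · exact HasDerivAt.fun_sum fun i _ => (hg' i).const_mul _
      · calc ∑ i, ‖B (b i)‖ * g' i ≤ ∑ i, ‖B (b i)‖ * ‖D t (w i)‖ :=
              Finset.sum_le_sum fun i _ => mul_le_mul_of_nonneg_left (hle i) (norm_nonneg _)
          _ ≤ R * √(∑ i, ‖D t (w i)‖ ^ 2) := Real.sum_mul_le_sqrt_mul_sqrt _ _ _
          _ = φ t := by
              have h4 : √(1 / 4 : ℝ) = 1 / 2 := by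
                rw [show (1 / 4 : ℝ) = (1 / 2) ^ 2 by norm_num, sqrt_sq (by norm_num)]
              rw [hφ]
              simp only
              rw [heta, sqrt_mul (by norm_num), h4]
              ring
    have h := intervalIntegral.sub_le_integral_of_hasDeriv_right_of_le (g' := deriv G) zero_le_one
      hGc (fun t ht => by
        obtain ⟨g', h1, _⟩ := hGd t ht
        rw [h1.deriv]
        exact h1.hasDerivWithinAt)
      (hφc.integrableOn_Icc) (fun t ht => by
        obtain ⟨g', h1, h2⟩ := hGd t ht
        rw [h1.deriv]
        exact h2)
    rw [hL] at h
    refine le_trans (le_of_eq ?_) h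
    rw [hG]
    simp only [← Finset.sum_sub_distrib, ← mul_sub]
    refine Finset.sum_congr rfl fun i _ => ?_
    have e0 : c 0 (w i) = b i := by
      rw [hc0]
      change flow B 0 (J (w i)) = _
      rw [hJw, flow_zero]
      rfl
    have e1 : c 1 (w i) = flow B s (b i) := by
      rw [hc1]
      change flow B s (J (w i)) = _
      rw [hJw]
    rw [e0, e1, inner_flow_eigenvector hB (b.orthonormal.1 i) (hb i), real_inner_self_eq_norm_sq,
      b.orthonormal.1 i]
    norm_num
  -- Continuity of arccos removes the regularisation r < 1.
  have hlim : ∑ i, ‖B (b i)‖ * (arccos (1 * cos (s * ‖B (b i)‖)) - arccos (1 * 1)) ≤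
      2 * R * curveLength c 0 1 := by
    have hcont : Continuous fun r : ℝ =>
        ∑ i, ‖B (b i)‖ * (arccos (r * cos (s * ‖B (b i)‖)) - arccos (r * 1)) := by
      refine continuous_finsetSum _ fun i _ => continuous_const.mul (Continuous.sub ?_ ?_)
      · exact continuous_arccos.comp (continuous_id.mul continuous_const)
      · exact continuous_arccos.comp (continuous_id.mul continuous_const)
    have ht : Filter.Tendsto (fun r : ℝ =>
        ∑ i, ‖B (b i)‖ * (arccos (r * cos (s * ‖B (b i)‖)) - arccos (r * 1)))
        (nhdsWithin (1 : ℝ) (Set.Iio 1)) (nhds _) := (hcont.tendsto 1).mono_left nhdsWithin_le_nhds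
    refine le_of_tendsto ht ?_
    filter_upwards [Ioo_mem_nhdsLT (zero_lt_one' ℝ)] with r hr using key r hr.1.le hr.2
  have hsum : ∑ i, ‖B (b i)‖ * (arccos (1 * cos (s * ‖B (b i)‖)) - arccos (1 * 1)) =
      s * R ^ 2 := by
    rw [hR2, Finset.mul_sum]
    refine Finset.sum_congr rfl fun i _ => ?_
    rw [one_mul, one_mul, arccos_one, arccos_cos (mul_nonneg hs (norm_nonneg _)) (hsb i)]
    ring
  rw [hsum] at hlim
  rcases hR0.eq_or_lt with h0 | h0
  · rw [← h0]
    simpa using curveLength_nonneg c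
  · have : R * (s * R) ≤ R * (2 * curveLength c 0 1) := by linarith
    have := le_of_mul_le_mul_left this h0
    linarith

/-- Rodrigues' formula for an operator that is a complex structure on a subspace and zero on a
complement. It is needed at t = 2π, where it gives the identity. -/
theorem flow_of_cube {K : V →L[ℝ] V} (hK : K * K * K = -K) (t : ℝ) :
    flow K t = 1 + sin t • K + (1 - cos t) • (K * K) := by
  have h := eq_of_deriv_zero
    (f := fun t => flow K (-t) * (1 + sin t • K + (1 - cos t) • (K * K))) (fun t => by
    have h1 : HasDerivAt (fun t => 1 + sin t • K + (1 - cos t) • (K * K))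
        (cos t • K + sin t • (K * K)) t := by
      have h2 := (((hasDerivAt_sin t).smul_const K).const_add 1).add
        (((hasDerivAt_cos t).const_sub 1).smul_const (K * K))
      refine h2.congr_deriv ?_
      rw [neg_neg]
    have h2 := (hasDerivAt_flow_neg K t).mul h1
    refine h2.congr_deriv ?_
    have e : K * (1 + sin t • K + (1 - cos t) • (K * K)) = cos t • K + sin t • (K * K) := by
      rw [mul_add, mul_add, mul_smul_comm, mul_smul_comm, ← mul_assoc, hK, mul_one]
      module
    rw [← flow_comm, neg_mul, mul_assoc, e, neg_add_cancel]) t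
  simp only [neg_zero, flow_zero, sin_zero, cos_zero, zero_smul, sub_self, add_zero,
    mul_one] at h
  have h2 := congrArg (fun z => flow K t * z) h
  simp only [← mul_assoc, flow_mul_neg, one_mul, mul_one] at h2
  exact h2.symm

theorem starProjection_comm {U : Submodule ℝ V} {A : V →L[ℝ] V} (hA : IsSkew A)
    (h : ∀ u ∈ U, A u ∈ U) : U.starProjection * A = A * U.starProjection := by
  ext v
  change U.starProjection (A v) = A (U.starProjection v)
  refine (Submodule.eq_starProjection_of_mem_of_inner_eq_zero
    (h _ (Submodule.starProjection_apply_mem _ _)) fun u hu => ?_)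
  rw [← map_sub, hA, Submodule.starProjection_inner_eq_zero v (A u) (h u hu), neg_zero]

/-- Subtracting a full turn from the rotation at angular speed l does not change the end point, but
replaces the angle sl > π by sl - 2π, which is smaller in absolute value. The resulting curve is
strictly shorter. -/
theorem not_isMinimizingUpTo_flow {n : ℕ} {o : Orientation ℝ V (Fin (2 * n))} {J B : V →L[ℝ] V}
    (hJ : J ∈ compatibleJ o) (hB : IsSkew B) (hBJ : B * J = -(J * B))
    {b : OrthonormalBasis ι ℝ V} (hb : IsEigenbasis b B) {s : ℝ} (hs : 0 < s) {j : ι}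
    (hj : π < s * ‖B (b j)‖) : ¬ IsMinimizingUpTo o (fun t => flow B t * J) s := by
  intro hmin
  set l := ‖B (b j)‖ with hl
  have hl0 : 0 < l := by
    by_contra h
    have := mul_nonpos_of_nonneg_of_nonpos hs.le (not_lt.mp h)
    linarith [pi_pos]
  have sJ := compatibleJ_skew hJ
  -- The whole eigenspace of B² is used, since it is stable under J; a single rotation plane of B
  -- would not be.
  let U : Submodule ℝ V := LinearMap.ker ((B * B + (l ^ 2) • 1 : V →L[ℝ] V) : V →ₗ[ℝ] V)
  have hU : ∀ v, v ∈ U ↔ B (B v) = -(l ^ 2) • v := by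
    intro v
    rw [LinearMap.mem_ker]
    change B (B v) + l ^ 2 • v = 0 ↔ _
    rw [neg_smul, eq_neg_iff_add_eq_zero]
  have hJB : ∀ v, J (B v) = -B (J v) := by
    intro v
    have := congrArg (fun A : V →L[ℝ] V => A v) hBJ
    exact (neg_eq_iff_eq_neg.mpr this).symm
  set Pr := U.starProjection with hPr
  have hPrB : Pr * B = B * Pr := starProjection_comm hB fun u hu => by
    rw [hU] at hu ⊢; rw [hu, map_smul]
  have hPrJ : Pr * J = J * Pr := starProjection_comm sJ fun u hu => by
    rw [hU] at hu ⊢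
    rw [← map_smul, ← hu, hJB, hJB, map_neg, neg_neg]
  have hBPr : B * B * Pr = -(l ^ 2) • Pr := by
    ext v
    exact (hU _).mp (Submodule.starProjection_apply_mem U v)
  have hPrPr : Pr * Pr = Pr := Submodule.isIdempotentElem_starProjection U
  -- The unit-speed generator of the rotation on `U`, extended by zero; it inherits skewness and
  -- anticommutation with J from B.
  set K : V →L[ℝ] V := l⁻¹ • (B * Pr) with hK
  have hK2 : K * K = -Pr := by
    rw [hK, smul_mul_smul_comm, mul_assoc B, ← mul_assoc Pr B, hPrB, mul_assoc B, hPrPr, ← mul_assoc,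
      hBPr, smul_smul]
    have : l⁻¹ * l⁻¹ * -l ^ 2 = -1 := by field_simp
    rw [this, neg_one_smul]
  have hK3 : K * K * K = -K := by
    rw [hK2, hK, mul_smul_comm, neg_mul, ← mul_assoc, hPrB, mul_assoc, hPrPr, smul_neg]
  have hPrsymm : ∀ x y, inner ℝ (Pr x) y = inner ℝ x (Pr y) := fun x y =>
    Submodule.inner_starProjection_left_eq_right U x y
  have sK : IsSkew K := by
    intro x y
    have e : ∀ x, Pr (B x) = B (Pr x) := fun x => congrArg (fun A : V →L[ℝ] V => A x) hPrB
    change inner ℝ (l⁻¹ • B (Pr x)) y = -inner ℝ x (l⁻¹ • B (Pr y))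
    rw [inner_smul_left, inner_smul_right, hB, hPrsymm, e]
    simp
  have hKJ : K * J = -(J * K) := by
    rw [hK, smul_mul_assoc, mul_assoc, hPrJ, ← mul_assoc, hBJ, mul_smul_comm, neg_mul, smul_neg,
      mul_assoc]
  have hKB : Commute B K := by
    rw [commute_iff_eq, hK, mul_smul_comm, smul_mul_assoc, mul_assoc B Pr, hPrB]
  set B' : V →L[ℝ] V := s • B - (2 * π) • K with hB'
  have sB' : IsSkew B' := by
    intro x y
    change inner ℝ (s • B x - (2 * π) • K x) y = -inner ℝ x (s • B y - (2 * π) • K y)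
    simp only [inner_sub_left, inner_sub_right, inner_smul_left, inner_smul_right, hB x, sK x]
    simp only [conj_trivial]
    ring
  have hB'J : B' * J = -(J * B') := by
    rw [hB', sub_mul, mul_sub, smul_mul_assoc, smul_mul_assoc, hBJ, hKJ, mul_smul_comm s J B,
      mul_smul_comm _ J K, smul_neg, smul_neg]
    abel
  have hend : flow B' 1 = flow B s := by
    have := FiniteDimensional.complete ℝ V
    let _ := NormedAlgebra.restrictScalars ℚ ℝ (V →L[ℝ] V)
    have h1 : flow K (2 * π) = 1 := by
      rw [flow_of_cube hK3]; simp
    have hc : Commute B' ((2 * π) • K) := by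
      rw [hB']
      exact ((hKB.smul_left s).sub_left ((Commute.refl K).smul_left _)).smul_right _
    have h2 := NormedSpace.exp_add_of_commute hc
    have h3 : B' + (2 * π) • K = s • B := by rw [hB']; abel
    rw [h3] at h2
    change flow B s = NormedSpace.exp B' * flow K (2 * π) at h2
    rw [h1, mul_one] at h2
    rw [h2, flow, one_smul]
  have hlen := hmin (fun t => flow B' t * J) (contDiff_flow_mul B' J 1).contDiffOn
    (fun t _ => compatibleJ_flow hJ sB' hB'J t) (by simp) (by simp only [hend])
  rw [curveLength_flow hJ hB b, curveLength_flow hJ sB' b] at hlen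
  have hbj : ∀ i, ‖B' (b i)‖ ^ 2 ≤ s ^ 2 * ‖B (b i)‖ ^ 2 ∧
      (i = j → ‖B' (b i)‖ ^ 2 < s ^ 2 * ‖B (b i)‖ ^ 2) := by
    intro i
    by_cases hi : ‖B (b i)‖ = l
    · have hiU : b i ∈ U := by rw [hU, hb i, hi]
      have e1 : Pr (b i) = b i := Submodule.starProjection_eq_self_iff.mpr hiU
      have e2 : B' (b i) = (s - 2 * π / l) • B (b i) := by
        change s • B (b i) - (2 * π) • (l⁻¹ • B (Pr (b i))) = _
        rw [e1, smul_smul, ← sub_smul]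
        rfl
      -- This is the inequality |sl - 2π| < sl, divided by l; it holds exactly because sl > π.
      have e3 : (s - 2 * π / l) ^ 2 < s ^ 2 := by
        have : 2 * π / l < 2 * s := by rw [div_lt_iff₀ hl0]; linarith
        have h0 : 0 < 2 * π / l := by positivity
        nlinarith
      have e4 : ‖B' (b i)‖ ^ 2 < s ^ 2 * ‖B (b i)‖ ^ 2 := by
        rw [e2, norm_smul, mul_pow, norm_eq_abs, sq_abs, hi]
        exact mul_lt_mul_of_pos_right e3 (by positivity)
      exact ⟨e4.le, fun _ => e4⟩
    · have e1 : Pr (b i) = 0 := by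
        rw [Submodule.starProjection_apply_eq_zero_iff, Submodule.mem_orthogonal]
        intro u hu
        have h1 : inner ℝ (B (B u)) (b i) = inner ℝ u (B (B (b i))) := by
          rw [hB, hB, neg_neg]
        rw [(hU u).mp hu, hb i, inner_smul_left, inner_smul_right] at h1
        simp only [conj_trivial] at h1
        have h2 : (‖B (b i)‖ ^ 2 - l ^ 2) * inner ℝ u (b i) = 0 := by linarith
        refine (mul_eq_zero.mp h2).resolve_left fun h3 => hi ?_
        have h4 : ‖B (b i)‖ ^ 2 = l ^ 2 := by linarith
        exact (pow_left_inj₀ (norm_nonneg _) hl0.le two_ne_zero).mp h4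
      have e2 : B' (b i) = s • B (b i) := by
        change s • B (b i) - (2 * π) • (l⁻¹ • B (Pr (b i))) = _
        rw [e1]; simp
      refine ⟨?_, fun h => absurd (by rw [h]) hi⟩
      rw [e2, norm_smul, mul_pow, norm_eq_abs, sq_abs]
  have hlt : ∑ i, ‖B' (b i)‖ ^ 2 < ∑ i, s ^ 2 * ‖B (b i)‖ ^ 2 :=
    Finset.sum_lt_sum (fun i _ => (hbj i).1) ⟨j, Finset.mem_univ j, (hbj j).2 rfl⟩
  rw [← Finset.mul_sum] at hlt
  have h1 := sqrt_lt_sqrt (Finset.sum_nonneg fun i _ => by positivity) hlt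
  rw [sqrt_mul (by positivity), sqrt_sq hs.le] at h1
  linarith

/-- The rotation angles of a geodesic that avoids the cut locus are smaller than `π`. -/
theorem norm_lt_pi_of_notMem_cutLocus {n : ℕ} {o : Orientation ℝ V (Fin (2 * n))}
    {J B : V →L[ℝ] V} (hJ : J ∈ compatibleJ o) (hB : IsSkew B) (hBJ : B * J = -(J * B))
    {b : OrthonormalBasis ι ℝ V} (hb : IsEigenbasis b B)
    (h : ∀ t ∈ Set.Icc (0 : ℝ) 1, flow B t * J ∉ cutLocus o J) (i : ι) : ‖B (b i)‖ < π := by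
  by_contra! hi
  obtain ⟨j, -, hj⟩ := Finset.exists_max_image Finset.univ (fun i => ‖B (b i)‖)
    ⟨i, Finset.mem_univ i⟩
  have hj' : π ≤ ‖B (b j)‖ := hi.trans (hj i (Finset.mem_univ i))
  have h0 : 0 < ‖B (b j)‖ := pi_pos.trans_le hj'
  -- The time at which the fastest rotation reaches π. It is at most 1, so this cut point would lie
  -- on the given segment.
  refine h (π / ‖B (b j)‖) ⟨by positivity, (div_le_one h0).mpr hj'⟩ ?_
  refine ⟨fun t => flow B t * J, π / ‖B (b j)‖, isGeodesicOn_flow hJ hB hBJ, by simp,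
    by positivity, rfl, ?_, fun t ht => ?_⟩
  · refine isMinimizingUpTo_flow hJ hB hb (by positivity) fun k => ?_
    rw [div_mul_eq_mul_div, div_le_iff₀ h0]
    exact mul_le_mul_of_nonneg_left (hj k (Finset.mem_univ k)) pi_pos.le
  · refine not_isMinimizingUpTo_flow hJ hB hBJ hb (lt_trans (by positivity) ht) (j := j) ?_
    rwa [div_lt_iff₀ h0] at ht

/-- If R = exp(tB) had eigenvalue -1, so would R⁻¹. But R + R⁻¹ is diagonal in the eigenbasis with
entries 2cos(tβ_i), β_i = ‖B b_i‖, and these exceed -2 as all angles are below π. -/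
theorem isUnit_one_add_flow {B : V →L[ℝ] V} (hB : IsSkew B) {b : OrthonormalBasis ι ℝ V}
    (hb : IsEigenbasis b B) (hlt : ∀ i, ‖B (b i)‖ < π) {t : ℝ} (ht : t ∈ Set.Icc (0 : ℝ) 1) :
    (1 + flow B t).det ≠ 0 := by
  intro hdet
  have hker : ∀ v, v + flow B t v = 0 → v = 0 := by
    intro v hv
    have h1 : flow B t v = -v := eq_neg_of_add_eq_zero_right hv
    have h2 : flow B (-t) v = -v := by
      have h3 : flow B (-t) (flow B t v) = v :=
        congrArg (fun A : V →L[ℝ] V => A v) (flow_neg_mul B t)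
      rw [h1, map_neg] at h3
      rw [← h3, neg_neg, h3]
    refine b.toBasis.ext_elem fun i => ?_
    have h4 : inner ℝ (b i) (flow B t v + flow B (-t) v) =
        2 * cos (t * ‖B (b i)‖) * inner ℝ (b i) v := by
      have e : ∀ t, inner ℝ (b i) (flow B t v) = inner ℝ (flow B (-t) (b i)) v := by
        intro t
        have h3 : flow B (-t) (flow B t v) = v :=
          congrArg (fun A : V →L[ℝ] V => A v) (flow_neg_mul B t)
        rw [← inner_flow hB (-t), h3]
      rw [inner_add_right, e, e, ← inner_add_left, neg_neg, flow_apply_eigenvector rfl (hb i),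
        flow_apply_eigenvector rfl (hb i), neg_mul, cos_neg, sin_neg]
      have : cos (t * ‖B (b i)‖) • b i + (-sin (t * ‖B (b i)‖) / ‖B (b i)‖) • B (b i) +
          (cos (t * ‖B (b i)‖) • b i + (sin (t * ‖B (b i)‖) / ‖B (b i)‖) • B (b i)) =
          (2 * cos (t * ‖B (b i)‖)) • b i := by
        module
      rw [this, inner_smul_left]
      simp
    rw [h1, h2, inner_add_right, inner_neg_right] at h4
    have h5 : (1 + cos (t * ‖B (b i)‖)) * inner ℝ (b i) v = 0 := by linarith
    have h6 : cos π < cos (t * ‖B (b i)‖) := by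
      refine cos_lt_cos_of_nonneg_of_le_pi (mul_nonneg ht.1 (norm_nonneg _)) le_rfl ?_
      calc t * ‖B (b i)‖ ≤ 1 * ‖B (b i)‖ := mul_le_mul_of_nonneg_right ht.2 (norm_nonneg _)
        _ < π := by rw [one_mul]; exact hlt i
    rw [cos_pi] at h6
    have h7 := (mul_eq_zero.mp h5).resolve_left (by linarith)
    simpa [b.repr_apply_apply] using h7
  have hbot := LinearMap.bot_lt_ker_of_det_eq_zero hdet
  obtain ⟨v, hv, hv0⟩ := (Submodule.ne_bot_iff _).mp hbot.ne'
  exact hv0 (hker v hv)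

/-- Since (1 + J)² = 2J, the determinant of J is a square up to a positive factor. -/
theorem det_pos_of_sq {J : V →L[ℝ] V} (hJ : J * J = -1) : 0 < J.det := by
  have h : (1 + J) * (1 + J) = (2 : ℝ) • J := by
    rw [mul_add, add_mul, add_mul, hJ, two_smul]; noncomm_ring
  have hJ0 : J.det ≠ 0 := by
    intro h0
    have h1 : J * -J = 1 := by rw [mul_neg, hJ, neg_neg]
    have h2 := congrArg ContinuousLinearMap.det h1
    rw [det_mul, h0, zero_mul, det_one'] at h2
    exact zero_ne_one h2
  have h3 : (1 + J).det * (1 + J).det = 2 ^ Module.finrank ℝ V * J.det := by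
    rw [← det_mul, h]
    exact LinearMap.det_smul 2 (J : V →ₗ[ℝ] V)
  have h4 : (1 + J).det ≠ 0 := by
    intro h0
    rw [h0, zero_mul] at h3
    have := mul_eq_zero.mp h3.symm
    rcases this with h5 | h5
    · exact absurd h5 (by positivity)
    · exact hJ0 h5
  have h5 : 0 < 2 ^ Module.finrank ℝ V * J.det := by rw [← h3]; exact mul_self_pos.mpr h4
  exact (mul_pos_iff_of_pos_left (by positivity)).mp h5

theorem continuous_det : Continuous (ContinuousLinearMap.det : (V →L[ℝ] V) → ℝ) := by
  let b := stdOrthonormalBasis ℝ V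
  have h : ∀ A : V →L[ℝ] V, A.det =
      (LinearMap.toMatrix b.toBasis b.toBasis (A : V →ₗ[ℝ] V)).det := fun A =>
    (LinearMap.det_toMatrix b.toBasis _).symm
  have : (ContinuousLinearMap.det : (V →L[ℝ] V) → ℝ) = fun A : V →L[ℝ] V =>
      (LinearMap.toMatrix b.toBasis b.toBasis (A : V →ₗ[ℝ] V)).det := funext h
  rw [this]
  refine Continuous.matrix_det ?_
  refine continuous_matrix fun i j => ?_
  simp only [LinearMap.toMatrix_apply, OrthonormalBasis.coe_toBasis_repr_apply,
    OrthonormalBasis.coe_toBasis, OrthonormalBasis.repr_apply_apply]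
  exact continuous_const.inner (ContinuousLinearMap.apply ℝ V (b j)).continuous

/-- The determinant of `(J₀ + J_t) / 2` is positive along a geodesic that avoids the cut locus. -/
theorem det_half_add_pos {J B : V →L[ℝ] V} (hJ : J * J = -1)
    (hdet : ∀ t ∈ Set.Icc (0 : ℝ) 1, (1 + flow B t).det ≠ 0) :
    ∀ t ∈ Set.Icc (0 : ℝ) 1, 0 < ((1 / 2 : ℝ) • (J + flow B t * J)).det := by
  have hne : ∀ t ∈ Set.Icc (0 : ℝ) 1, ((1 / 2 : ℝ) • (J + flow B t * J)).det ≠ 0 := by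
    intro t ht h0
    have h1 : ((1 / 2 : ℝ) • (J + flow B t * J)).det =
        (1 / 2) ^ Module.finrank ℝ V * ((1 + flow B t).det * J.det) := by
      rw [← det_mul, add_mul, one_mul]
      exact LinearMap.det_smul (1 / 2 : ℝ) ((J + flow B t * J : V →L[ℝ] V) : V →ₗ[ℝ] V)
    rw [h1] at h0
    have := (det_pos_of_sq hJ).ne'
    have h2 := hdet t ht
    exact (mul_ne_zero (by positivity) (mul_ne_zero h2 this)) h0
  intro t ht
  have hc : ContinuousOn (fun t => ((1 / 2 : ℝ) • (J + flow B t * J)).det) (Set.Icc 0 1) := by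
    refine (continuous_det.comp ?_).continuousOn
    exact (continuous_const.add (contDiff_flow_mul B J 0).continuous).const_smul (1 / 2 : ℝ)
  have h0 : 0 < ((1 / 2 : ℝ) • (J + flow B 0 * J)).det := by
    have : (1 / 2 : ℝ) • (J + flow B 0 * J) = J := by
      rw [flow_zero, one_mul, ← two_smul ℝ, smul_smul]; norm_num
    rw [this]
    exact det_pos_of_sq hJ
  -- The determinant never vanishes on [0,1] and is positive at time 0, so a negative value
  -- contradicts the intermediate value theorem.
  by_contra hneg
  have hlt := (not_lt.mp hneg).lt_of_ne (hne t ht)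
  have hsub : Set.Icc 0 t ⊆ Set.Icc (0 : ℝ) 1 := Set.Icc_subset_Icc_right ht.2
  obtain ⟨τ, hτ, h⟩ := intermediate_value_Icc' ht.1 (hc.mono hsub) ⟨hlt.le, h0.le⟩
  exact hne τ (hsub hτ) h

end CutLocus

end FermionicTransport

end

open scoped TensorProduct

noncomputable section

set_option linter.unusedSectionVars false

namespace FermionicTransport

/-! ### Covariant derivatives and quantum spaces -/

section Nabla

variable {V : Type*} [NormedAddCommGroup V] [InnerProductSpace ℝ V] [FiniteDimensional ℝ V]
variable {W : Type*} [AddCommGroup W] [Module ℝ W]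

/-- The covariant derivatives `ι_{j(x)} - g(x, f) / 2` on functions on `ΠW`. -/
def nablaAlong (f : W →ₗ[ℝ] V) (j : V →ₗ[ℝ] W) : V →ₗ[ℝ] Module.End ℂ (FermFun W) :=
  contract ∘ₗ j - (1 / 2 : ℝ) • (((LinearMap.mul ℂ (FermFun W)).restrictScalars ℝ) ∘ₗ cov f)

theorem nablaAlong_apply (f : W →ₗ[ℝ] V) (j : V →ₗ[ℝ] W) (x : V) (F : FermFun W) :
    nablaAlong f j x F = contract (j x) F - (1 / 2 : ℝ) • (cov f x * F) := rfl

theorem nablaReal_eq_nablaAlong :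
    (nablaReal : V →ₗ[ℝ] Module.End ℂ (FermFun V)) = nablaAlong LinearMap.id LinearMap.id := rfl

/-- Contractions anticommute among themselves, and so do multiplications; each of the two mixed
brackets contributes -½ g(x, y). The generality covers functions of θ alone and functions of θ and
χ. -/
theorem isClifford_nablaAlong {f : W →ₗ[ℝ] V} {j : V →ₗ[ℝ] W} (h : ∀ x, f (j x) = x) :
    IsClifford (nablaAlong f j) := by
  intro x y
  refine LinearMap.ext fun F => ?_
  change nablaAlong f j x (nablaAlong f j y F) + nablaAlong f j y (nablaAlong f j x F) =
    -((inner ℝ x y : ℂ) • F)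
  have e : cov f x * (cov f y * F) = -(cov f y * (cov f x * F)) := by
    rw [← mul_assoc, cov_mul_swap, ferm_neg_mul, mul_assoc]
  simp only [nablaAlong_apply, map_sub, contract_real_smul, contract_cov_mul,
    ferm_mul_real_smul, h]
  rw [contract_contract (j x) (j y), e, real_inner_comm x y, ferm_coe_smul]
  module

theorem isClifford_nablaReal : IsClifford (nablaReal (V := V)) := by
  rw [nablaReal_eq_nablaAlong]
  exact isClifford_nablaAlong fun _ => LinearMap.id_apply _

theorem tmul_add_mem_V01 {J : V →L[ℝ] V} (hJ : ∀ x, J (J x) = -x) (x : V) :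
    (1 : ℂ) ⊗ₜ[ℝ] x + Complex.I ⊗ₜ[ℝ] J x ∈ V01 J := by
  rw [V01, Module.End.mem_eigenspace_iff, map_add, LinearMap.baseChange_tmul,
    LinearMap.baseChange_tmul]
  simp only [ContinuousLinearMap.coe_coe, hJ, smul_add, TensorProduct.smul_tmul', smul_eq_mul,
    TensorProduct.tmul_neg]
  simp [TensorProduct.neg_tmul, add_comm]

/-- The map z ↦ z + iJz has image V^{0,1} and is multiplication by 2 there, so testing on the
vectors x + iJx with x real suffices. -/
theorem mem_quantumSpace_iff {J : V →L[ℝ] V} (hJ : ∀ x, J (J x) = -x) {ψ : FermFun V} :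
    ψ ∈ quantumSpace J ↔ ∀ x, annih nablaReal J x ψ = 0 := by
  have hn : ∀ (z : ℂ) (x : V), nabla (z ⊗ₜ[ℝ] x) ψ = z • nablaReal x ψ := fun z x => rfl
  simp only [quantumSpace, Submodule.mem_iInf, LinearMap.mem_ker]
  constructor
  · intro h x
    have h1 := h _ (tmul_add_mem_V01 hJ x)
    rw [map_add, LinearMap.add_apply, hn, hn, one_smul] at h1
    change (1 / 2 : ℂ) • (nablaReal x ψ + Complex.I • nablaReal (J x) ψ) = 0
    rw [h1, smul_zero]
  · intro h z hz
    have h1 : ∀ z : ℂ ⊗[ℝ] V,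
        nabla (z + Complex.I • LinearMap.baseChange ℂ (J : V →ₗ[ℝ] V) z) ψ = 0 := by
      intro z
      induction z using TensorProduct.induction_on with
      | zero => simp
      | add x y hx hy =>
        have : x + y + Complex.I • (LinearMap.baseChange ℂ (J : V →ₗ[ℝ] V)) (x + y) =
            (x + Complex.I • (LinearMap.baseChange ℂ (J : V →ₗ[ℝ] V)) x) +
            (y + Complex.I • (LinearMap.baseChange ℂ (J : V →ₗ[ℝ] V)) y) := by
          rw [map_add, smul_add]; abel
        rw [this, map_add, LinearMap.add_apply, hx, hy, add_zero]
      | tmul c x =>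
        rw [LinearMap.baseChange_tmul, TensorProduct.smul_tmul', map_add, LinearMap.add_apply, hn,
          hn]
        have h2 : (1 / 2 : ℂ) • (nablaReal x ψ + Complex.I • nablaReal (J x) ψ) = 0 := h x
        have h3 : c • nablaReal x ψ + (Complex.I • c) • nablaReal (J x) ψ =
            (2 * c) • ((1 / 2 : ℂ) • (nablaReal x ψ + Complex.I • nablaReal (J x) ψ)) := by
          rw [smul_eq_mul]; module
        exact h3.trans (by rw [h2, smul_zero])
    have h2 := h1 z
    rw [V01, Module.End.mem_eigenspace_iff] at hz
    rw [hz, smul_smul, mul_neg, Complex.I_mul_I, neg_neg, one_smul, ← two_smul ℂ, map_smul,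
      LinearMap.smul_apply] at h2
    exact (smul_eq_zero.mp h2).resolve_left two_ne_zero

end Nabla

/-! ### Annihilation operators of two complex structures -/

section Shift

attribute [-instance] Module.complexToReal Algebra.complexToReal

variable {V : Type*} [NormedAddCommGroup V] [InnerProductSpace ℝ V] [FiniteDimensional ℝ V]
variable {E : Type*} [Ring E] [Algebra ℂ E] [Module ℝ E] [IsScalarTower ℝ ℂ E]

/-- The intertwiner 1 + T maps V^{0,1} of J into that of J', and (1 + T)x^{0,1} = x^{0,1} +
(Tx)^{1,0} because T exchanges types. -/
theorem annih_one_add (N : V →ₗ[ℝ] E) {J J' T : V →L[ℝ] V} (hTJ : ∀ x, T (J x) = -J (T x))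
    (hJ' : J' * (1 + T) = (1 + T) * J) (x : V) :
    annih N J' ((1 + T) x) = annih N J x + creat N J (T x) := by
  have h : J' ((1 + T) x) = (1 + T) (J x) := congrArg (fun A : V →L[ℝ] V => A x) hJ'
  rw [annih_apply, h, add_apply, add_apply, one_apply_eq_self,
    one_apply_eq_self, map_add, map_add, hTJ, map_neg, annih_apply, creat_apply]
  module

end Shift

/-! ### The Cayley transform of the flow -/

section Cayley

variable {V : Type*} [NormedAddCommGroup V] [InnerProductSpace ℝ V] [FiniteDimensional ℝ V]
variable {ι : Type*} [Fintype ι]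

/-- The operator `tanh(tB/2) = (R - 1) / (R + 1)` for `R = exp(tB)`. -/
def cayley (B : V →L[ℝ] V) (t : ℝ) : V →L[ℝ] V := 1 - (2 : ℝ) • Ring.inverse (1 + flow B t)

theorem isUnit_of_det_ne_zero {A : V →L[ℝ] V} (h : A.det ≠ 0) : IsUnit A := by
  have h1 : IsUnit (LinearMap.det (A : V →ₗ[ℝ] V)) := isUnit_iff_ne_zero.mpr h
  let Φ := (LinearMap.equivOfIsUnitDet h1).toContinuousLinearEquiv
  have h2 : A = (Φ : V →L[ℝ] V) := by
    ext x
    exact (LinearMap.congr_fun (LinearMap.coe_equivOfIsUnitDet h1) x).symm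
  rw [h2]
  exact ⟨ContinuousLinearEquiv.toUnit Φ, rfl⟩

section Fixed

variable {B J : V →L[ℝ] V} {t : ℝ}

theorem add_mul_inverse (hu : IsUnit (1 + flow B t)) :
    (1 + flow B t) * Ring.inverse (1 + flow B t) = 1 := Ring.mul_inverse_cancel _ hu

theorem inverse_mul_add (hu : IsUnit (1 + flow B t)) :
    Ring.inverse (1 + flow B t) * (1 + flow B t) = 1 := Ring.inverse_mul_cancel _ hu

theorem flow_mul_inverse (hu : IsUnit (1 + flow B t)) :
    flow B t * Ring.inverse (1 + flow B t) = 1 - Ring.inverse (1 + flow B t) := by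
  have h := add_mul_inverse hu
  rw [add_mul, one_mul] at h
  exact eq_sub_of_add_eq' h

theorem inverse_mul_flow (hu : IsUnit (1 + flow B t)) :
    Ring.inverse (1 + flow B t) * flow B t = 1 - Ring.inverse (1 + flow B t) := by
  have h := inverse_mul_add hu
  rw [mul_add, mul_one] at h
  exact eq_sub_of_add_eq' h

/-- Conjugation by J inverts R = exp(tB), and (1 + R⁻¹)⁻¹ = 1 - (1 + R)⁻¹. -/
theorem J_mul_inverse (hu : IsUnit (1 + flow B t)) (hBJ : B * J = -(J * B)) :
    J * Ring.inverse (1 + flow B t) = (1 - Ring.inverse (1 + flow B t)) * J := by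
  have h1 : (1 + flow B t) * J = J * flow B (-t) * (1 + flow B t) := by
    rw [mul_flow (B := B) (J := J) hBJ, neg_neg, mul_add, mul_one, mul_assoc, mul_flow hBJ,
      ← mul_assoc, flow_mul_neg, one_mul, add_comm, add_mul, one_mul]
  have h2 : J * flow B (-t) = flow B t * J := by
    rw [mul_flow hBJ, neg_neg]
  rw [h2] at h1
  have h3 : (1 + flow B t) * (J * Ring.inverse (1 + flow B t)) = flow B t * J := by
    rw [← mul_assoc, h1, mul_assoc, add_mul_inverse hu, mul_one]
  have h4 := congrArg (fun A => Ring.inverse (1 + flow B t) * A) h3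
  simp only [← mul_assoc] at h4
  rwa [inverse_mul_add hu, one_mul, inverse_mul_flow hu] at h4

/-- For orthogonal R the operator Y = (1 + R)⁻¹ satisfies Y + Yᵀ = 1, so 1 - 2Y is skew. -/
theorem isSkew_cayley (hB : IsSkew B) (hu : IsUnit (1 + flow B t)) : IsSkew (cayley B t) := by
  set Y := Ring.inverse (1 + flow B t) with hY
  have h1 : ∀ x, x = Y x + flow B t (Y x) := fun x =>
    (congrArg (fun A : V →L[ℝ] V => A x) (add_mul_inverse hu)).symm
  have key : ∀ x y, inner ℝ (Y x) y + inner ℝ x (Y y) = inner ℝ x y := by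
    intro x y
    have h2 := inner_flow hB t (Y x) (Y y)
    conv_rhs => rw [h1 x, h1 y]
    conv_lhs => enter [1]; rw [h1 y]
    conv_lhs => enter [2]; rw [h1 x]
    simp only [inner_add_left, inner_add_right]
    linarith
  intro x y
  have := key x y
  simp only [cayley, sub_apply, smul_apply, one_apply_eq_self, inner_sub_left,
    inner_sub_right, inner_smul_left, inner_smul_right, conj_trivial, ← hY]
  linarith

theorem cayley_mul_J (hu : IsUnit (1 + flow B t)) (hBJ : B * J = -(J * B)) :
    cayley B t * J = -(J * cayley B t) := by
  rw [cayley, mul_sub, mul_smul_comm, J_mul_inverse hu hBJ, sub_mul, sub_mul, smul_mul_assoc,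
    mul_one, one_mul]
  module

theorem cayley_mul_comm (hu : IsUnit (1 + flow B t)) : cayley B t * B = B * cayley B t := by
  have h : Commute (1 + flow B t) B := by
    rw [commute_iff_eq, add_mul, mul_add, one_mul, mul_one, flow_comm]
  have h2 := (h.symm.ringInverse_ringInverse)
  have h1 : Ring.inverse (1 + flow B t) * B = B * Ring.inverse (1 + flow B t) := by
    have h3 := congrArg (fun A => Ring.inverse (1 + flow B t) * A * Ring.inverse (1 + flow B t))
      h.eq
    simp only [← mul_assoc] at h3
    rw [inverse_mul_add hu, one_mul, mul_assoc _ (1 + flow B t), add_mul_inverse hu, mul_one] at h3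
    exact h3.symm
  rw [cayley, sub_mul, mul_sub, smul_mul_assoc, h1, mul_smul_comm, one_mul, mul_one]

theorem one_add_cayley (hu : IsUnit (1 + flow B t)) :
    1 + cayley B t = (2 : ℝ) • (flow B t * Ring.inverse (1 + flow B t)) := by
  rw [flow_mul_inverse hu, cayley]; module

theorem flow_mul_J_mul_one_add_cayley (hu : IsUnit (1 + flow B t)) (hBJ : B * J = -(J * B)) :
    flow B t * J * (1 + cayley B t) = (1 + cayley B t) * J := by
  rw [one_add_cayley hu, mul_smul_comm, smul_mul_assoc]
  congr 1
  have h : flow B t * J * flow B t = J := flow_mul_mul_flow hBJ t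
  rw [← mul_assoc, h, J_mul_inverse hu hBJ, flow_mul_inverse hu]

theorem exists_one_add_cayley (hu : IsUnit (1 + flow B t)) (x : V) :
    ∃ y, (1 + cayley B t) y = x := by
  refine ⟨((1 / 2 : ℝ) • ((1 + flow B t) * flow B (-t))) x, ?_⟩
  have h : (1 + cayley B t) * ((1 / 2 : ℝ) • ((1 + flow B t) * flow B (-t))) = 1 := by
    rw [one_add_cayley hu, smul_mul_smul_comm, mul_assoc, ← mul_assoc (Ring.inverse _),
      inverse_mul_add hu, one_mul, flow_mul_neg]
    norm_num
  exact congrArg (fun A : V →L[ℝ] V => A x) h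

theorem cayley_zero (B : V →L[ℝ] V) : cayley B 0 = 0 := by
  have h : Ring.inverse (1 + flow B 0) = (1 / 2 : ℝ) • (1 : V →L[ℝ] V) := by
    have h1 : (1 + flow B 0) * ((1 / 2 : ℝ) • (1 : V →L[ℝ] V)) = 1 := by
      rw [flow_zero, mul_smul_comm, mul_one, ← two_smul ℝ, smul_smul]; norm_num
    have h2 : ((1 / 2 : ℝ) • (1 : V →L[ℝ] V)) * (1 + flow B 0) = 1 := by
      rw [flow_zero, smul_mul_assoc, one_mul, ← two_smul ℝ, smul_smul]; norm_num
    exact Ring.inverse_unit ⟨_, _, h1, h2⟩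
  rw [cayley, h, smul_smul]; norm_num

/-- (J + RJ)/2 = ½(1 + R)J, whose inverse is J⁻¹ · 2(1 + R)⁻¹ with J⁻¹ = -J and 2(1 + R)⁻¹ = 1 - T.
This links the operator in the theorem to T. -/
theorem inverse_half_add (hu : IsUnit (1 + flow B t)) (hJ : J * J = -1) :
    Ring.inverse ((1 / 2 : ℝ) • (J + flow B t * J)) = -(J * (1 - cayley B t)) := by
  have e : 1 - cayley B t = (2 : ℝ) • Ring.inverse (1 + flow B t) := by rw [cayley]; abel
  have e2 : J + flow B t * J = (1 + flow B t) * J := by rw [add_mul, one_mul]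
  set Y := Ring.inverse (1 + flow B t) with hY
  have h1 : (1 / 2 : ℝ) • ((1 + flow B t) * J) * -(J * (2 : ℝ) • Y) = 1 := by
    rw [mul_smul_comm, ← smul_neg, smul_mul_smul_comm, mul_neg, mul_assoc, ← mul_assoc J, hJ,
      neg_mul, one_mul, mul_neg, neg_neg, hY, add_mul_inverse hu]
    norm_num
  have h2 : -(J * (2 : ℝ) • Y) * (1 / 2 : ℝ) • ((1 + flow B t) * J) = 1 := by
    rw [mul_smul_comm _ J Y, ← smul_neg, smul_mul_smul_comm, neg_mul, mul_assoc, ← mul_assoc Y, hY,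
      inverse_mul_add hu, one_mul, hJ, neg_neg]
    norm_num
  rw [e, e2]
  exact Ring.inverse_unit ⟨_, _, h1, h2⟩

theorem hasDerivAt_inverse (hu : IsUnit (1 + flow B t)) :
    HasDerivAt (fun s => Ring.inverse (1 + flow B s))
      (-(Ring.inverse (1 + flow B t) * (B * flow B t) * Ring.inverse (1 + flow B t))) t := by
  have := FiniteDimensional.complete ℝ V
  obtain ⟨u, hu'⟩ := hu
  have h1 : HasDerivAt (fun s => 1 + flow B s) (B * flow B t) t :=
    (hasDerivAt_flow B t).const_add 1
  have h2 := hasFDerivAt_ringInverse (𝕜 := ℝ) u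
  rw [hu'] at h2
  have h3 := h2.comp_hasDerivAt t h1
  refine h3.congr_deriv ?_
  rw [← hu', Ring.inverse_unit]
  simp [mul_assoc]

theorem hasDerivAt_cayley (hu : IsUnit (1 + flow B t)) :
    HasDerivAt (cayley B) ((1 / 2 : ℝ) • (B - cayley B t * cayley B t * B)) t := by
  have h := ((hasDerivAt_inverse hu).const_smul (2 : ℝ)).const_sub 1
  refine h.congr_deriv ?_
  have hc := cayley_mul_comm hu
  have e0 : cayley B t = 1 - (2 : ℝ) • Ring.inverse (1 + flow B t) := rfl
  set Y := Ring.inverse (1 + flow B t) with hY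
  have e1 : B * flow B t * Y = B * (1 - Y) := by rw [mul_assoc, flow_mul_inverse hu]
  have hYB : Y * B = B * Y := by
    have e2 : Y = (1 / 2 : ℝ) • (1 - cayley B t) := by rw [e0]; module
    rw [e2, smul_mul_assoc, mul_smul_comm, sub_mul, mul_sub, hc, one_mul, mul_one]
  have e3 : cayley B t * cayley B t * B = B - (4 : ℝ) • (B * Y) + (4 : ℝ) • (B * Y * Y) := by
    rw [mul_assoc, hc, ← mul_assoc, hc, mul_assoc, e0, sub_mul, one_mul, mul_sub, mul_sub, mul_sub,
      mul_one, smul_mul_smul_comm, mul_one, mul_sub, mul_smul_comm _ B Y,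
      mul_smul_comm _ B (Y * Y), mul_assoc]
    module
  rw [e3, mul_assoc Y, e1, ← mul_assoc, hYB, mul_sub, mul_one]
  module

end Fixed

/-! ### The derivative of the determinant -/

theorem differentiable_det : Differentiable ℝ (ContinuousLinearMap.det : (V →L[ℝ] V) → ℝ) := by
  let b := stdOrthonormalBasis ℝ V
  have h : (ContinuousLinearMap.det : (V →L[ℝ] V) → ℝ) = fun A : V →L[ℝ] V =>
      ∑ σ : Equiv.Perm (Fin (Module.finrank ℝ V)), ((Equiv.Perm.sign σ : ℤ) : ℝ) *
        ∏ i, inner ℝ (b (σ i)) (A (b i)) := by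
    funext A
    rw [ContinuousLinearMap.det, ← LinearMap.det_toMatrix b.toBasis, Matrix.det_apply']
    simp [LinearMap.toMatrix_apply, b.repr_apply_apply]
  rw [h]
  refine Differentiable.fun_sum fun σ _ => Differentiable.const_mul ?_ _
  intro A
  have h1 : ∀ i, HasFDerivAt (fun A : V →L[ℝ] V => inner ℝ (b (σ i)) (A (b i)))
      ((innerSL ℝ (b (σ i))).comp (ContinuousLinearMap.apply ℝ V (b i))) A := fun i =>
    ((innerSL ℝ (b (σ i))).comp (ContinuousLinearMap.apply ℝ V (b i))).hasFDerivAt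
  exact (HasFDerivAt.finsetProd fun i _ => h1 i).differentiableAt

theorem hasDerivAt_det_one_add (b : OrthonormalBasis ι ℝ V) (A : V →L[ℝ] V) :
    HasDerivAt (fun s : ℝ => (1 + s • A).det) (∑ i, inner ℝ (b i) (A (b i))) 0 := by
  classical
  set M := LinearMap.toMatrix b.toBasis b.toBasis (A : V →ₗ[ℝ] V) with hM
  have h1 : ∀ s : ℝ, (1 + s • A).det = (1 + s • M).det := by
    intro s
    rw [ContinuousLinearMap.det, ← LinearMap.det_toMatrix b.toBasis]
    congr 1
    have : ((1 + s • A : V →L[ℝ] V) : V →ₗ[ℝ] V) = LinearMap.id + s • (A : V →ₗ[ℝ] V) := rfl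
    rw [this, map_add, map_smul, LinearMap.toMatrix_id]
  have h2 : M.trace = ∑ i, inner ℝ (b i) (A (b i)) := by
    simp [hM, Matrix.trace, LinearMap.toMatrix_apply, b.repr_apply_apply]
  have h4 : ∀ s : ℝ, (1 + s • A).det = 1 + M.trace * s + Polynomial.eval s
      (1 + (Polynomial.X : Polynomial ℝ) • M.map Polynomial.C).det.divX.divX * s ^ 2 := fun s => by
    rw [h1, Matrix.det_one_add_smul]
  simp only [h4]
  generalize (1 + (Polynomial.X : Polynomial ℝ) • M.map Polynomial.C).det.divX.divX = p
  have h3 := (((hasDerivAt_id (0 : ℝ)).const_mul M.trace).const_add 1).add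
    ((p.hasDerivAt 0).mul ((hasDerivAt_id (0 : ℝ)).pow 2))
  refine h3.congr_deriv ?_
  simp [h2]

/-- Jacobi's formula. The chain rule allows replacing the curve by its tangent line M + sM' = M(1 +
sYM'), which reduces to the derivative of the determinant at the identity. -/
theorem hasDerivAt_det (b : OrthonormalBasis ι ℝ V) {M : ℝ → V →L[ℝ] V} {M' Y : V →L[ℝ] V} {t : ℝ}
    (hM : HasDerivAt M M' t) (hY : M t * Y = 1) :
    HasDerivAt (fun s => (M s).det) ((M t).det * ∑ i, inner ℝ (b i) (Y (M' (b i)))) t := by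
  have hd := (differentiable_det (M t)).hasFDerivAt
  have h1 := hd.comp_hasDerivAt t hM
  have h2 : HasDerivAt (fun s : ℝ => M t + s • M') M' 0 := by
    refine (((hasDerivAt_id (0 : ℝ)).smul_const M').const_add (M t)).congr_deriv ?_
    rw [one_smul]
  have hd' : HasFDerivAt ContinuousLinearMap.det (fderiv ℝ ContinuousLinearMap.det (M t))
      ((fun s : ℝ => M t + s • M') 0) := by simpa using hd
  have h3 := hd'.comp_hasDerivAt 0 h2
  have h4 : HasDerivAt (fun s : ℝ => (M t + s • M').det)
      ((M t).det * ∑ i, inner ℝ (b i) ((Y * M') (b i))) 0 := by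
    have h5 := (hasDerivAt_det_one_add b (Y * M')).const_mul (M t).det
    refine h5.congr_of_eventuallyEq (Filter.Eventually.of_forall fun s => ?_)
    simp only
    rw [← det_mul, mul_add, mul_one, mul_smul_comm, ← mul_assoc, hY, one_mul]
  have h6 := h3.unique h4
  exact h1.congr_deriv h6

end Cayley

end FermionicTransport

end

open scoped TensorProduct

noncomputable section

set_option linter.unusedSectionVars false

namespace FermionicTransport

/-! ### Componentwise derivatives in finite-dimensional complex vector spaces -/

section WeakDerivative

attribute [-instance] Module.complexToReal Algebra.complexToReal

variable {E F G : Type*} [AddCommGroup E] [Module ℂ E] [AddCommGroup F] [Module ℂ F]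
  [AddCommGroup G] [Module ℂ G]

/-- Componentwise derivatives of curves in complex vector spaces. -/
def HasWeakDeriv (a : ℝ → E) (a' : E) (s : Set ℝ) (t : ℝ) : Prop :=
  ∀ l : E →ₗ[ℂ] ℂ, HasDerivWithinAt (fun τ => l (a τ)) (l a') s t

variable {s : Set ℝ} {t : ℝ}

theorem HasWeakDeriv.congr_deriv {a : ℝ → E} {a' a'' : E} (h : HasWeakDeriv a a' s t)
    (e : a' = a'') : HasWeakDeriv a a'' s t := e ▸ h

theorem hasWeakDeriv_const (a : E) : HasWeakDeriv (fun _ => a) 0 s t := fun l => by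
  rw [map_zero]; exact hasDerivWithinAt_const t s (l a)

theorem HasWeakDeriv.add {a b : ℝ → E} {a' b' : E} (ha : HasWeakDeriv a a' s t)
    (hb : HasWeakDeriv b b' s t) : HasWeakDeriv (fun τ => a τ + b τ) (a' + b') s t := fun l => by
  simp only [map_add]; exact (ha l).add (hb l)

theorem HasWeakDeriv.sub {a b : ℝ → E} {a' b' : E} (ha : HasWeakDeriv a a' s t)
    (hb : HasWeakDeriv b b' s t) : HasWeakDeriv (fun τ => a τ - b τ) (a' - b') s t := fun l => by
  simp only [map_sub]; exact (ha l).sub (hb l)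

theorem HasWeakDeriv.sum {ι : Type*} {S : Finset ι} {a : ι → ℝ → E} {a' : ι → E}
    (h : ∀ i ∈ S, HasWeakDeriv (a i) (a' i) s t) :
    HasWeakDeriv (fun τ => ∑ i ∈ S, a i τ) (∑ i ∈ S, a' i) s t := fun l => by
  simp only [map_sum]; exact HasDerivWithinAt.fun_sum fun i hi => h i hi l

theorem HasWeakDeriv.map {a : ℝ → E} {a' : E} (h : HasWeakDeriv a a' s t) (L : E →ₗ[ℂ] F) :
    HasWeakDeriv (fun τ => L (a τ)) (L a') s t := fun l => h (l ∘ₗ L)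

/-- In finite dimension a bilinear map is a finite sum of products of coordinates, so the scalar
product rule suffices and no norm has to be chosen. -/
theorem HasWeakDeriv.bilinear [Module.Finite ℂ E] [Module.Finite ℂ F] (Φ : E →ₗ[ℂ] F →ₗ[ℂ] G)
    {a : ℝ → E} {b : ℝ → F} {a' : E} {b' : F} (ha : HasWeakDeriv a a' s t)
    (hb : HasWeakDeriv b b' s t) :
    HasWeakDeriv (fun τ => Φ (a τ) (b τ)) (Φ a' (b t) + Φ (a t) b') s t := by
  intro l
  let v := Module.finBasis ℂ E
  let w := Module.finBasis ℂ F
  have h : ∀ x y, l (Φ x y) = ∑ i, ∑ j, v.coord i x * (w.coord j y * l (Φ (v i) (w j))) := by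
    intro x y
    conv_lhs => rw [← v.sum_repr x, ← w.sum_repr y]
    simp only [map_sum, map_smul, LinearMap.sum_apply, LinearMap.smul_apply, smul_eq_mul,
      Module.Basis.coord_apply, Finset.mul_sum]
    rw [Finset.sum_comm]
    refine Finset.sum_congr rfl fun i _ => Finset.sum_congr rfl fun j _ => by ring
  have hd : HasDerivWithinAt
      (fun τ => ∑ i, ∑ j, v.coord i (a τ) * (w.coord j (b τ) * l (Φ (v i) (w j)))) _ s t :=
    HasDerivWithinAt.fun_sum fun i _ => HasDerivWithinAt.fun_sum fun j _ =>
      (ha (v.coord i)).mul ((hb (w.coord j)).mul_const (l (Φ (v i) (w j))))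
  have hfun : (fun τ => l (Φ (a τ) (b τ))) = fun τ =>
      ∑ i, ∑ j, v.coord i (a τ) * (w.coord j (b τ) * l (Φ (v i) (w j))) := funext fun τ => h _ _
  rw [hfun]
  refine hd.congr_deriv ?_
  rw [map_add, h a' (b t), h (a t) b', ← Finset.sum_add_distrib]
  simp only [← Finset.sum_add_distrib]

theorem HasWeakDeriv.smul [Module.Finite ℂ E] {c : ℝ → ℂ} {c' : ℂ} {a : ℝ → E} {a' : E}
    (hc : HasDerivWithinAt c c' s t) (ha : HasWeakDeriv a a' s t) :
    HasWeakDeriv (fun τ => c τ • a τ) (c' • a t + c t • a') s t := by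
  have h : HasWeakDeriv c c' s t := fun l => by
    have e : ∀ z, l z = z * l 1 := fun z => by
      conv_lhs => rw [← mul_one z, ← smul_eq_mul, map_smul, smul_eq_mul]
    simp only [e (c _), e c']
    exact hc.mul_const _
  exact h.bilinear (LinearMap.lsmul ℂ E) ha

theorem HasWeakDeriv.of_linear [Module ℝ E] [IsScalarTower ℝ ℂ E] {V : Type*}
    [NormedAddCommGroup V] [NormedSpace ℝ V] [FiniteDimensional ℝ V] (φ : V →ₗ[ℝ] E) {u : ℝ → V}
    {u' : V} (h : HasDerivWithinAt u u' s t) : HasWeakDeriv (fun τ => φ (u τ)) (φ u') s t := by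
  intro l
  let L : V →ₗ[ℝ] ℂ :=
    { toFun := fun x => l (φ x)
      map_add' := fun x y => by rw [map_add, map_add]
      map_smul' := fun r x => by
        rw [map_smul, ← algebraMap_smul ℂ r (φ x), map_smul, RingHom.id_apply, smul_eq_mul,
          Complex.real_smul]
        rfl }
  exact L.toContinuousLinearMap.hasFDerivAt.comp_hasDerivWithinAt t h

end WeakDerivative

/-! ### Componentwise derivatives of powers and exponentials -/

section WeakDerivativeAlgebra

attribute [-instance] Module.complexToReal Algebra.complexToReal

variable {E : Type*} [Ring E] [Algebra ℂ E] [Module.Finite ℂ E] {s : Set ℝ} {t : ℝ}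

theorem HasWeakDeriv.pow {a : ℝ → E} {a' : E} (h : HasWeakDeriv a a' s t)
    (hc : Commute (a t) a') (k : ℕ) :
    HasWeakDeriv (fun τ => a τ ^ (k + 1)) (((k : ℂ) + 1) • (a t ^ k * a')) s t := by
  induction k with
  | zero => simpa using h
  | succ k ih =>
    simp only [pow_succ _ (k + 1)]
    refine (ih.bilinear (LinearMap.mul ℂ E) h).congr_deriv ?_
    simp only [LinearMap.mul_apply']
    rw [smul_mul_assoc, mul_assoc, ← hc.eq, ← mul_assoc, ← pow_succ]
    push_cast
    module

/-- A nilpotency exponent that works for all times makes the exponential one fixed polynomial in the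
curve; the curve commutes with its derivative at `t`, so powers differentiate as for scalars. -/
theorem HasWeakDeriv.exp [Module ℚ E] {a : ℝ → E} {a' : E} (h : HasWeakDeriv a a' s t)
    (hc : Commute (a t) a') {m : ℕ} (hm : ∀ τ, a τ ^ m = 0) :
    HasWeakDeriv (fun τ => IsNilpotent.exp (a τ)) (IsNilpotent.exp (a t) * a') s t := by
  have hm' : ∀ τ, a τ ^ (m + 1) = 0 := fun τ => by rw [pow_succ, hm, zero_mul]
  have h1 : ∀ τ, IsNilpotent.exp (a τ) = ∑ i ∈ Finset.range m,
      (((i + 1).factorial : ℂ)⁻¹) • a τ ^ (i + 1) + 1 := fun τ => by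
    rw [exp_eq_sum_complex (hm' τ), Finset.sum_range_succ']; simp
  simp only [h1 _]
  have h2 := (HasWeakDeriv.sum (S := Finset.range m) fun i _ =>
    (h.pow hc i).map (LinearMap.lsmul ℂ E ((i + 1).factorial : ℂ)⁻¹)).add
      (hasWeakDeriv_const (1 : E))
  refine h2.congr_deriv ?_
  rw [← h1, exp_eq_sum_complex (hm t), add_zero, Finset.sum_mul]
  refine Finset.sum_congr rfl fun i _ => ?_
  rw [LinearMap.lsmul_apply, smul_smul, smul_mul_assoc, Nat.factorial_succ]
  congr 1
  have : (i : ℂ) + 1 ≠ 0 := Nat.cast_add_one_ne_zero i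
  push_cast
  field_simp

variable {V : Type*} [NormedAddCommGroup V] [InnerProductSpace ℝ V] [FiniteDimensional ℝ V]
variable [Module ℝ E] [IsScalarTower ℝ ℂ E] {ι : Type*} [Fintype ι]

theorem quadOp_smul (b : OrthonormalBasis ι ℝ V) (N : V →ₗ[ℝ] E) (J M : V →L[ℝ] V) (r : ℝ) :
    quadOp b N J (r • M) = (r : ℂ) • quadOp b N J M := by
  have h : ∀ i, creat N J (b i) * creat N J ((r • M) (b i)) =
      (r : ℂ) • (creat N J (b i) * creat N J (M (b i))) := fun i => by
    rw [smul_apply, map_smul, ← coe_smul_eq, mul_smul_comm]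
  rw [quadOp, quadOp, Finset.sum_congr rfl fun i _ => h i, ← Finset.smul_sum, smul_comm]

theorem hasWeakDeriv_quadOp (b : OrthonormalBasis ι ℝ V) (N : V →ₗ[ℝ] E) (J : V →L[ℝ] V)
    {T : ℝ → V →L[ℝ] V} {T' : V →L[ℝ] V} (hT : HasDerivWithinAt T T' s t) :
    HasWeakDeriv (fun τ => quadOp b N J (T τ)) (quadOp b N J T') s t := by
  refine (HasWeakDeriv.sum (S := Finset.univ) fun i _ => ?_).map (LinearMap.lsmul ℂ E (1 / 2 : ℂ))
  have h1 : HasDerivWithinAt (fun τ => T τ (b i)) (T' (b i)) s t := by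
    refine (hT.clm_apply (hasDerivWithinAt_const t s (b i))).congr_deriv ?_
    simp
  exact (HasWeakDeriv.of_linear (creat N J) h1).map (LinearMap.mulLeft ℂ (creat N J (b i)))

end WeakDerivativeAlgebra

instance finite_fermFun {W : Type*} [AddCommGroup W] [Module ℝ W] [FiniteDimensional ℝ W] :
    Module.Finite ℂ (FermFun W) := by
  have : Module.Finite ℝ (ExteriorAlgebra ℝ (Module.Dual ℝ W)) :=
    Module.Finite.of_basis (Module.finBasis ℝ (Module.Dual ℝ W)).ExteriorAlgebra
  infer_instance

/-- Cayley–Hamilton supplies an exponent that depends only on the space, hence is uniform in time.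
-/
theorem pow_finrank_eq_zero {X : Type*} [AddCommGroup X] [Module ℂ X] [Module.Finite ℂ X]
    {A : Module.End ℂ X} (hA : IsNilpotent A) : A ^ Module.finrank ℂ X = 0 := by
  have h := LinearMap.aeval_self_charpoly A
  rw [hA.charpoly_eq_X_pow_finrank] at h
  simpa using h

end FermionicTransport

end

open scoped TensorProduct

noncomputable section

set_option linter.unusedSectionVars false

namespace FermionicTransport

/-! ### Parallel transport along a geodesic -/

section Transport

variable {V : Type*} [NormedAddCommGroup V] [InnerProductSpace ℝ V] [FiniteDimensional ℝ V]
variable {n : ℕ} {ι : Type*} [Fintype ι]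

/-- The factor `det((J + J_t)/2)^{1/4}` for `J_t = exp(tB) J`. -/
def transportFactor (J B : V →L[ℝ] V) (t : ℝ) : ℝ :=
  ((1 / 2 : ℝ) • (J + flow B t * J)).det ^ (1 / 4 : ℝ)

/-- The operator of parallel transport along `t ↦ exp(tB) J`. -/
def transportOp (b : OrthonormalBasis ι ℝ V) (J B : V →L[ℝ] V) (t : ℝ) :
    Module.End ℂ (FermFun V) :=
  (transportFactor J B t : ℂ) • IsNilpotent.exp (quadOp b nablaReal J (cayley B t))

theorem apply_J_of_anticomm {A J : V →L[ℝ] V} (h : A * J = -(J * A)) (x : V) :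
    A (J x) = -J (A x) := congrArg (fun A : V →L[ℝ] V => A x) h

theorem sum_inner_eq_zero (b : OrthonormalBasis ι ℝ V) {B : V →L[ℝ] V} (hB : IsSkew B) :
    ∑ i, inner ℝ (b i) (B (b i)) = 0 := by
  refine Finset.sum_eq_zero fun i _ => ?_
  have h1 := hB (b i) (b i)
  rw [real_inner_comm] at h1
  linarith

/-- By Jacobi's formula the logarithmic derivative of the determinant is ½ tr(TB), and the power ¼
turns this into ⅛ tr(TB), the scalar produced by normal ordering the generator. -/
theorem hasDerivAt_transportFactor (b : OrthonormalBasis ι ℝ V) {J B : V →L[ℝ] V}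
    (hJ : J * J = -1) (sJ : IsSkew J) (hB : IsSkew B) {t : ℝ} (hu : IsUnit (1 + flow B t))
    (hpos : 0 < ((1 / 2 : ℝ) • (J + flow B t * J)).det) :
    HasDerivAt (transportFactor J B)
      (transportFactor J B t * (1 / 8 * ∑ i, inner ℝ (b i) (cayley B t (B (b i))))) t := by
  have hM : HasDerivAt (fun t => (1 / 2 : ℝ) • (J + flow B t * J))
      ((1 / 2 : ℝ) • (B * (flow B t * J))) t :=
    ((hasDerivAt_flow_mul B J t).const_add J).const_smul (1 / 2 : ℝ)
  have hunit : IsUnit ((1 / 2 : ℝ) • (J + flow B t * J)) := isUnit_of_det_ne_zero hpos.ne'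
  have hY := Ring.mul_inverse_cancel _ hunit
  rw [inverse_half_add hu hJ] at hY
  have hd := hasDerivAt_det b hM hY
  have hJ' : ∀ x, J (J x) = -x := fun x => congrArg (fun A : V →L[ℝ] V => A x) hJ
  have e0 : 1 - cayley B t = (2 : ℝ) • Ring.inverse (1 + flow B t) := by rw [cayley]; abel
  have e1 : (1 - cayley B t) * (B * flow B t) = B * (1 + cayley B t) := by
    have h1 : (1 - cayley B t) * B = B * (1 - cayley B t) := by
      rw [sub_mul, mul_sub, cayley_mul_comm hu, one_mul, mul_one]
    rw [← mul_assoc, h1, mul_assoc, e0, smul_mul_assoc, inverse_mul_flow hu, cayley]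
    congr 1
    module
  have htr : ∑ i, inner ℝ (b i) ((-(J * (1 - cayley B t)))
      (((1 / 2 : ℝ) • (B * (flow B t * J))) (b i))) =
      1 / 2 * ∑ i, inner ℝ (b i) (cayley B t (B (b i))) := by
    have e2 : ∀ i, inner ℝ (b i) ((-(J * (1 - cayley B t)))
        (((1 / 2 : ℝ) • (B * (flow B t * J))) (b i))) =
        1 / 2 * inner ℝ (J (b i)) ((B * (1 + cayley B t)) (J (b i))) := by
      intro i
      have e3 : (-(J * (1 - cayley B t))) (((1 / 2 : ℝ) • (B * (flow B t * J))) (b i)) =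
          -((1 / 2 : ℝ) • J (((1 - cayley B t) * (B * flow B t)) (J (b i)))) := by
        change (-(J * (1 - cayley B t))) ((1 / 2 : ℝ) • (B * (flow B t * J)) (b i)) = _
        rw [map_smul, neg_apply, smul_neg]
        rfl
      rw [e3, e1, inner_neg_right, inner_smul_right, sJ.right]
      ring
    rw [Finset.sum_congr rfl fun i _ => e2 i, ← Finset.mul_sum]
    congr 1
    have e4 := sum_J_J b hJ' sJ
      ((innerₗ V).compl₂ ((B * (1 + cayley B t) : V →L[ℝ] V) : V →ₗ[ℝ] V))
    have e5 : ∑ i, inner ℝ (J (b i)) ((B * (1 + cayley B t)) (J (b i))) =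
      ∑ i, inner ℝ (b i) ((B * (1 + cayley B t)) (b i)) := e4
    rw [e5, mul_add, mul_one, ← cayley_mul_comm hu]
    -- Of tr(B(1 + T)) only tr(TB) remains, as the skew operator B has trace zero.
    simp only [add_apply, inner_add_right, Finset.sum_add_distrib, sum_inner_eq_zero b hB, zero_add]
    rfl
  rw [htr] at hd
  have h := hd.rpow_const (p := 1 / 4) (Or.inl hpos.ne')
  refine h.congr_deriv ?_
  have e6 : ((1 / 2 : ℝ) • (J + flow B t * J)).det ^ (1 / 4 : ℝ) =
      ((1 / 2 : ℝ) • (J + flow B t * J)).det *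
        ((1 / 2 : ℝ) • (J + flow B t * J)).det ^ (1 / 4 - 1 : ℝ) := by
    rw [← Real.rpow_one_add' hpos.le (by norm_num)]
    norm_num
  rw [transportFactor, e6]
  ring

theorem exp_quadOp_mem_quantumSpace (b : OrthonormalBasis ι ℝ V) {J B : V →L[ℝ] V}
    (hJ : J * J = -1) (sJ : IsSkew J) (hB : IsSkew B) (hBJ : B * J = -(J * B)) {t : ℝ}
    (hu : IsUnit (1 + flow B t)) (hJt : ∀ x, (flow B t * J) ((flow B t * J) x) = -x)
    {ψ : FermFun V} (hψ : ψ ∈ quantumSpace J) :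
    IsNilpotent.exp (quadOp b nablaReal J (cayley B t)) ψ ∈ quantumSpace (flow B t * J) := by
  have hJ' : ∀ x, J (J x) = -x := fun x => congrArg (fun A : V →L[ℝ] V => A x) hJ
  have hTJ := apply_J_of_anticomm (cayley_mul_J hu hBJ)
  rw [mem_quantumSpace_iff hJ'] at hψ
  rw [mem_quantumSpace_iff hJt]
  intro x
  obtain ⟨y, rfl⟩ := exists_one_add_cayley hu x
  rw [annih_one_add nablaReal hTJ (flow_mul_J_mul_one_add_cayley hu hBJ)]
  have h := isClifford_nablaReal.annih_mul_exp hJ' sJ b (isSkew_cayley hB hu) hTJ y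
  have h1 := LinearMap.congr_fun h ψ
  simp only [Module.End.mul_apply, LinearMap.add_apply, LinearMap.neg_apply, hψ, map_zero,
    zero_add] at h1
  rw [LinearMap.add_apply, h1, neg_add_cancel]

/-- The normally ordered generator is ⅛ tr(TB) + ½ A(B - T²B) on the transported state. The first
term is the logarithmic derivative of the factor, the second is A(T') since T' = ½(B - T²B). -/
theorem hasWeakDeriv_transportOp (b : OrthonormalBasis ι ℝ V) {J B : V →L[ℝ] V}
    (hJ : J * J = -1) (sJ : IsSkew J) (hB : IsSkew B) (hBJ : B * J = -(J * B)) {t : ℝ}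
    (hu : IsUnit (1 + flow B t)) (hpos : 0 < ((1 / 2 : ℝ) • (J + flow B t * J)).det)
    {ψ : FermFun V} (hψ : ψ ∈ quantumSpace J) :
    HasWeakDeriv (fun τ => transportOp b J B τ ψ)
      (generator b nablaReal B (transportOp b J B t ψ)) (Set.Icc 0 1) t := by
  have hJ' : ∀ x, J (J x) = -x := fun x => congrArg (fun A : V →L[ℝ] V => A x) hJ
  have hTJ := apply_J_of_anticomm (cayley_mul_J hu hBJ)
  have hBJ' := apply_J_of_anticomm hBJ
  have hN := isClifford_nablaReal (V := V)
  have hf : HasDerivWithinAt (fun τ => (transportFactor J B τ : ℂ)) _ (Set.Icc 0 1) t :=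
    ((hasDerivAt_transportFactor b hJ sJ hB hu hpos).ofReal_comp).hasDerivWithinAt
  have hA := hasWeakDeriv_quadOp b (nablaReal (V := V)) J
    ((hasDerivAt_cayley hu).hasDerivWithinAt (s := Set.Icc 0 1))
  have hexp := hA.exp (hN.commute_quadOp hJ' sJ b _ _)
    (fun τ => pow_finrank_eq_zero (hN.isNilpotent_quadOp hJ' sJ b (cayley B τ)))
  refine ((HasWeakDeriv.smul hf hexp).map (LinearMap.applyₗ ψ)).congr_deriv ?_
  set P := IsNilpotent.exp (quadOp b nablaReal J (cayley B t)) with hP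
  -- The left ideal `L` consists of the operators that kill ψ; working modulo it expresses that d_x
  -- + c_{Tx} annihilates the transported state.
  have hL := hN.generator_mul hJ' sJ b (isSkew_cayley hB hu) hTJ hB hBJ'
    (fun x => congrArg (fun A : V →L[ℝ] V => A x) (cayley_mul_comm hu))
    (L := LinearMap.ker (LinearMap.applyₗ (R := ℂ) ψ : Module.End ℂ (FermFun V) →ₗ[ℂ] FermFun V))
    (fun a z hz => by
      rw [LinearMap.mem_ker] at hz ⊢
      change a (z ψ) = 0
      rw [show z ψ = 0 from hz, map_zero]) (P := P) (fun x => by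
      rw [LinearMap.mem_ker, hP, hN.annih_mul_exp hJ' sJ b (isSkew_cayley hB hu) hTJ]
      change P (annih nablaReal J x ψ) + -(creat nablaReal J (cayley B t x) (P ψ)) +
        creat nablaReal J (cayley B t x) (P ψ) = 0
      rw [neg_add_cancel_right, (mem_quantumSpace_iff hJ').mp hψ, map_zero])
  rw [LinearMap.mem_ker, map_sub, sub_eq_zero] at hL
  have hq : quadOp b (nablaReal (V := V)) J
      ((1 / 2 : ℝ) • (B - cayley B t * cayley B t * B)) =
      (1 / 2 : ℂ) • quadOp b nablaReal J (B - cayley B t * cayley B t * B) := by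
    rw [quadOp_smul]; norm_num
  have hc : Commute P (quadOp b nablaReal J (B - cayley B t * cayley B t * B)) :=
    Module.End.commute_exp_left_of_commute (hN.isNilpotent_quadOp hJ' sJ b _)
      (hN.isNilpotent_quadOp hJ' sJ b _) (hN.commute_quadOp hJ' sJ b _ _).eq
  rw [hq, mul_smul_comm, hc.eq]
  change _ = generator b nablaReal B ((transportFactor J B t : ℂ) • P ψ)
  rw [map_smul]
  have hL' : generator b nablaReal B (P ψ) = _ := hL
  rw [hL', map_add, map_smul, map_add, map_smul, map_smul, map_smul, smul_add, smul_smul, smul_smul]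
  push_cast
  rfl

theorem herm_creat_mul (e : OrthonormalBasis (Fin (2 * n)) ℝ V) (J : V →L[ℝ] V) (x : V)
    (φ ψ : FermFun V) :
    herm e φ (creat nablaReal J x ψ) = -herm e (annih nablaReal J x φ) ψ := by
  change herm e φ ((1 / 2 : ℂ) • (nablaReal x ψ + (-Complex.I) • nablaReal (J x) ψ)) =
    -herm e ((1 / 2 : ℂ) • (nablaReal x φ + Complex.I • nablaReal (J x) φ)) ψ
  simp only [herm_smul_right, herm_smul_left, herm_add_right, herm_add_left, herm_nablaReal]
  simp only [map_div₀, map_one, map_ofNat, Complex.conj_I]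
  ring

/-- The annihilation part kills ψ, and the adjoint of the outer creation operator is minus an
annihilation operator, which kills φ. -/
theorem herm_generator (e : OrthonormalBasis (Fin (2 * n)) ℝ V) {J B : V →L[ℝ] V}
    (hJ : ∀ x, J (J x) = -x) (sJ : IsSkew J) (hBJ : ∀ x, B (J x) = -J (B x)) {φ ψ : FermFun V}
    (hφ : φ ∈ quantumSpace J) (hψ : ψ ∈ quantumSpace J) :
    herm e φ (generator e nablaReal B ψ) = 0 := by
  rw [mem_quantumSpace_iff hJ] at hφ hψ
  rw [generator_eq e hJ sJ hBJ, LinearMap.smul_apply, herm_smul_right, LinearMap.add_apply,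
    LinearMap.sum_apply, LinearMap.sum_apply, herm_add_right, ← hermBilin_apply, ← hermBilin_apply,
    map_sum, map_sum, Finset.sum_eq_zero, Finset.sum_eq_zero, add_zero, mul_zero]
  · intro i _
    rw [Module.End.mul_apply, hψ, map_zero, map_zero]
  · intro i _
    rw [Module.End.mul_apply, hermBilin_apply, herm_creat_mul, hφ, herm_zero_left, neg_zero]

theorem hasWeakDeriv_conjFun {δ : ℝ → FermFun V} {δ' : FermFun V} {s : Set ℝ} {t : ℝ}
    (h : HasWeakDeriv δ δ' s t) : HasWeakDeriv (fun τ => conjFun (δ τ)) (conjFun δ') s t := by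
  intro l
  let l' : FermFun V →ₗ[ℂ] ℂ :=
    { toFun := fun x => starRingEnd ℂ (l (conjFun x))
      map_add' := fun x y => by rw [map_add, map_add, map_add]
      map_smul' := fun c x => by
        rw [conjFun_smul, map_smul, smul_eq_mul, map_mul, Complex.conj_conj]; rfl }
  have h1 : ∀ x, l (conjFun x) = Complex.conjCLE (l' x) := fun x => (Complex.conj_conj _).symm
  simp only [h1]
  exact Complex.conjCLE.toContinuousLinearMap.hasFDerivAt.comp_hasDerivWithinAt t (h l')

theorem hasDerivWithinAt_herm_self (e : OrthonormalBasis (Fin (2 * n)) ℝ V)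
    {δ : ℝ → FermFun V} {δ' : FermFun V} {s : Set ℝ} {t : ℝ} (h : HasWeakDeriv δ δ' s t) :
    HasDerivWithinAt (fun τ => herm e (δ τ) (δ τ)) (herm e δ' (δ t) + herm e (δ t) δ') s t := by
  let β : FermFun V →ₗ[ℂ] FermFun V →ₗ[ℂ] ℂ :=
    LinearMap.mk₂ ℂ (fun φ ψ => berezin e (φ * hodgeHalf e ψ))
      (fun x y z => by rw [add_mul, berezin_add])
      (fun c x y => by rw [ferm_smul_mul, berezin_smul]; rfl)
      (fun x y z => by rw [map_add, mul_add, berezin_add])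
      (fun c x y => by rw [map_smul, ferm_mul_smul, berezin_smul]; rfl)
  exact (hasWeakDeriv_conjFun h).bilinear β h LinearMap.id

/-- The difference of two parallel sections lies in the fibre while its derivative is orthogonal to
the fibre, so its norm is constant; it vanishes at 0, and the form is definite. -/
theorem IsParallelAlong.eq_of_eq {e : OrthonormalBasis (Fin (2 * n)) ℝ V} {γ : ℝ → V →L[ℝ] V}
    {ψ₁ ψ₂ : ℝ → FermFun V} (h1 : IsParallelAlong e γ ψ₁) (h2 : IsParallelAlong e γ ψ₂)
    (h0 : ψ₁ 0 = ψ₂ 0) : ψ₁ 1 = ψ₂ 1 := by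
  have hd : ∀ t ∈ Set.Icc (0 : ℝ) 1, HasDerivWithinAt
      (fun τ => herm e (ψ₁ τ - ψ₂ τ) (ψ₁ τ - ψ₂ τ)) 0 (Set.Icc 0 1) t := by
    intro t ht
    obtain ⟨m1, d1, w1, o1⟩ := h1 t ht
    obtain ⟨m2, d2, w2, o2⟩ := h2 t ht
    have hw : HasWeakDeriv (fun τ => ψ₁ τ - ψ₂ τ) (d1 - d2) (Set.Icc 0 1) t :=
      HasWeakDeriv.sub (a := ψ₁) (b := ψ₂) w1 w2
    refine (hasDerivWithinAt_herm_self e hw).congr_deriv ?_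
    have hm := (quantumSpace (γ t)).sub_mem m1 m2
    have hz : herm e (ψ₁ t - ψ₂ t) (d1 - d2) = 0 := by
      have e1 : d1 - d2 = d1 + (-1 : ℂ) • d2 := by module
      rw [e1, herm_add_right, herm_smul_right, o1 _ hm, o2 _ hm]
      ring
    rw [hz, herm_symm, hz, map_zero, add_zero]
  have hconst := constant_of_derivWithin_zero (fun t ht => (hd t ht).differentiableWithinAt)
    (fun t ht => (hd t (Set.Ico_subset_Icc_self ht)).derivWithin
      (uniqueDiffOn_Icc zero_lt_one t (Set.Ico_subset_Icc_self ht))) 1 ⟨zero_le_one, le_rfl⟩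
  rw [h0, sub_self, herm_zero_left] at hconst
  exact sub_eq_zero.mp ((herm_self_pos e _).2 (by rw [hconst, Complex.zero_re]))

/-- The curve of states `t ↦ det((J + J_t)/2)^{1/4} e^{A(t)} ψ` is parallel. -/
theorem isParallelAlong_transportOp {o : Orientation ℝ V (Fin (2 * n))}
    (e : OrthonormalBasis (Fin (2 * n)) ℝ V) {J B : V →L[ℝ] V} (hJ : J ∈ compatibleJ o)
    (hB : IsSkew B) (hBJ : B * J = -(J * B))
    (hu : ∀ t ∈ Set.Icc (0 : ℝ) 1, IsUnit (1 + flow B t))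
    (hpos : ∀ t ∈ Set.Icc (0 : ℝ) 1, 0 < ((1 / 2 : ℝ) • (J + flow B t * J)).det)
    {γ : ℝ → V →L[ℝ] V} (hγ : ∀ t ∈ Set.Icc (0 : ℝ) 1, γ t = flow B t * J) {ψ : FermFun V}
    (hψ : ψ ∈ quantumSpace J) : IsParallelAlong e γ (fun t => transportOp e J B t ψ) := by
  intro t ht
  have hJt := compatibleJ_flow hJ hB hBJ t
  have sJ := compatibleJ_skew hJ
  have hJ2 := compatibleJ_sq hJ
  have hmem : transportOp e J B t ψ ∈ quantumSpace (flow B t * J) :=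
    (quantumSpace _).smul_mem _
      (exp_quadOp_mem_quantumSpace e hJ2 sJ hB hBJ (hu t ht) hJt.1 hψ)
  rw [hγ t ht]
  refine ⟨hmem, _, hasWeakDeriv_transportOp e hJ2 sJ hB hBJ (hu t ht) (hpos t ht) hψ,
    fun φ hφ => herm_generator e hJt.1 (compatibleJ_skew hJt) ?_ hφ hmem⟩
  refine apply_J_of_anticomm ?_
  rw [← mul_assoc, ← flow_comm, mul_assoc, hBJ, mul_neg, mul_assoc]

theorem transportOp_zero (b : OrthonormalBasis ι ℝ V) {J : V →L[ℝ] V} (hJ : J * J = -1)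
    (B : V →L[ℝ] V) : transportOp b J B 0 = 1 := by
  have h0 : (1 / 2 : ℝ) • (J + flow B 0 * J) = J := by
    rw [flow_zero, one_mul, ← two_smul ℝ, smul_smul]; norm_num
  -- J⁴ = 1 and the determinant is positive, so the factor equals 1 at time 0.
  have hdet : J.det = 1 := by
    have h1 : (J * J * (J * J)).det = 1 := by rw [hJ, neg_mul_neg, one_mul, det_one']
    rw [det_mul, det_mul] at h1
    have h2 := det_pos_of_sq hJ
    have h3 : J.det ^ 4 = 1 := by rw [← h1]; ring
    exact (pow_eq_one_iff_of_nonneg h2.le (by norm_num)).mp h3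
  have h1 : quadOp b (nablaReal (V := V)) J 0 = 0 := by
    simp [quadOp]
  rw [transportOp, transportFactor, h0, hdet, Real.one_rpow, cayley_zero, h1,
    IsNilpotent.exp_zero, Complex.ofReal_one, one_smul]

end Transport

end FermionicTransport

end

open scoped TensorProduct

noncomputable section

set_option linter.unusedSectionVars false

namespace FermionicTransport

/-! ### Transport of the coherent states -/

section Coherent

variable {V : Type*} [NormedAddCommGroup V] [InnerProductSpace ℝ V] [FiniteDimensional ℝ V]
variable {W : Type*} [AddCommGroup W] [Module ℝ W] {ι : Type*} [Fintype ι]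

theorem gform_self_one (f : W →ₗ[ℝ] V) : gform f f 1 = 0 := by
  have h := gform_swap (A := (1 : V →L[ℝ] V)) (B := 1) (fun _ _ => rfl) f f
  have h2 : (2 : ℂ) • gform f f 1 = 0 := by
    rw [two_smul]; nth_rewrite 1 [h]; exact neg_add_cancel _
  exact (smul_eq_zero.mp h2).resolve_left two_ne_zero

theorem IsSkew.neg_apply_right {A : V →L[ℝ] V} (h : IsSkew A) (x y : V) :
    inner ℝ (A x) y = inner ℝ x ((-A) y) := by
  rw [h, neg_apply, inner_neg_right]

theorem IsSkew.gform_swap {A : V →L[ℝ] V} (h : IsSkew A) (f k : W →ₗ[ℝ] V) :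
    gform f k A = gform k f A := by
  rw [FermionicTransport.gform_swap h.neg_apply_right, gform_neg, neg_neg]

theorem fermInner_fermAct_fermVec {A : V →L[ℝ] V} (h : IsSkew A) (f k : W →ₗ[ℝ] V)
    (B : V →L[ℝ] V) :
    fermInner (fermAct A (fermVec f)) (fermAct B (fermVec k)) = -gform f k (A * B) := by
  rw [fermInner_fermAct_left h.neg_apply_right, fermAct_fermAct, neg_mul, ← gform_neg]; rfl

theorem fermInner_fermVec_fermAct (f k : W →ₗ[ℝ] V) (B : V →L[ℝ] V) :
    fermInner (fermVec f) (fermAct B (fermVec k)) = gform f k B := rfl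

theorem fermAct_one (u : V ⊗[ℝ] FermFun W) : fermAct 1 u = u :=
  LinearMap.congr_fun (LinearMap.rTensor_id _ _) u

theorem varpi_fermVec {J : V →L[ℝ] V} (h : IsSkew J) (f : W →ₗ[ℝ] V) :
    varpi J (fermVec f) = -gform f f J := by
  have h1 := fermInner_fermAct_fermVec h f f 1
  rwa [fermAct_one, mul_one] at h1

theorem fermInner_part10_part01 {J : V →L[ℝ] V} (hJ : J * J = -1) (h : IsSkew J)
    (f k : W →ₗ[ℝ] V) :
    fermInner (part10 J (fermVec f)) (part01 J (fermVec k)) =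
      (1 / 2 : ℂ) • (gform f k 1 + Complex.I • gform f k J) := by
  have e1 : fermInner (fermVec f) (fermVec k) = gform f k 1 := by
    rw [← fermInner_fermVec_fermAct, fermAct_one]
  have e2 : fermInner (fermAct J (fermVec f)) (fermVec k) = -gform f k J := by
    have h1 := fermInner_fermAct_fermVec h f k 1
    rwa [fermAct_one, mul_one] at h1
  simp only [part10, part01, map_sub, map_add, map_smul, LinearMap.sub_apply, LinearMap.smul_apply,
    fermInner_fermI_left, fermInner_fermI_right, fermInner_fermAct_fermVec h, hJ,
    fermInner_fermVec_fermAct, gform_neg, e1, e2, ← ferm_coe_smul]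
  match_scalars
  · linear_combination (-1 / 4 : ℂ) * Complex.I_mul_I
  · ring

/-- The exponent of the coherent states. -/
def coherentExponent (J : V →L[ℝ] V) : FermFun (V × V) :=
  (1 / 2 : ℂ) • (gform (LinearMap.fst ℝ V V) (LinearMap.snd ℝ V V) 1 +
    Complex.I • gform (LinearMap.fst ℝ V V) (LinearMap.snd ℝ V V) J) -
  (Complex.I / 4) • gform (LinearMap.fst ℝ V V) (LinearMap.fst ℝ V V) J

theorem coherentState_eq {J : V →L[ℝ] V} (hJ : J * J = -1) (h : IsSkew J) :
    coherentState J = IsNilpotent.exp (coherentExponent J) := by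
  rw [coherentState, coherentExponent, theta, chi, fermInner_part10_part01 hJ h,
    fermInner_part10_part01 hJ h, gform_self_one, ← ferm_coe_smul]
  congr 2
  push_cast
  module

theorem coherentExponent_mem_quad (J : V →L[ℝ] V) : coherentExponent J ∈ quad :=
  quad.sub_mem (quad.smul_mem _ (quad.add_mem (gform_mem_quad _ _ _)
    (quad.smul_mem _ (gform_mem_quad _ _ _)))) (quad.smul_mem _ (gform_mem_quad _ _ _))

/-- The covariant derivatives with respect to the variable `θ`. -/
def nablaTheta : V →ₗ[ℝ] Module.End ℂ (FermFun (V × V)) :=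
  nablaAlong (LinearMap.fst ℝ V V) (LinearMap.inl ℝ V V)

theorem isClifford_nablaTheta : IsClifford (nablaTheta (V := V)) :=
  isClifford_nablaAlong fun x => LinearMap.fst_apply (R := ℝ) (x, (0 : V))

/-- The function `-g(x_J^{1,0}, f)`. -/
def holCov (f : W →ₗ[ℝ] V) (J : V →L[ℝ] V) (x : V) : FermFun W :=
  (-1 / 2 : ℂ) • (cov f x - Complex.I • cov f (J x))

theorem holCov_J (f : W →ₗ[ℝ] V) {J : V →L[ℝ] V} (hJ : ∀ x, J (J x) = -x) (x : V) :
    holCov f J (J x) = Complex.I • holCov f J x := by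
  rw [holCov, holCov, hJ, map_neg]
  match_scalars
  · linear_combination (-1 / 2 : ℂ) * Complex.I_mul_I
  · ring

theorem contract_coherentExponent {J : V →L[ℝ] V} (h : IsSkew J) (x : V) :
    contract (LinearMap.inl ℝ V V x) (coherentExponent J) =
      (1 / 2 : ℂ) • (cov (LinearMap.snd ℝ V V) x - Complex.I • cov (LinearMap.snd ℝ V V) (J x)) +
        (Complex.I / 2) • cov (LinearMap.fst ℝ V V) (J x) := by
  have h1 : ∀ x y : V, inner ℝ ((1 : V →L[ℝ] V) x) y = inner ℝ x ((1 : V →L[ℝ] V) y) :=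
    fun _ _ => rfl
  rw [coherentExponent]
  simp only [map_sub, map_add, map_smul, contract_gform h.neg_apply_right, contract_gform h1,
    LinearMap.fst_apply, LinearMap.snd_apply, LinearMap.inl_apply, map_zero, sub_zero,
    one_apply_eq_self, neg_apply, map_neg]
  module

/-- The multiplier depends only on x^{1,0}. Hence annihilation operators kill the coherent state and
creation operators act on it by multiplication. -/
theorem nablaTheta_coherent {J : V →L[ℝ] V} (h : IsSkew J) (x : V) :
    nablaTheta x (IsNilpotent.exp (coherentExponent J)) =
      holCov (LinearMap.fst ℝ V V - LinearMap.snd ℝ V V) J x *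
        IsNilpotent.exp (coherentExponent J) := by
  rw [nablaTheta, nablaAlong_apply, contract_exp_quad _ (coherentExponent_mem_quad J),
    contract_coherentExponent h, holCov, cov_sub, cov_sub, ← ferm_coe_smul, ← ferm_smul_mul,
    ← sub_mul]
  congr 1
  push_cast
  module

theorem creat_coherent {J : V →L[ℝ] V} (hJ : ∀ x, J (J x) = -x) (h : IsSkew J) (x : V) :
    creat nablaTheta J x (IsNilpotent.exp (coherentExponent J)) =
      holCov (LinearMap.fst ℝ V V - LinearMap.snd ℝ V V) J x *
        IsNilpotent.exp (coherentExponent J) := by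
  change (1 / 2 : ℂ) • (nablaTheta x _ + (-Complex.I) • nablaTheta (J x) _) = _
  rw [nablaTheta_coherent h, nablaTheta_coherent h, holCov_J _ hJ, ferm_smul_mul]
  match_scalars
  linear_combination (-1 / 2 : ℂ) * Complex.I_mul_I

/-- Both the derivative and the multiplier are of type (1,0), and V^{1,0} is isotropic, so the
scalar term of the bracket vanishes. -/
theorem creat_holCov_mul {J : V →L[ℝ] V} (hJ : ∀ x, J (J x) = -x) (h : IsSkew J) (x y : V)
    (F : FermFun (V × V)) :
    creat nablaTheta J x (holCov (LinearMap.fst ℝ V V - LinearMap.snd ℝ V V) J y * F) =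
      -(holCov (LinearMap.fst ℝ V V - LinearMap.snd ℝ V V) J y * creat nablaTheta J x F) := by
  set v := LinearMap.fst ℝ V V - LinearMap.snd ℝ V V with hv
  have hvx : ∀ x, v (LinearMap.inl ℝ V V x) = x := fun x => by simp [hv]
  have key : ∀ x, nablaTheta x (holCov v J y * F) =
      ((-1 / 2 : ℂ) * ((inner ℝ y x : ℝ) - Complex.I * (inner ℝ (J y) x : ℝ))) • F -
        holCov v J y * nablaTheta x F := by
    intro x
    have hs : ∀ z, cov (LinearMap.fst ℝ V V) x * (cov v z * F) =
        -(cov v z * (cov (LinearMap.fst ℝ V V) x * F)) := fun z => by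
      rw [← mul_assoc, cov_mul_swap, ferm_neg_mul, mul_assoc]
    simp only [nablaTheta, nablaAlong_apply, holCov, ferm_smul_mul, sub_mul, map_smul, map_sub,
      contract_cov_mul, hvx, ferm_mul_smul, mul_sub, hs, ← ferm_coe_smul]
    module
  change (1 / 2 : ℂ) • (nablaTheta x _ + (-Complex.I) • nablaTheta (J x) _) =
    -(_ * ((1 / 2 : ℂ) • (nablaTheta x _ + (-Complex.I) • nablaTheta (J x) _)))
  have e1 : inner ℝ (J y) (J x) = inner ℝ y x := by rw [h, hJ, inner_neg_right, neg_neg]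
  have e2 : inner ℝ y (J x) = -inner ℝ (J y) x := h.right y x
  rw [key, key, e1, e2, ferm_mul_smul, mul_add, ferm_mul_smul]
  match_scalars
  · linear_combination (-1 / 4 * (inner ℝ y x : ℂ)) * Complex.I_mul_I
  · ring
  · ring

/-- The exponent `½ ∑ m(e_i) m(T e_i)` for `m(x) = -g(x_J^{1,0}, θ - χ)`. -/
def shiftExponent (J T : V →L[ℝ] V) : FermFun (V × V) :=
  (1 / 4 : ℂ) •
    (Complex.I • gform (LinearMap.fst ℝ V V - LinearMap.snd ℝ V V)
        (LinearMap.fst ℝ V V - LinearMap.snd ℝ V V) (J * T) -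
      gform (LinearMap.fst ℝ V V - LinearMap.snd ℝ V V)
        (LinearMap.fst ℝ V V - LinearMap.snd ℝ V V) T)

theorem shiftExponent_mem_quad (J T : V →L[ℝ] V) : shiftExponent J T ∈ quad :=
  quad.smul_mem _ (quad.sub_mem (quad.smul_mem _ (gform_mem_quad _ _ _)) (gform_mem_quad _ _ _))

theorem sum_holCov_mul (b : OrthonormalBasis ι ℝ V) {J T : V →L[ℝ] V} (hJ : J * J = -1)
    (h : IsSkew J) (hT : IsSkew T) (hTJ : T * J = -(J * T)) (f : W →ₗ[ℝ] V) :
    ∑ i, holCov f J (b i) * holCov f J (T (b i)) =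
      (1 / 2 : ℂ) • (Complex.I • gform f f (J * T) - gform f f T) := by
  have t1 : ∀ x y, inner ℝ (T x) y = inner ℝ x ((-T) y) := hT.neg_apply_right
  have t2 : ∀ x y, inner ℝ ((J * T) x) y = inner ℝ x ((T * J) y) := fun x y => by
    change inner ℝ (J (T x)) y = inner ℝ x (T (J y))
    rw [h, hT, neg_neg]
  have a1 := sum_cov_mul_cov (A := 1) b t1 f f
  have a2 := sum_cov_mul_cov (A := 1) b t2 f f
  have a3 := sum_cov_mul_cov (A := J) b t1 f f
  have a4 := sum_cov_mul_cov (A := J) b t2 f f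
  have e : ∀ i, holCov f J (b i) * holCov f J (T (b i)) =
      (1 / 4 : ℂ) • (cov f ((1 : V →L[ℝ] V) (b i)) * cov f (T (b i))) -
      (Complex.I / 4) • (cov f ((1 : V →L[ℝ] V) (b i)) * cov f ((J * T) (b i))) -
      (Complex.I / 4) • (cov f (J (b i)) * cov f (T (b i))) -
      (1 / 4 : ℂ) • (cov f (J (b i)) * cov f ((J * T) (b i))) := by
    intro i
    rw [holCov, holCov, one_apply_eq_self, show (J * T) (b i) = J (T (b i)) from rfl]
    simp only [ferm_smul_mul, ferm_mul_smul, sub_mul, mul_sub]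
    match_scalars
    · ring
    · ring
    · ring
    · linear_combination (1 / 4 : ℂ) * Complex.I_mul_I
  rw [Finset.sum_congr rfl fun i _ => e i, Finset.sum_sub_distrib, Finset.sum_sub_distrib,
    Finset.sum_sub_distrib, ← Finset.smul_sum, ← Finset.smul_sum, ← Finset.smul_sum,
    ← Finset.smul_sum, a1, a2, a3, a4, one_mul, one_mul, hTJ, mul_neg, mul_neg, ← mul_assoc, hJ,
    neg_mul, one_mul, neg_neg, gform_neg, gform_neg]
  module

/-- On the coherent state A(T) acts as multiplication by a quadratic function Q, and A(T) commutes
with multiplication by Q. Thus A(T)^k becomes Q^k for all k, and the exponentials agree. -/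
theorem exp_quadOp_coherent (b : OrthonormalBasis ι ℝ V) {J T : V →L[ℝ] V} (hJ : J * J = -1)
    (h : IsSkew J) (hT : IsSkew T) (hTJ : T * J = -(J * T)) :
    IsNilpotent.exp (quadOp b nablaTheta J T) (IsNilpotent.exp (coherentExponent J)) =
      IsNilpotent.exp (coherentExponent J + shiftExponent J T) := by
  have hJ' : ∀ x, J (J x) = -x := fun x => congrArg (fun A : V →L[ℝ] V => A x) hJ
  set v := LinearMap.fst ℝ V V - LinearMap.snd ℝ V V with hv
  set A := quadOp b nablaTheta J T with hA
  set Q := shiftExponent J T with hQ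
  set c := IsNilpotent.exp (coherentExponent J) with hc
  have hQs : Q = (1 / 2 : ℂ) • ∑ i, holCov v J (b i) * holCov v J (T (b i)) := by
    rw [sum_holCov_mul b hJ h hT hTJ, hQ, shiftExponent, smul_smul]
    norm_num
    rfl
  have hAm : ∀ x y F, A (holCov v J x * (holCov v J y * F)) =
      holCov v J x * (holCov v J y * A F) := by
    intro x y F
    have h1 : ∀ y F, A (holCov v J y * F) = holCov v J y * A F := by
      intro y F
      rw [hA, quadOp, LinearMap.smul_apply, LinearMap.sum_apply, LinearMap.smul_apply,
        LinearMap.sum_apply, ferm_mul_smul, Finset.mul_sum]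
      congr 1
      refine Finset.sum_congr rfl fun i _ => ?_
      rw [Module.End.mul_apply, Module.End.mul_apply, creat_holCov_mul hJ' h, map_neg,
        creat_holCov_mul hJ' h, neg_neg]
    rw [h1, h1]
  have hAQ : ∀ F, A (Q * F) = Q * A F := by
    intro F
    rw [hQs, ferm_smul_mul, ferm_smul_mul, map_smul, Finset.sum_mul, Finset.sum_mul, map_sum]
    congr 1
    refine Finset.sum_congr rfl fun i _ => ?_
    rw [mul_assoc, mul_assoc, hAm]
  have hAc : A c = Q * c := by
    rw [hQs, ferm_smul_mul, hA, quadOp, LinearMap.smul_apply, LinearMap.sum_apply, Finset.sum_mul]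
    congr 1
    refine Finset.sum_congr rfl fun i _ => ?_
    have e : holCov v J (b i) * holCov v J (T (b i)) =
        -(holCov v J (T (b i)) * holCov v J (b i)) := by
      simp only [holCov, ferm_smul_mul, ferm_mul_smul, sub_mul, mul_sub,
        cov_mul_swap v v (b i), cov_mul_swap v v (J (b i))]
      module
    rw [Module.End.mul_apply, creat_coherent hJ' h, creat_holCov_mul hJ' h, creat_coherent hJ' h, e,
      ferm_neg_mul, mul_assoc]
  have hpow : ∀ k, (A ^ k) c = Q ^ k * c := by
    intro k
    induction k with
    | zero => simp
    | succ k ih =>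
      have h2 : ∀ k, A (Q ^ k * c) = Q ^ k * A c := by
        intro k
        induction k with
        | zero => simp
        | succ k ih => rw [pow_succ', mul_assoc, hAQ, ih, mul_assoc]
      rw [pow_succ', Module.End.mul_apply, ih, h2, hAc, ← mul_assoc, ← pow_succ]
  obtain ⟨k, hk⟩ := isClifford_nablaTheta.isNilpotent_quadOp hJ' h b T
  obtain ⟨m, hm⟩ := isNilpotent_quad (shiftExponent_mem_quad J T)
  have hk' : A ^ (max k m) = 0 := pow_eq_zero_of_le (le_max_left _ _) hk
  have hm' : Q ^ (max k m) = 0 := pow_eq_zero_of_le (le_max_right _ _) hm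
  rw [add_comm, exp_add_quad (shiftExponent_mem_quad J T) (coherentExponent_mem_quad J),
    exp_eq_sum_complex hk', exp_eq_sum_complex hm', LinearMap.sum_apply, Finset.sum_mul]
  refine Finset.sum_congr rfl fun i _ => ?_
  rw [LinearMap.smul_apply, hpow, ferm_smul_mul]

/-- The exponent of the transported coherent states. -/
theorem exponent_identity {J₀ J₁ T : V →L[ℝ] V} (hJ₀ : J₀ * J₀ = -1) (hJ₁ : J₁ * J₁ = -1)
    (s₀ : IsSkew J₀) (s₁ : IsSkew J₁) (hT : IsSkew T) (hT₀ : T * J₀ = -(J₀ * T))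
    (hT₁ : T * J₁ = -(J₁ * T)) (h₁₀ : J₁ * (1 + T) = (1 + T) * J₀)
    (hK : Ring.inverse ((1 / 2 : ℝ) • (J₀ + J₁)) = -(J₀ * (1 - T))) :
    (Complex.I / 4) • varpi J₁ theta + transportExponent J₀ J₁ =
      coherentExponent J₀ + shiftExponent J₀ T := by
  set f := LinearMap.fst ℝ V V with hf
  set k := LinearMap.snd ℝ V V with hk
  set K := Ring.inverse ((1 / 2 : ℝ) • (J₀ + J₁)) with hKdef
  -- Taking (1,0)- and (0,1)-parts produces K multiplied by J₀ or J₁ on either side; the relations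
  -- below turn these products into 1 ± T.
  have k1 : K = J₀ * T - J₀ := by rw [hK]; noncomm_ring
  have sK : IsSkew K := by
    intro x y
    have e1 : K x = J₀ (T x) - J₀ x := congrArg (fun A : V →L[ℝ] V => A x) k1
    have e2 : K y = J₀ (T y) - J₀ y := congrArg (fun A : V →L[ℝ] V => A y) k1
    rw [e1, e2, inner_sub_left, inner_sub_right, s₀, hT, s₀, apply_J_of_anticomm hT₀,
      inner_neg_right]
    ring
  have k2 : K = -(J₁ * (1 + T)) := by rw [h₁₀, k1, add_mul, hT₀]; noncomm_ring
  have k3 : J₁ * K = 1 + T := by rw [k2, mul_neg, ← mul_assoc, hJ₁]; noncomm_ring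
  have k4 : K * J₁ = 1 - T := by
    have : K * J₁ = J₁ * J₁ * (T - 1) := by
      rw [k2, neg_mul, mul_assoc, add_mul, hT₁]; noncomm_ring
    rw [this, hJ₁]; noncomm_ring
  have k5 : K * J₀ = 1 + T := by
    rw [k1, sub_mul, mul_assoc, hT₀, mul_neg, ← mul_assoc, hJ₀]; noncomm_ring
  have k6 : J₀ * K = 1 - T := by rw [k1, mul_sub, ← mul_assoc, hJ₀]; noncomm_ring
  have k7 : J₁ + J₁ * T = J₀ - J₀ * T := by
    have := h₁₀
    rw [mul_add, add_mul, mul_one, one_mul, hT₀] at this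
    rw [this]; abel
  have sJT : IsSkew (J₀ * T) := by
    intro x y
    change inner ℝ (J₀ (T x)) y = -inner ℝ x (J₀ (T y))
    rw [s₀, hT, apply_J_of_anticomm hT₀, inner_neg_right, neg_neg]
  have eaa : fermInner (part10 J₁ (fermVec f)) (fermAct K (part10 J₁ (fermVec f))) =
      (1 / 2 : ℂ) • (Complex.I • gform f f T - gform f f (J₁ * T)) := by
    simp only [part10, map_sub, map_smul, LinearMap.sub_apply, LinearMap.smul_apply,
      fermAct_fermI, fermAct_fermAct, fermInner_fermI_left, fermInner_fermI_right,
      fermInner_fermAct_fermVec s₁, fermInner_fermVec_fermAct, k3, k4, ← ferm_coe_smul]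
    rw [k2, gform_neg, mul_add, mul_sub, mul_one, gform_add, gform_sub, gform_add, gform_sub]
    push_cast
    match_scalars <;> ring_nf <;> norm_num [Complex.I_sq]
  have eab : fermInner (part10 J₁ (fermVec f)) (fermAct K (part01 J₀ (fermVec k))) =
      (1 / 2 : ℂ) • (gform f k (J₀ * T) - gform f k J₀ +
        Complex.I • (gform f k 1 + gform f k T)) := by
    simp only [part10, part01, map_sub, map_add, map_smul, LinearMap.sub_apply,
      LinearMap.smul_apply,
      fermAct_fermI, fermAct_fermAct, fermInner_fermI_left, fermInner_fermI_right,
      fermInner_fermAct_fermVec s₁, fermInner_fermVec_fermAct, k3, k5, ← ferm_coe_smul]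
    rw [mul_add, mul_one, k7, k1, gform_add, gform_sub, gform_sub]
    push_cast
    match_scalars <;> ring_nf <;> norm_num [Complex.I_sq]
  have eba : fermInner (part01 J₀ (fermVec k)) (fermAct K (part10 J₁ (fermVec f))) =
      (1 / 2 : ℂ) • (gform f k (J₀ * T) - gform f k J₀ +
        Complex.I • (gform f k 1 + gform f k T)) := by
    simp only [part10, part01, map_sub, map_add, map_smul, LinearMap.add_apply,
      LinearMap.smul_apply,
      fermAct_fermI, fermAct_fermAct, fermInner_fermI_left, fermInner_fermI_right,
      fermInner_fermAct_fermVec s₀, fermInner_fermVec_fermAct, k4, k6, ← ferm_coe_smul]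
    rw [mul_sub, mul_one, k1, gform_sub, gform_sub, gform_sub, sJT.gform_swap k f, s₀.gform_swap k f,
      hT.gform_swap k f, gform_swap (A := (1 : V →L[ℝ] V)) (B := 1) (fun _ _ => rfl) k f]
    push_cast
    match_scalars <;> ring_nf <;> norm_num [Complex.I_sq]
  have ebb : fermInner (part01 J₀ (fermVec k)) (fermAct K (part01 J₀ (fermVec k))) =
      (1 / 2 : ℂ) • (gform k k (J₀ * T) + Complex.I • gform k k T) := by
    simp only [part01, map_add, map_smul, LinearMap.add_apply, LinearMap.smul_apply,
      fermAct_fermI, fermAct_fermAct, fermInner_fermI_left, fermInner_fermI_right,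
      fermInner_fermAct_fermVec s₀, fermInner_fermVec_fermAct, k5, k6, ← ferm_coe_smul]
    rw [mul_add, mul_one, k1, gform_sub, gform_sub, gform_add, gform_add]
    push_cast
    match_scalars <;> ring_nf <;> norm_num [Complex.I_sq]
  rw [transportExponent, theta, chi, ← hf, ← hk, ← hKdef, varpi_fermVec s₁, map_sub, map_sub,
    LinearMap.sub_apply, map_sub, map_sub, eaa, eab, eba, ebb, coherentExponent, shiftExponent, ← hf, ← hk,
    gform_sub_sub, gform_sub_sub, sJT.gform_swap k f, hT.gform_swap k f]
  -- The intertwining relation eliminates the last occurrences of J₁.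
  have k8 : gform f f J₁ + gform f f (J₁ * T) = gform f f J₀ - gform f f (J₀ * T) := by
    rw [← gform_add, ← gform_sub, k7]
  have k9 := eq_sub_of_add_eq k8
  rw [k9]
  match_scalars <;> ring_nf <;> norm_num [Complex.I_sq]

end Coherent

end FermionicTransport

end

open scoped TensorProduct

noncomputable section

set_option linter.unusedSectionVars false

namespace FermionicTransport

/-! ### States with a fermionic parameter -/

section Parameter

variable {V : Type*} [NormedAddCommGroup V] [InnerProductSpace ℝ V] [FiniteDimensional ℝ V]
variable {W W' : Type*} [AddCommGroup W] [Module ℝ W] [AddCommGroup W'] [Module ℝ W']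
variable {ι : Type*} [Fintype ι]

theorem quadOp_intertwine (b : OrthonormalBasis ι ℝ V) (J T : V →L[ℝ] V)
    {N : V →ₗ[ℝ] Module.End ℂ (FermFun W)} {N' : V →ₗ[ℝ] Module.End ℂ (FermFun W')}
    {g : FermFun W →ₗ[ℂ] FermFun W'} (h : ∀ x F, N' x (g F) = g (N x F)) :
    quadOp b N' J T ∘ₗ g = g ∘ₗ quadOp b N J T := by
  have hc : ∀ x F, creat N' J x (g F) = g (creat N J x F) := by
    intro x F
    change (1 / 2 : ℂ) • (N' x (g F) + (-Complex.I) • N' (J x) (g F)) =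
      g ((1 / 2 : ℂ) • (N x F + (-Complex.I) • N (J x) F))
    rw [h, h, map_smul, map_add, map_smul]
  refine LinearMap.ext fun F => ?_
  rw [LinearMap.comp_apply, LinearMap.comp_apply, quadOp, quadOp, LinearMap.smul_apply,
    LinearMap.smul_apply, LinearMap.sum_apply, LinearMap.sum_apply, map_smul, map_sum]
  congr 1
  refine Finset.sum_congr rfl fun i _ => ?_
  rw [Module.End.mul_apply, Module.End.mul_apply, hc, hc]

/-- A map commuting with the covariant derivatives commutes with e^{A(T)}. It is applied to pulling
back states of θ, to multiplying by functions of χ, and to integrating over χ. -/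
theorem exp_quadOp_intertwine (b : OrthonormalBasis ι ℝ V) {J : V →L[ℝ] V}
    (hJ : ∀ x, J (J x) = -x) (hs : IsSkew J) (T : V →L[ℝ] V)
    {N : V →ₗ[ℝ] Module.End ℂ (FermFun W)} {N' : V →ₗ[ℝ] Module.End ℂ (FermFun W')}
    (hN : IsClifford N) (hN' : IsClifford N')
    {g : FermFun W →ₗ[ℂ] FermFun W'} (h : ∀ x F, N' x (g F) = g (N x F)) (F : FermFun W) :
    IsNilpotent.exp (quadOp b N' J T) (g F) = g (IsNilpotent.exp (quadOp b N J T) F) :=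
  LinearMap.congr_fun (Module.End.commute_exp_left_of_commute (hN.isNilpotent_quadOp hJ hs b T)
    (hN'.isNilpotent_quadOp hJ hs b T) (quadOp_intertwine b J T h)) F

theorem nablaTheta_mul_snd (x : V) (F : FermFun (V × V)) (a : FermFun V) :
    nablaTheta x (F * pullback (LinearMap.snd ℝ V V) a) =
      nablaTheta x F * pullback (LinearMap.snd ℝ V V) a := by
  rw [nablaTheta, nablaAlong_apply, nablaAlong_apply, contract_mul, contract_pullback,
    LinearMap.snd_apply, LinearMap.inl_apply, map_zero, LinearMap.zero_apply, map_zero, mul_zero,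
    add_zero, sub_mul, ferm_real_smul_mul, mul_assoc]

theorem nablaTheta_pullback_fst (x : V) (ψ : FermFun V) :
    nablaTheta x (pullback (LinearMap.fst ℝ V V) ψ) =
      pullback (LinearMap.fst ℝ V V) (nablaReal x ψ) := by
  rw [nablaTheta, nablaAlong_apply, nablaReal_eq_nablaAlong, nablaAlong_apply, contract_pullback,
    map_sub, pullback_real_smul, map_mul, pullback_cov]
  rfl

theorem paramState_tmul (J : V →L[ℝ] V) (ψ : quantumSpace J) (a : FermFun V) :
    paramState J (ψ ⊗ₜ[ℂ] a) = pullback (LinearMap.fst ℝ V V) (ψ : FermFun V) *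
      pullback (LinearMap.snd ℝ V V) a := rfl

theorem exp_quadOp_mul_snd (b : OrthonormalBasis ι ℝ V) {J : V →L[ℝ] V}
    (hJ : ∀ x, J (J x) = -x) (hs : IsSkew J) (T : V →L[ℝ] V) (F : FermFun (V × V))
    (a : FermFun V) :
    IsNilpotent.exp (quadOp b nablaTheta J T) (F * pullback (LinearMap.snd ℝ V V) a) =
      IsNilpotent.exp (quadOp b nablaTheta J T) F * pullback (LinearMap.snd ℝ V V) a :=
  exp_quadOp_intertwine b hJ hs T isClifford_nablaTheta isClifford_nablaTheta
    (g := LinearMap.mulRight ℂ (pullback (LinearMap.snd ℝ V V) a))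
    (fun x F => nablaTheta_mul_snd x F a) F

/-- On functions of θ and χ the extension of U acts by e^{A(T)} in the variable θ. So the result
depends only on the function, not on the tensor that represents it. -/
theorem paramState_rTensor (b : OrthonormalBasis ι ℝ V) {J₀ J₁ : V →L[ℝ] V}
    (hJ : ∀ x, J₀ (J₀ x) = -x) (hs : IsSkew J₀) (T : V →L[ℝ] V) {c : ℂ}
    {U : quantumSpace J₀ →ₗ[ℂ] quantumSpace J₁}
    (hU : ∀ ψ, (U ψ : FermFun V) = c • IsNilpotent.exp (quadOp b nablaReal J₀ T) (ψ : FermFun V))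
    (Z : quantumSpace J₀ ⊗[ℂ] FermFun V) :
    paramState J₁ (LinearMap.rTensor (FermFun V) U Z) =
      c • IsNilpotent.exp (quadOp b nablaTheta J₀ T) (paramState J₀ Z) := by
  induction Z using TensorProduct.induction_on with
  | zero => simp
  | add x y hx hy => rw [map_add, map_add, hx, hy, map_add, map_add, smul_add]
  | tmul ψ a =>
    have h := exp_quadOp_intertwine b hJ hs T isClifford_nablaReal isClifford_nablaTheta
      (g := (pullback (LinearMap.fst ℝ V V)).toLinearMap) nablaTheta_pullback_fst (ψ : FermFun V)
    rw [LinearMap.rTensor_tmul, paramState_tmul, paramState_tmul, hU, map_smul, ferm_smul_mul,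
      exp_quadOp_mul_snd b hJ hs]
    exact congrArg (fun F => c • (F * _)) h.symm

/-! ### Coherent states as states with a parameter -/

theorem nablaReal_cov_mul (x y : V) (F : FermFun V) :
    nablaReal y (cov LinearMap.id x * F) =
      inner ℝ x y • F - cov LinearMap.id x * nablaReal y F := by
  have h : cov LinearMap.id y * (cov LinearMap.id x * F) =
      -(cov LinearMap.id x * (cov LinearMap.id y * F)) := by
    rw [← mul_assoc, cov_mul_swap, ferm_neg_mul, mul_assoc]
  rw [nablaReal_eq_nablaAlong, nablaAlong_apply, nablaAlong_apply, contract_cov_mul, h, mul_sub,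
    ferm_mul_real_smul]
  simp only [LinearMap.id_apply]
  module

theorem nablaReal_inv (y : V) (F : FermFun V) : nablaReal y (inv F) = -inv (nablaReal y F) := by
  rw [nablaReal_eq_nablaAlong, nablaAlong_apply, nablaAlong_apply, contract_inv, map_sub,
    inv_real_smul, map_mul, inv_cov, ferm_neg_mul]
  module

/-- The factor is 2g(x, θ^{1,0}), which anticommutes with all annihilation operators as V^{0,1} is
isotropic. The grade involution makes this a multiplication from the right. -/
theorem cov_mul_inv_mem_quantumSpace {J : V →L[ℝ] V} (hJ : ∀ x, J (J x) = -x) (hs : IsSkew J)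
    {ψ : FermFun V} (hψ : ψ ∈ quantumSpace J) (x : V) :
    (cov LinearMap.id x + Complex.I • cov LinearMap.id (J x)) * inv ψ ∈ quantumSpace J := by
  rw [mem_quantumSpace_iff hJ] at hψ ⊢
  intro y
  have hψ' : (1 / 2 : ℂ) • (nablaReal y ψ + Complex.I • nablaReal (J y) ψ) = 0 := hψ y
  have key : ∀ y, nablaReal y ((cov LinearMap.id x + Complex.I • cov LinearMap.id (J x)) * inv ψ) =
      ((inner ℝ x y : ℂ) + Complex.I * (inner ℝ (J x) y : ℝ)) • inv ψ +
        (cov LinearMap.id x + Complex.I • cov LinearMap.id (J x)) * inv (nablaReal y ψ) := by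
    intro y
    rw [add_mul, ferm_smul_mul, map_add, map_smul, nablaReal_cov_mul, nablaReal_cov_mul,
      nablaReal_inv, ferm_mul_neg, ferm_mul_neg, add_mul, ferm_smul_mul, ← ferm_coe_smul,
      ← ferm_coe_smul]
    module
  change (1 / 2 : ℂ) • (nablaReal y _ + Complex.I • nablaReal (J y) _) = 0
  have e1 : inner ℝ (J x) (J y) = inner ℝ x y := by rw [hs, hJ, inner_neg_right, neg_neg]
  have e2 : inner ℝ x (J y) = -inner ℝ (J x) y := hs.right x y
  have e3 := congrArg (fun F => (cov LinearMap.id x + Complex.I • cov LinearMap.id (J x)) * inv F)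
    hψ'
  simp only [map_smul, map_add, map_zero, mul_zero, ferm_mul_smul, mul_add] at e3
  rw [key, key, e1, e2, smul_add, smul_add, smul_add]
  rw [smul_add] at e3
  have e4 : (1 / 2 : ℂ) • (((inner ℝ x y : ℂ) + Complex.I * (inner ℝ (J x) y : ℝ)) • inv ψ) +
      (1 / 2 : ℂ) • Complex.I • (((-inner ℝ (J x) y : ℝ) + Complex.I * (inner ℝ x y : ℝ)) • inv ψ)
      = 0 := by
    match_scalars
    linear_combination (1 / 2 * (inner ℝ x y : ℂ)) * Complex.I_mul_I
  rw [smul_add]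
  calc _ = ((1 / 2 : ℂ) • (((inner ℝ x y : ℂ) + Complex.I * (inner ℝ (J x) y : ℝ)) • inv ψ) +
      (1 / 2 : ℂ) • Complex.I • (((-inner ℝ (J x) y : ℝ) + Complex.I * (inner ℝ x y : ℝ)) • inv ψ))
      + _ := add_add_add_comm _ _ _ _
    _ = 0 := by rw [e4, e3, add_zero]

/-- The exponent of the vacuum state of `H_J`. -/
def vacuumExponent (J : V →L[ℝ] V) : FermFun V :=
  -((Complex.I / 4) • gform LinearMap.id LinearMap.id J)

theorem vacuumExponent_mem_quad (J : V →L[ℝ] V) : vacuumExponent J ∈ quad :=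
  quad.neg_mem (quad.smul_mem _ (gform_mem_quad _ _ _))

theorem varpi_theta₁ {J : V →L[ℝ] V} (hs : IsSkew J) :
    (Complex.I / 4) • varpi J theta₁ = vacuumExponent J := by
  rw [theta₁, varpi_fermVec hs, smul_neg]; rfl

theorem nablaReal_exp_vacuum_mul {J : V →L[ℝ] V} (hs : IsSkew J) (x : V) (F : FermFun V) :
    nablaReal x (IsNilpotent.exp (vacuumExponent J) * F) =
      IsNilpotent.exp (vacuumExponent J) * (((Complex.I / 2) • cov LinearMap.id (J x) -
        (1 / 2 : ℂ) • cov LinearMap.id x) * F + contract x F) := by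
  have h : contract x (vacuumExponent J) = (Complex.I / 2) • cov LinearMap.id (J x) := by
    rw [vacuumExponent, map_neg, map_smul, contract_gform hs.neg_apply_right]
    simp only [LinearMap.id_apply, neg_apply, map_neg]
    module
  rw [nablaReal_eq_nablaAlong, nablaAlong_apply, LinearMap.id_apply,
    contract_exp_mul _ (vacuumExponent_mem_quad J), h, ← mul_assoc (cov LinearMap.id x),
    ← (commute_exp_quad (vacuumExponent_mem_quad J) _).eq, mul_assoc _ (cov LinearMap.id x),
    ← ferm_mul_real_smul, ← mul_sub, sub_mul, ferm_smul_mul, ferm_smul_mul, ← ferm_coe_smul]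
  congr 1
  push_cast
  abel

/-- `e^{i ϖ_J / 2} φ` is in `H_J` if and only if `φ` is holomorphic. -/
theorem exp_vacuum_mul_mem_iff {J : V →L[ℝ] V} (hJ : ∀ x, J (J x) = -x) (hs : IsSkew J)
    (F : FermFun V) : IsNilpotent.exp (vacuumExponent J) * F ∈ quantumSpace J ↔
      ∀ x, contract x F + Complex.I • contract (J x) F = 0 := by
  rw [mem_quantumSpace_iff hJ]
  refine forall_congr' fun x => ?_
  change (1 / 2 : ℂ) • (nablaReal x _ + Complex.I • nablaReal (J x) _) = 0 ↔ _
  have e : (1 / 2 : ℂ) • (nablaReal x (IsNilpotent.exp (vacuumExponent J) * F) +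
      Complex.I • nablaReal (J x) (IsNilpotent.exp (vacuumExponent J) * F)) =
      IsNilpotent.exp (vacuumExponent J) *
        ((1 / 2 : ℂ) • (contract x F + Complex.I • contract (J x) F)) := by
    rw [nablaReal_exp_vacuum_mul hs, nablaReal_exp_vacuum_mul hs, hJ, map_neg, ← ferm_mul_smul,
      ← mul_add, ← ferm_mul_smul]
    congr 1
    simp only [sub_mul, ferm_smul_mul, ferm_neg_mul]
    match_scalars <;> ring_nf
    norm_num [Complex.I_sq]
  rw [e]
  constructor
  · intro h
    have h1 := congrArg (fun G => IsNilpotent.exp (-vacuumExponent J) * G) h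
    have h2 : IsNilpotent.exp (-vacuumExponent J) * IsNilpotent.exp (vacuumExponent J) = 1 :=
      IsNilpotent.exp_neg_mul_exp_self (isNilpotent_quad (vacuumExponent_mem_quad J))
    simp only [← mul_assoc] at h1
    rw [h2, one_mul, mul_zero] at h1
    exact (smul_eq_zero.mp h1).resolve_left (by norm_num)
  · intro h
    rw [h, smul_zero, mul_zero]

theorem exp_vacuum_mem {J : V →L[ℝ] V} (hJ : ∀ x, J (J x) = -x) (hs : IsSkew J) :
    IsNilpotent.exp (vacuumExponent J) ∈ quantumSpace J := by
  have h := (exp_vacuum_mul_mem_iff hJ hs 1).mpr fun x => by simp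
  rwa [mul_one] at h

/-- The coupling `g(θ, χ_J^{0,1})`. -/
def couplingExponent (J : V →L[ℝ] V) : FermFun (V × V) :=
  (1 / 2 : ℂ) • (gform (LinearMap.fst ℝ V V) (LinearMap.snd ℝ V V) 1 +
    Complex.I • gform (LinearMap.fst ℝ V V) (LinearMap.snd ℝ V V) J)

theorem couplingExponent_mem_quad (J : V →L[ℝ] V) : couplingExponent J ∈ quad :=
  quad.smul_mem _ (quad.add_mem (gform_mem_quad _ _ _) (quad.smul_mem _ (gform_mem_quad _ _ _)))

theorem coherentExponent_eq (J : V →L[ℝ] V) : coherentExponent J =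
    couplingExponent J + pullback (LinearMap.fst ℝ V V) (vacuumExponent J) := by
  rw [vacuumExponent, map_neg, map_smul, pullback_gform]
  exact sub_eq_add_neg _ _

theorem couplingExponent_mul_mem {J : V →L[ℝ] V} (hJ : ∀ x, J (J x) = -x) (hs : IsSkew J)
    {F : FermFun (V × V)} (hF : F ∈ LinearMap.range (paramState J)) :
    couplingExponent J * F ∈ LinearMap.range (paramState J) := by
  obtain ⟨Z, rfl⟩ := hF
  induction Z using TensorProduct.induction_on with
  | zero => rw [map_zero, mul_zero]; exact Submodule.zero_mem _
  | add x y hx hy => rw [map_add, mul_add]; exact Submodule.add_mem _ hx hy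
  | tmul ψ a =>
    let b := stdOrthonormalBasis ℝ V
    have e : couplingExponent J = (1 / 2 : ℂ) • ∑ i,
        (cov (LinearMap.fst ℝ V V) (b i) + Complex.I • cov (LinearMap.fst ℝ V V) (J (b i))) *
          cov (LinearMap.snd ℝ V V) (b i) := by
      rw [couplingExponent, gform_eq_sum b, gform_eq_sum b, Finset.smul_sum,
        ← Finset.sum_add_distrib]
      simp only [add_mul, ferm_smul_mul, one_apply_eq_self]
    rw [e, ferm_smul_mul, Finset.sum_mul]
    refine Submodule.smul_mem _ _ (Submodule.sum_mem _ fun i _ => ?_)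
    refine ⟨⟨_, cov_mul_inv_mem_quantumSpace hJ hs ψ.2 (b i)⟩ ⊗ₜ (cov LinearMap.id (b i) * a), ?_⟩
    rw [paramState_tmul, paramState_tmul, map_mul, map_mul, map_add, map_smul, pullback_cov,
      pullback_cov, pullback_cov, pullback_inv, LinearMap.id_comp, LinearMap.id_comp, mul_assoc,
      mul_assoc, ← mul_assoc (inv _), ← mul_assoc (cov (LinearMap.snd ℝ V V) (b i))]
    congr 2
    exact (linFun_mul _ _).symm

/-- The coherent state is the vacuum times a finite power series in g(θ, χ^{0,1}), and each such
factor preserves the states with a parameter. -/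
theorem coherent_mem_range {J : V →L[ℝ] V} (hJ : ∀ x, J (J x) = -x) (hs : IsSkew J) :
    IsNilpotent.exp (coherentExponent J) ∈ LinearMap.range (paramState J) := by
  have h0 : IsNilpotent.exp (pullback (LinearMap.fst ℝ V V) (vacuumExponent J)) ∈
      LinearMap.range (paramState J) := by
    refine ⟨⟨_, exp_vacuum_mem hJ hs⟩ ⊗ₜ 1, ?_⟩
    rw [paramState_tmul, map_one, mul_one, pullback_exp _ (vacuumExponent_mem_quad J)]
  have hpow : ∀ k : ℕ, couplingExponent J ^ k *
      IsNilpotent.exp (pullback (LinearMap.fst ℝ V V) (vacuumExponent J)) ∈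
        LinearMap.range (paramState J) := by
    intro k
    induction k with
    | zero => rwa [pow_zero, one_mul]
    | succ k ih => rw [pow_succ', mul_assoc]; exact couplingExponent_mul_mem hJ hs ih
  obtain ⟨k, hk⟩ := isNilpotent_quad (couplingExponent_mem_quad J)
  rw [coherentExponent_eq, exp_add_quad (couplingExponent_mem_quad J)
    (pullback_mem_quad _ (vacuumExponent_mem_quad J)), exp_eq_sum_complex hk, Finset.sum_mul]
  refine Submodule.sum_mem _ fun i _ => ?_
  rw [ferm_smul_mul]
  exact Submodule.smul_mem _ _ (hpow i)

end Parameter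

end FermionicTransport

end

open scoped TensorProduct

noncomputable section

set_option linter.unusedSectionVars false

namespace FermionicTransport

/-! ### The fermionic integral over a parameter -/

section Integral

variable {V : Type*} [NormedAddCommGroup V] [InnerProductSpace ℝ V] [FiniteDimensional ℝ V]
variable {n : ℕ} (e : OrthonormalBasis (Fin (2 * n)) ℝ V)

/-- The fermionic integral over the second variable, as a linear map. -/
def fermIntegralₗ : FermFun (V × V) →ₗ[ℂ] FermFun V :=
  (Complex.I ^ n * (-1) ^ (2 * n * (2 * n - 1) / 2) : ℂ) •
    ((pullback (LinearMap.inl ℝ V V)).toLinearMap ∘ₗ contractFrame (fun i => ((0 : V), e i)))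

theorem fermIntegralₗ_apply (F : FermFun (V × V)) : fermIntegralₗ e F = fermIntegral e F := rfl

theorem fermIntegralₗ_linFun_mul (α : Module.Dual ℝ V) (F : FermFun (V × V)) :
    fermIntegralₗ e (linFun (α ∘ₗ LinearMap.fst ℝ V V) * F) = linFun α * fermIntegralₗ e F := by
  have h := contractFrame_comm (fun i => ((0 : V), e i))
    (LinearMap.mulLeft ℂ (linFun (α ∘ₗ LinearMap.fst ℝ V V))) (fun i F => by
      rw [LinearMap.mulLeft_apply, LinearMap.mulLeft_apply, contract_linFun_mul]
      simp) F
  rw [LinearMap.mulLeft_apply, LinearMap.mulLeft_apply] at h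
  rw [fermIntegralₗ_apply, fermIntegralₗ_apply, fermIntegral, fermIntegral, h, map_mul,
    pullback_linFun, LinearMap.comp_assoc, LinearMap.fst_comp_inl, LinearMap.comp_id,
    ferm_mul_smul]

theorem fermIntegralₗ_fst_mul (a : FermFun V) (F : FermFun (V × V)) :
    fermIntegralₗ e (pullback (LinearMap.fst ℝ V V) a * F) = a * fermIntegralₗ e F := by
  induction a using fermFun_induction with
  | one => rw [map_one, one_mul, one_mul]
  | smul c x hx => rw [map_smul, ferm_smul_mul, map_smul, hx, ferm_smul_mul]
  | add x y hx hy => rw [map_add, add_mul, map_add, hx, hy, add_mul]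
  | mul α x hx =>
    rw [map_mul (pullback _), pullback_linFun, mul_assoc, fermIntegralₗ_linFun_mul, hx, mul_assoc]

theorem contract_fermIntegralₗ (x : V) (F : FermFun (V × V)) :
    contract x (fermIntegralₗ e F) = fermIntegralₗ e (contract (x, 0) F) := by
  rw [fermIntegralₗ_apply, fermIntegralₗ_apply, fermIntegral, fermIntegral, map_smul,
    contract_pullback, contractFrame_comm _ (contract (x, (0 : V)))
      (fun i F => contract_contract _ _ F)]
  rfl

theorem fermIntegralₗ_contract (x : V) (F : FermFun (V × V)) :
    fermIntegralₗ e (contract (0, x) F) = 0 := by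
  rw [fermIntegralₗ_apply, fermIntegral, contractFrame_comm _ (contract ((0 : V), x))
    (fun i F => contract_contract _ _ F)]
  have h : ((0 : V), x) = ∑ i, inner ℝ (e i) x • ((0 : V), e i) := by
    refine Prod.ext (by simp [Prod.fst_sum]) ?_
    rw [Prod.snd_sum]
    exact (e.sum_repr' x).symm
  have h2 : contract ((0 : V), x) (contractFrame (fun i => ((0 : V), e i)) F) = 0 := by
    rw [h, map_sum, LinearMap.sum_apply]
    refine Finset.sum_eq_zero fun i _ => ?_
    rw [map_smul, LinearMap.smul_apply, contract_contractFrame_self (fun i => ((0 : V), e i)) i,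
      smul_zero]
  rw [h2, map_zero, smul_zero]

/-- Covariant derivatives in θ pass under the integral over χ, without sign because the number of
integrated variables is even. -/
theorem nablaReal_fermIntegralₗ (x : V) (F : FermFun (V × V)) :
    nablaReal x (fermIntegralₗ e F) = fermIntegralₗ e (nablaTheta x F) := by
  rw [nablaTheta, nablaAlong_apply, nablaReal_eq_nablaAlong, nablaAlong_apply, map_sub,
    contract_fermIntegralₗ, ← ferm_coe_smul, ← ferm_coe_smul, map_smul,
    ← fermIntegralₗ_fst_mul, pullback_cov]
  rfl

/-- The exponent `g(θ - χ, χ_J^{0,1})` of the reproducing kernel. -/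
def kernelExponent (J : V →L[ℝ] V) : FermFun (V × V) :=
  couplingExponent J - (Complex.I / 2) • gform (LinearMap.snd ℝ V V) (LinearMap.snd ℝ V V) J

theorem kernelExponent_mem_quad (J : V →L[ℝ] V) : kernelExponent J ∈ quad :=
  quad.sub_mem (couplingExponent_mem_quad J) (quad.smul_mem _ (gform_mem_quad _ _ _))

theorem contract_kernelExponent {J : V →L[ℝ] V} (hs : IsSkew J) (x y : V) :
    contract (x, y) (kernelExponent J) =
      (1 / 2 : ℂ) • (cov (LinearMap.snd ℝ V V) x - Complex.I • cov (LinearMap.snd ℝ V V) (J x)) -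
      (1 / 2 : ℂ) • (cov (LinearMap.fst ℝ V V) y + Complex.I • cov (LinearMap.fst ℝ V V) (J y)) +
      Complex.I • cov (LinearMap.snd ℝ V V) (J y) := by
  rw [kernelExponent, couplingExponent, map_sub, map_smul, map_smul, map_add, map_smul,
    contract_gform (A := 1) (B := 1) (fun _ _ => rfl), contract_gform hs.neg_apply_right,
    contract_gform hs.neg_apply_right]
  simp only [LinearMap.fst_apply, LinearMap.snd_apply, one_apply_eq_self, neg_apply, map_neg]
  module

/-- The integral operator with the kernel `exp g(θ - χ, χ_J^{0,1})`. -/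
def kernelOp (J : V →L[ℝ] V) : FermFun V →ₗ[ℂ] FermFun V :=
  fermIntegralₗ e ∘ₗ LinearMap.mulLeft ℂ (IsNilpotent.exp (kernelExponent J)) ∘ₗ
    (pullback (LinearMap.snd ℝ V V)).toLinearMap

theorem kernelOp_apply (J : V →L[ℝ] V) (φ : FermFun V) : kernelOp e J φ = fermIntegralₗ e
    (IsNilpotent.exp (kernelExponent J) * pullback (LinearMap.snd ℝ V V) φ) := rfl

theorem contract_kernel_mul {J : V →L[ℝ] V} (x y : V) (φ : FermFun V) :
    contract (x, y) (IsNilpotent.exp (kernelExponent J) * pullback (LinearMap.snd ℝ V V) φ) =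
      IsNilpotent.exp (kernelExponent J) * (contract (x, y) (kernelExponent J) *
        pullback (LinearMap.snd ℝ V V) φ + pullback (LinearMap.snd ℝ V V) (contract y φ)) := by
  rw [contract_exp_mul _ (kernelExponent_mem_quad J), contract_pullback]
  rfl

/-- The kernel is invariant when θ moves by x and χ by x^{1,0}, since g(x^{0,1}, χ^{0,1}) = 0.
Integration by parts then shifts the derivative to φ. -/
theorem contract_kernelOp {J : V →L[ℝ] V} (hJ : ∀ x, J (J x) = -x) (hs : IsSkew J) (x : V)
    (φ : FermFun V) : contract x (kernelOp e J φ) =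
      kernelOp e J ((1 / 2 : ℂ) • (contract x φ - Complex.I • contract (J x) φ)) := by
  have h1 := fermIntegralₗ_contract e x
    (IsNilpotent.exp (kernelExponent J) * pullback (LinearMap.snd ℝ V V) φ)
  have h2 := fermIntegralₗ_contract e (J x)
    (IsNilpotent.exp (kernelExponent J) * pullback (LinearMap.snd ℝ V V) φ)
  have h3 : contract (x, 0)
        (IsNilpotent.exp (kernelExponent J) * pullback (LinearMap.snd ℝ V V) φ) +
      (1 / 2 : ℂ) • (contract (0, x)
        (IsNilpotent.exp (kernelExponent J) * pullback (LinearMap.snd ℝ V V) φ) - Complex.I •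
      contract (0, J x)
        (IsNilpotent.exp (kernelExponent J) * pullback (LinearMap.snd ℝ V V) φ)) =
      IsNilpotent.exp (kernelExponent J) * pullback (LinearMap.snd ℝ V V)
        ((1 / 2 : ℂ) • (contract x φ - Complex.I • contract (J x) φ)) := by
    rw [contract_kernel_mul, contract_kernel_mul, contract_kernel_mul, contract_kernelExponent hs,
      contract_kernelExponent hs, contract_kernelExponent hs, ← ferm_mul_smul, ← mul_sub,
      ← ferm_mul_smul, ← mul_add, hJ]
    congr 1
    simp only [map_zero, map_neg, map_smul, map_sub, sub_mul, add_mul, ferm_smul_mul, ferm_neg_mul,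
      zero_mul, LinearMap.zero_apply]
    match_scalars <;> ring_nf <;> norm_num [Complex.I_sq]
  rw [kernelOp_apply, kernelOp_apply, ← h3, map_add, map_smul, map_sub, map_smul, h1, h2,
    smul_zero, sub_zero, smul_zero, add_zero, contract_fermIntegralₗ]

/-- Deriving the kernel in χ along x + iJx produces the difference of the multipliers in θ and χ. A
total derivative integrates to zero, and the correction vanishes on holomorphic φ. -/
theorem kernelOp_mul {J : V →L[ℝ] V} (hJ : ∀ x, J (J x) = -x) (hs : IsSkew J) (x : V)
    (φ : FermFun V) : kernelOp e J ((cov LinearMap.id x + Complex.I • cov LinearMap.id (J x)) * φ) =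
      (cov LinearMap.id x + Complex.I • cov LinearMap.id (J x)) * kernelOp e J φ -
        kernelOp e J (contract x φ + Complex.I • contract (J x) φ) := by
  have h1 := fermIntegralₗ_contract e x
    (IsNilpotent.exp (kernelExponent J) * pullback (LinearMap.snd ℝ V V) φ)
  have h2 := fermIntegralₗ_contract e (J x)
    (IsNilpotent.exp (kernelExponent J) * pullback (LinearMap.snd ℝ V V) φ)
  have hc := (commute_exp_quad (kernelExponent_mem_quad J)
    (cov (LinearMap.fst ℝ V V) x + Complex.I • cov (LinearMap.fst ℝ V V) (J x))).eq
  have hp : pullback (LinearMap.fst ℝ V V) (cov LinearMap.id x +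
      Complex.I • cov LinearMap.id (J x)) =
      cov (LinearMap.fst ℝ V V) x + Complex.I • cov (LinearMap.fst ℝ V V) (J x) := by
    rw [map_add, map_smul, pullback_cov, pullback_cov, LinearMap.id_comp]
  have h3 : IsNilpotent.exp (kernelExponent J) * pullback (LinearMap.snd ℝ V V)
        ((cov LinearMap.id x + Complex.I • cov LinearMap.id (J x)) * φ) =
      pullback (LinearMap.fst ℝ V V) (cov LinearMap.id x + Complex.I • cov LinearMap.id (J x)) *
        (IsNilpotent.exp (kernelExponent J) * pullback (LinearMap.snd ℝ V V) φ) -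
      IsNilpotent.exp (kernelExponent J) * pullback (LinearMap.snd ℝ V V)
        (contract x φ + Complex.I • contract (J x) φ) +
      (contract (0, x) (IsNilpotent.exp (kernelExponent J) *
        pullback (LinearMap.snd ℝ V V) φ) + Complex.I •
      contract (0, J x)
        (IsNilpotent.exp (kernelExponent J) * pullback (LinearMap.snd ℝ V V) φ)) := by
    rw [contract_kernel_mul, contract_kernel_mul, contract_kernelExponent hs,
      contract_kernelExponent hs, hp, ← mul_assoc (cov _ _ + _), ← hc, mul_assoc, ← mul_sub,
      ← ferm_mul_smul, ← mul_add, ← mul_add, hJ]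
    congr 1
    simp only [map_mul, map_add, map_zero, map_neg, map_smul, sub_mul, add_mul,
      ferm_smul_mul, ferm_neg_mul, zero_mul, pullback_cov, LinearMap.id_comp]
    match_scalars <;> ring_nf <;> norm_num [Complex.I_sq]
  rw [kernelOp_apply, kernelOp_apply, kernelOp_apply, h3, map_add (fermIntegralₗ e),
    map_add (fermIntegralₗ e), map_smul, map_sub, h1, h2, smul_zero, add_zero, add_zero, fermIntegralₗ_fst_mul]

end Integral

end FermionicTransport

end

open scoped TensorProduct

noncomputable section

set_option linter.unusedSectionVars false

namespace FermionicTransport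

/-! ### The reproducing property of the kernel -/

section Projection

variable {V : Type*} [NormedAddCommGroup V] [InnerProductSpace ℝ V] [FiniteDimensional ℝ V]

/-- The `(1,0)`-part of a linear function. -/
def linFun10 (J : V →L[ℝ] V) : Module.Dual ℝ V →ₗ[ℝ] FermFun V where
  toFun α := (1 / 2 : ℂ) • (linFun α - Complex.I • linFun (α ∘ₗ (J : V →ₗ[ℝ] V)))
  map_add' α β := by rw [LinearMap.add_comp, map_add, map_add]; module
  map_smul' r α := by
    rw [LinearMap.smul_comp, map_smul, map_smul, RingHom.id_apply, ← ferm_coe_smul,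
      ← ferm_coe_smul, ← ferm_coe_smul]
    module

theorem linFun10_apply (J : V →L[ℝ] V) (α : Module.Dual ℝ V) : linFun10 J α =
    (1 / 2 : ℂ) • (linFun α - Complex.I • linFun (α ∘ₗ (J : V →ₗ[ℝ] V))) := rfl

theorem linFun10_mul_self (J : V →L[ℝ] V) (α : Module.Dual ℝ V) :
    linFun10 J α * linFun10 J α = 0 := by
  rw [linFun10_apply, ferm_smul_mul, ferm_mul_smul, sub_mul, mul_sub, mul_sub, ferm_smul_mul,
    ferm_smul_mul, ferm_mul_smul, ferm_mul_smul, linFun_mul_self, linFun_mul_self,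
    linFun_mul_swap α]
  module

/-- The projection of functions to holomorphic functions, by `θ ↦ θ_J^{1,0}`. -/
def proj10 (J : V →L[ℝ] V) : FermFun V →ₐ[ℂ] FermFun V :=
  Algebra.TensorProduct.lift (Algebra.ofId ℂ (FermFun V))
    (ExteriorAlgebra.lift ℝ ⟨linFun10 J, linFun10_mul_self J⟩)
    (fun z _ => show Commute _ _ from Algebra.commutes z _)

@[simp]
theorem proj10_linFun (J : V →L[ℝ] V) (α : Module.Dual ℝ V) :
    proj10 J (linFun α) = linFun10 J α := by
  rw [linFun_apply, proj10, Algebra.TensorProduct.lift_tmul, map_one, one_mul,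
    ExteriorAlgebra.lift_ι_apply]

theorem contract_linFun10_mul (J : V →L[ℝ] V) (x : V) (α : Module.Dual ℝ V) (F : FermFun V) :
    contract x (linFun10 J α * F) =
      ((1 / 2 : ℂ) * ((α x : ℂ) - Complex.I * (α (J x) : ℝ))) • F -
        linFun10 J α * contract x F := by
  rw [linFun10_apply, ferm_smul_mul, ferm_smul_mul, map_smul, sub_mul, sub_mul, map_sub,
    ferm_smul_mul, ferm_smul_mul, map_smul, contract_linFun_mul, contract_linFun_mul,
    ← ferm_coe_smul, ← ferm_coe_smul]
  simp only [LinearMap.comp_apply, ContinuousLinearMap.coe_coe]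
  module

theorem contract_proj10 (J : V →L[ℝ] V) (x : V) (F : FermFun V) :
    contract x (proj10 J F) =
      proj10 J ((1 / 2 : ℂ) • (contract x F - Complex.I • contract (J x) F)) := by
  induction F using fermFun_induction with
  | one => simp
  | smul c F h => simp only [map_smul, h, map_sub]; module
  | add F G hF hG => simp only [map_smul, map_add, hF, hG, map_sub]; module
  | mul α F h =>
    rw [map_mul, proj10_linFun, contract_linFun10_mul, h, contract_linFun_mul, contract_linFun_mul,
      ← ferm_coe_smul, ← ferm_coe_smul]
    simp only [map_smul, map_sub, map_mul, proj10_linFun, ferm_mul_smul, mul_sub]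
    module

theorem body_proj10 (J : V →L[ℝ] V) (F : FermFun V) : body (proj10 J F) = body F := by
  induction F using fermFun_induction with
  | one => simp
  | smul c F h => simp only [map_smul, h]
  | add F G hF hG => simp only [map_add, hF, hG]
  | mul α F h => simp [linFun10_apply]

theorem proj10_holomorphic {J : V →L[ℝ] V} (hJ : ∀ x, J (J x) = -x) (x : V) (F : FermFun V) :
    contract x (proj10 J F) + Complex.I • contract (J x) (proj10 J F) = 0 := by
  rw [contract_proj10, contract_proj10, hJ, ← map_smul (proj10 J), ← map_add]
  have h : (1 / 2 : ℂ) • (contract x F - Complex.I • contract (J x) F) +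
      Complex.I • (1 / 2 : ℂ) • (contract (J x) F - Complex.I • contract (-x) F) = 0 := by
    rw [map_neg, LinearMap.neg_apply]
    match_scalars <;> ring_nf
    norm_num [Complex.I_sq]
  rw [h, map_zero]

/-- On holomorphic functions the projection commutes with all derivatives and preserves the value at
zero, so `eq_zero_of_commute_contract` applies to its difference from the identity. -/
theorem proj10_eq_self {J : V →L[ℝ] V} {F : FermFun V}
    (hF : ∀ x, contract x F + Complex.I • contract (J x) F = 0) : proj10 J F = F := by
  let S : Submodule ℂ (FermFun V) :=
    { carrier := {F | ∀ x, contract x F + Complex.I • contract (J x) F = 0}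
      add_mem' := fun {F G} hF hG x => by
        rw [map_add, map_add, smul_add, add_add_add_comm, hF, hG, add_zero]
      zero_mem' := fun x => by simp
      smul_mem' := fun c F hF x => by
        rw [map_smul, map_smul, smul_comm, ← smul_add, hF, smul_zero] }
  refine sub_eq_zero.mp (eq_zero_of_commute_contract S (fun w F hF x => ?_)
    ((proj10 J).toLinearMap - LinearMap.id) (fun w F hF => ?_) (fun F hF => ?_) (F := F) hF)
  · have h := congrArg (contract w) (hF x)
    rw [map_add, map_smul, map_zero] at h
    rw [contract_contract, contract_contract (J x), smul_neg, ← neg_add, h, neg_zero]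
  · have h : (1 / 2 : ℂ) • (contract w F - Complex.I • contract (J w) F) = contract w F := by
      rw [eq_neg_of_add_eq_zero_left (hF w)]
      module
    change contract w (proj10 J F - F) = proj10 J (contract w F) - contract w F
    rw [map_sub, contract_proj10, h]
  · change body (proj10 J F - F) = 0
    rw [map_sub, body_proj10, sub_self]

variable {n : ℕ} (e : OrthonormalBasis (Fin (2 * n)) ℝ V)

theorem kernelOp_one {J : V →L[ℝ] V} (hJ : ∀ x, J (J x) = -x) (hs : IsSkew J) :
    kernelOp e J 1 = body (kernelOp e J 1) • 1 :=
  eq_body_of_contract_eq_zero fun x => by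
    rw [contract_kernelOp e hJ hs, contract_one, contract_one, smul_zero, sub_zero, smul_zero,
      map_zero]

/-- Holomorphic functions are generated from 1 by the multipliers of `kernelOp_mul`, whose
correction term vanishes on them. Everything is thereby reduced to the normalisation. -/
theorem kernelOp_proj10 {J : V →L[ℝ] V} (hJ : ∀ x, J (J x) = -x) (hs : IsSkew J)
    (h1 : kernelOp e J 1 = 1) (F : FermFun V) : kernelOp e J (proj10 J F) = proj10 J F := by
  induction F using fermFun_induction with
  | one => rw [map_one, h1]
  | smul c F h => rw [map_smul, map_smul, h]
  | add F G hF hG => rw [map_add, map_add, hF, hG]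
  | mul α F h =>
    obtain ⟨x, rfl⟩ : ∃ x, innerₗ V x = α :=
      ⟨(InnerProductSpace.toDual ℝ V).symm (LinearMap.toContinuousLinearMap α),
        LinearMap.ext fun y => by simp⟩
    have hx : linFun10 J (innerₗ V x) =
        (1 / 2 : ℂ) • (cov LinearMap.id x + Complex.I • cov LinearMap.id (J x)) := by
      have h2 : innerₗ V x ∘ₗ (J : V →ₗ[ℝ] V) = -innerₗ V (J x) :=
        LinearMap.ext fun y => hs.right x y
      rw [linFun10_apply, h2, map_neg, smul_neg, sub_neg_eq_add]
      rfl
    rw [map_mul, proj10_linFun, hx, ferm_smul_mul, map_smul, kernelOp_mul e hJ hs, h,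
      proj10_holomorphic hJ, map_zero, sub_zero]

end Projection

/-! ### Frames adapted to a complex structure -/

section Adapted

variable {V : Type*} [NormedAddCommGroup V] [InnerProductSpace ℝ V] [FiniteDimensional ℝ V]

/-- In an adapted frame the Gaussian integral factors over the planes spanned by u and Ju, each
contributing a factor i. -/
theorem body_contractFrame_exp {J : V →L[ℝ] V} (hJ : ∀ x, J (J x) = -x) (hs : IsSkew J) (k : ℕ)
    (u : Fin (2 * k) → V) (hu : Orthonormal ℝ u)
    (hu' : ∀ j : Fin k, u ⟨2 * j + 1, by omega⟩ = J (u ⟨2 * j, by omega⟩)) :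
    body (contractFrame u (IsNilpotent.exp
      (-((Complex.I / 2) • gform LinearMap.id LinearMap.id J)))) = Complex.I ^ k := by
  have hq : -((Complex.I / 2) • gform LinearMap.id LinearMap.id J) ∈ quad (W := V) :=
    quad.neg_mem (quad.smul_mem _ (gform_mem_quad _ _ _))
  have hc : ∀ x, contract x (-((Complex.I / 2) • gform LinearMap.id LinearMap.id J)) =
      Complex.I • cov LinearMap.id (J x) := by
    intro x
    rw [map_neg, map_smul, contract_gform hs.neg_apply_right]
    simp only [LinearMap.id_apply, neg_apply, map_neg]
    module
  induction k with
  | zero => rw [contractFrame_zero, Module.End.one_apply, body_exp hq, pow_zero]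
  | succ k ih =>
    have h1 : u 1 = J (u 0) := hu' 0
    have hrest : Orthonormal ℝ (fun i : Fin (2 * k) => u i.succ.succ) :=
      hu.comp _ ((Fin.succ_injective _).comp (Fin.succ_injective _))
    have ih' := ih (fun i => u i.succ.succ) hrest (fun j => hu' j.succ)
    set q := -((Complex.I / 2) • gform LinearMap.id LinearMap.id J)
    have h2 : contract (u 1) (contract (u 0) (IsNilpotent.exp q)) =
        Complex.I • (IsNilpotent.exp q + Complex.I • (cov LinearMap.id (u 1) *
          (cov LinearMap.id (u 0) * IsNilpotent.exp q))) := by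
      have h3 : ∀ x, contract x (IsNilpotent.exp q) =
          Complex.I • (cov LinearMap.id (J x) * IsNilpotent.exp q) := by
        intro x
        rw [contract_exp_quad _ hq, hc, ferm_smul_mul]
      rw [h3, map_smul, contract_cov_mul, ← h1, h3, h1, hJ, ← h1, LinearMap.id_apply,
        real_inner_self_eq_norm_sq, hu.1, map_neg, ferm_neg_mul, smul_neg, ferm_mul_neg,
        ferm_mul_smul]
      norm_num
    change body (contractFrame (N := 2 * k + 1 + 1) u _) = _
    rw [contractFrame_succ, contractFrame_succ]
    change body (contractFrame (fun i : Fin (2 * k) => u i.succ.succ)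
      (contract (u 1) (contract (u 0) _))) = _
    -- The covector of u_1 is orthogonal to the remaining frame, so it survives all contractions and
    -- vanishes at zero.
    have h4 : contractFrame (fun i : Fin (2 * k) => u i.succ.succ) (cov LinearMap.id (u 1) *
          (cov LinearMap.id (u 0) * IsNilpotent.exp q)) = cov LinearMap.id (u 1) *
        contractFrame (fun i : Fin (2 * k) => u i.succ.succ)
          (cov LinearMap.id (u 0) * IsNilpotent.exp q) := by
      refine contractFrame_comm _ (LinearMap.mulLeft ℂ (cov LinearMap.id (u 1))) (fun i F => ?_) _
      rw [LinearMap.mulLeft_apply, LinearMap.mulLeft_apply, contract_cov_mul, LinearMap.id_apply,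
        hu.2, zero_smul, zero_sub]
      intro h
      exact absurd (Fin.succ_injective (2 * k + 1) (a₁ := 0) (a₂ := i.succ) h)
        (Fin.succ_ne_zero i).symm
    rw [h2, map_smul (contractFrame _), map_add (contractFrame _), map_smul (contractFrame _), h4,
      map_smul, map_add, map_smul, map_mul, body_cov,
      zero_mul, smul_zero, add_zero, ih', smul_eq_mul, pow_succ']

/-- The contraction with a frame, evaluated at zero, as an alternating map in the frame. -/
theorem exists_alternatingMap_contractFrame {N : ℕ} (G : FermFun V) (l : ℂ →ₗ[ℝ] ℝ) :
    ∃ ω : V [⋀^Fin N]→ₗ[ℝ] ℝ, ∀ w, ω w = l (body (contractFrame w G)) := by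
  -- The opposite algebra accounts for the reversed order of composition in `contractFrame`.
  let f : V →ₗ[ℝ] (Module.End ℂ (FermFun V))ᵐᵒᵖ :=
    (MulOpposite.opLinearEquiv ℝ).toLinearMap ∘ₗ contract
  have hf : ∀ x, f x * f x = 0 := fun x =>
    MulOpposite.unop_injective (LinearMap.ext fun F => contract_self x F)
  let Φ := ExteriorAlgebra.lift ℝ ⟨f, hf⟩
  let ev : (Module.End ℂ (FermFun V))ᵐᵒᵖ →ₗ[ℝ] ℝ :=
    { toFun := fun A => l (body (A.unop G))
      map_add' := fun A B => by simp
      map_smul' := fun r A => by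
        rw [MulOpposite.unop_smul, LinearMap.smul_apply, ← ferm_coe_smul, map_smul, smul_eq_mul,
          ← Complex.real_smul, map_smul, RingHom.id_apply] }
  refine ⟨(ev ∘ₗ Φ.toLinearMap).compAlternatingMap (ExteriorAlgebra.ιMulti ℝ N), fun w => ?_⟩
  have h : Φ (ExteriorAlgebra.ιMulti ℝ N w) = MulOpposite.op (contractFrame w) := by
    rw [ExteriorAlgebra.ιMulti_apply, map_list_prod, List.map_ofFn, contractFrame,
      MulOpposite.op_list_prod, List.map_reverse, List.reverse_reverse, List.map_ofFn]
    congr 2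
    funext i
    exact ExteriorAlgebra.lift_ι_apply ℝ f hf (w i)
  change ev (Φ (ExteriorAlgebra.ιMulti ℝ N w)) = _
  rw [h]
  rfl

/-- Top-degree alternating maps see only the relative determinant, which is 1 here. Real and
imaginary parts are treated separately to stay with real-valued forms. -/
theorem body_contractFrame_eq_of_orientation {N : ℕ} (e u : OrthonormalBasis (Fin N) ℝ V)
    (h : e.toBasis.orientation = u.toBasis.orientation) (G : FermFun V) :
    body (contractFrame (fun i => e i) G) = body (contractFrame (fun i => u i) G) := by
  have key : ∀ l : ℂ →ₗ[ℝ] ℝ, l (body (contractFrame (fun i => e i) G)) =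
      l (body (contractFrame (fun i => u i) G)) := by
    intro l
    obtain ⟨ω, hω⟩ := exists_alternatingMap_contractFrame (N := N) G l
    have h1 := ω.eq_smul_basis_det u.toBasis
    have h2 := congrArg (fun η : V [⋀^Fin N]→ₗ[ℝ] ℝ => η fun i => e i) h1
    have h3 : u.toBasis.det (fun i => e i) = 1 :=
      u.det_to_matrix_orthonormalBasis_of_same_orientation e h.symm
    rw [← hω, ← hω]
    simpa [h3] using h2
  exact Complex.ext (key Complex.reLm) (key Complex.imLm)

theorem map_span_Iio_le {J : V →L[ℝ] V} (hJ : ∀ x, J (J x) = -x) {n : ℕ} {b : Fin (2 * n) → V}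
    (hb : ∀ k : Fin n, b ⟨2 * k + 1, by omega⟩ = J (b ⟨2 * k, by omega⟩)) (k : Fin n) {x : V}
    (hx : x ∈ Submodule.span ℝ (b '' Set.Iio ⟨2 * k, by omega⟩)) :
    J x ∈ Submodule.span ℝ (b '' Set.Iio ⟨2 * k, by omega⟩) := by
  induction hx using Submodule.span_induction with
  | zero => rw [map_zero]; exact Submodule.zero_mem _
  | add x y _ _ hx hy => rw [map_add]; exact Submodule.add_mem _ hx hy
  | smul r x _ hx => rw [map_smul]; exact Submodule.smul_mem _ r hx
  | mem x hx =>
    obtain ⟨i, hi, rfl⟩ := hx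
    have hi' : (i : ℕ) < 2 * k := hi
    rcases Nat.even_or_odd' (i : ℕ) with ⟨j, hj | hj⟩
    · have e : i = ⟨2 * (⟨j, by omega⟩ : Fin n), by simp only; omega⟩ := Fin.ext hj
      rw [e, ← hb ⟨j, by omega⟩]
      refine Submodule.subset_span ⟨_, ?_, rfl⟩
      change 2 * j + 1 < 2 * (k : ℕ)
      omega
    · have e : i = ⟨2 * (⟨j, by omega⟩ : Fin n) + 1, by simp only; omega⟩ := Fin.ext hj
      rw [e, hb ⟨j, by omega⟩, hJ]
      refine Submodule.neg_mem _ (Submodule.subset_span ⟨_, ?_, rfl⟩)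
      change 2 * j < 2 * (k : ℕ)
      omega

theorem gramSchmidt_sub_mem {N : ℕ} (b : Fin N → V) (i : Fin N) :
    InnerProductSpace.gramSchmidt ℝ b i - b i ∈ Submodule.span ℝ (b '' Set.Iio i) := by
  rw [← InnerProductSpace.span_gramSchmidt_Iio ℝ b i, InnerProductSpace.gramSchmidt_def,
    sub_sub_cancel_left]
  refine Submodule.neg_mem _ (Submodule.sum_mem _ fun j hj => ?_)
  refine Submodule.span_mono ?_ (Submodule.starProjection_apply_mem _ _)
  rintro x rfl
  exact ⟨j, Finset.mem_Iio.mp hj, rfl⟩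

theorem inner_gramSchmidt_eq_zero {N : ℕ} (b : Fin N → V) (i : Fin N) {x : V}
    (hx : x ∈ Submodule.span ℝ (b '' Set.Iio i)) :
    inner ℝ (InnerProductSpace.gramSchmidt ℝ b i) x = 0 := by
  rw [← InnerProductSpace.span_gramSchmidt_Iio ℝ b i] at hx
  induction hx using Submodule.span_induction with
  | zero => rw [inner_zero_right]
  | add x y _ _ hx hy => rw [inner_add_right, hx, hy, add_zero]
  | smul r x _ hx => rw [inner_smul_right, hx, mul_zero]
  | mem x hx =>
    obtain ⟨j, hj, rfl⟩ := hx
    exact InnerProductSpace.gramSchmidt_orthogonal ℝ b (ne_of_gt hj)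

/-- The span of the preceding pairs is stable under J, so the image under J of the even vector is
already orthogonal to all earlier ones and differs from the next basis vector by an element of their
span. These two properties characterise the Gram–Schmidt vector. -/
theorem gramSchmidt_adapted {J : V →L[ℝ] V} (hJ : ∀ x, J (J x) = -x) (hs : IsSkew J) {n : ℕ}
    {b : Fin (2 * n) → V}
    (hb : ∀ k : Fin n, b ⟨2 * k + 1, by omega⟩ = J (b ⟨2 * k, by omega⟩)) (k : Fin n) :
    InnerProductSpace.gramSchmidt ℝ b ⟨2 * k + 1, by omega⟩ =
      J (InnerProductSpace.gramSchmidt ℝ b ⟨2 * k, by omega⟩) := by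
  set p : Fin (2 * n) := ⟨2 * k, by omega⟩ with hp
  set q : Fin (2 * n) := ⟨2 * k + 1, by omega⟩ with hq
  set g := InnerProductSpace.gramSchmidt ℝ b
  have hpq : b '' Set.Iio p ⊆ b '' Set.Iio q := Set.image_mono (Set.Iio_subset_Iio (by
    rw [Fin.le_def, hp, hq]; simp))
  have h1 : g q - J (g p) ∈ Submodule.span ℝ (b '' Set.Iio q) := by
    have e : g q - J (g p) = (g q - b q) - J (g p - b p) := by
      rw [map_sub, hb k]; abel
    rw [e]
    exact Submodule.sub_mem _ (gramSchmidt_sub_mem b q)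
      (Submodule.span_mono hpq (map_span_Iio_le hJ hb k (gramSchmidt_sub_mem b p)))
  have h2 : inner ℝ (J (g p)) (g q - J (g p)) = 0 := by
    have hx := h1
    rw [← InnerProductSpace.span_gramSchmidt_Iio ℝ b q] at hx
    generalize g q - J (g p) = x at hx
    induction hx using Submodule.span_induction with
    | zero => rw [inner_zero_right]
    | add x y _ _ hx hy => rw [inner_add_right, hx, hy, add_zero]
    | smul r x _ hx => rw [inner_smul_right, hx, mul_zero]
    | mem x hx =>
      obtain ⟨j, hj, rfl⟩ := hx
      have hj' : (j : ℕ) < 2 * k + 1 := hj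
      rcases Nat.lt_succ_iff_lt_or_eq.mp hj' with hlt | heq
      · have hm : g j ∈ Submodule.span ℝ (b '' Set.Iio p) := by
          rw [← InnerProductSpace.span_gramSchmidt_Iio ℝ b p]
          exact Submodule.subset_span ⟨j, hlt, rfl⟩
        rw [hs, inner_gramSchmidt_eq_zero b p (map_span_Iio_le hJ hb k hm), neg_zero]
      · have : j = p := Fin.ext heq
        rw [this]
        have h3 := hs (g p) (g p)
        rw [real_inner_comm] at h3
        linarith [real_inner_comm (J (g p)) (g p)]
  have h4 : inner ℝ (g q - J (g p)) (g q - J (g p)) = 0 := by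
    rw [inner_sub_left, h2, inner_gramSchmidt_eq_zero b q h1, sub_zero]
  exact sub_eq_zero.mp (inner_self_eq_zero.mp h4)

/-- A compatible complex structure has positively oriented adapted orthonormal bases. -/
theorem exists_adapted_orthonormalBasis {n : ℕ} {o : Orientation ℝ V (Fin (2 * n))}
    {J : V →L[ℝ] V} (hJ : J ∈ compatibleJ o) :
    ∃ u : OrthonormalBasis (Fin (2 * n)) ℝ V, u.toBasis.orientation = o ∧
      ∀ k : Fin n, u ⟨2 * k + 1, by omega⟩ = J (u ⟨2 * k, by omega⟩) := by
  obtain ⟨hJ2, hJo, b, hbo, hb⟩ := hJ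
  have hs : IsSkew J := fun x y => by
    rw [← hJo x (J y), hJ2, inner_neg_right, neg_neg]
  have hN : Module.finrank ℝ V = Fintype.card (Fin (2 * n)) := Module.finrank_eq_card_basis b
  let u := InnerProductSpace.gramSchmidtOrthonormalBasis hN b
  let g := InnerProductSpace.gramSchmidt ℝ b
  have hu : ∀ i, u i = ‖g i‖⁻¹ • g i := by
    intro i
    refine InnerProductSpace.gramSchmidtOrthonormalBasis_apply hN (fun h0 => ?_)
    have h1 := InnerProductSpace.gramSchmidtNormed_unit_length (𝕜 := ℝ) i b.linearIndependent
    rw [h0, norm_zero] at h1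
    exact zero_ne_one h1
  have hn : ∀ x, ‖J x‖ = ‖x‖ := fun x => by
    rw [norm_eq_sqrt_real_inner, hJo, ← norm_eq_sqrt_real_inner]
  refine ⟨u, ?_, fun k => ?_⟩
  -- The change of basis is triangular with diagonal entries ‖g_i‖ > 0.
  · rw [← hbo, u.toBasis.orientation_eq_iff_det_pos]
    have hd : u.toBasis.det b = ∏ i, inner ℝ (u i) (b i) :=
      InnerProductSpace.gramSchmidtOrthonormalBasis_det hN b
    rw [hd]
    refine Finset.prod_pos fun i _ => ?_
    have h0 : g i ≠ 0 := InnerProductSpace.gramSchmidt_ne_zero i b.linearIndependent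
    have h1 : inner ℝ (g i) (b i) = inner ℝ (g i) (g i) := by
      have h2 := inner_gramSchmidt_eq_zero (⇑b) i (gramSchmidt_sub_mem (⇑b) i)
      rw [inner_sub_right] at h2
      exact (sub_eq_zero.mp h2).symm
    rw [hu, inner_smul_left, h1]
    have : 0 < inner ℝ (g i) (g i) := real_inner_self_pos.mpr h0
    have : 0 < ‖g i‖ := norm_pos_iff.mpr h0
    simp only [conj_trivial]
    positivity
  · have h := gramSchmidt_adapted hJ2 hs hb k
    rw [hu, hu, map_smul]
    change ‖InnerProductSpace.gramSchmidt ℝ b _‖⁻¹ • InnerProductSpace.gramSchmidt ℝ b _ = _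
    rw [h, hn]

variable {n : ℕ} (e : OrthonormalBasis (Fin (2 * n)) ℝ V)

/-- The orientation induced by J allows the integral to be computed in an adapted frame, with value
iⁿ. The factor iⁿ of the volume element and the sign convention turn this into 1. -/
theorem body_kernelOp_one {J : V →L[ℝ] V} (hJ : J ∈ compatibleJ e.toBasis.orientation) :
    body (kernelOp e J 1) = 1 := by
  obtain ⟨u, huo, hu⟩ := exists_adapted_orthonormalBasis hJ
  have h1 : pullback (LinearMap.inr ℝ V V) (kernelExponent J) =
      -((Complex.I / 2) • gform LinearMap.id LinearMap.id J) := by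
    have h0 : ∀ M : V →L[ℝ] V, gform (0 : V →ₗ[ℝ] V) LinearMap.id M = 0 := fun M => by
      rw [gform_eq_sum (stdOrthonormalBasis ℝ V)]
      refine Finset.sum_eq_zero fun i _ => ?_
      rw [cov_apply, LinearMap.comp_zero, map_zero, zero_mul]
    rw [kernelExponent, couplingExponent, map_sub, map_smul, map_smul, map_add, map_smul,
      pullback_gform, pullback_gform, pullback_gform, LinearMap.fst_comp_inr,
      LinearMap.snd_comp_inr, h0, h0, smul_zero, add_zero, smul_zero, zero_sub]
  have h2 := body_contractFrame_exp hJ.1 (compatibleJ_skew hJ) n u u.orthonormal hu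
  rw [← body_contractFrame_eq_of_orientation e u huo.symm, ← h1,
    ← pullback_exp _ (kernelExponent_mem_quad J), contractFrame_pullback, body_pullback] at h2
  rw [kernelOp_apply, map_one, mul_one, fermIntegralₗ_apply, fermIntegral, map_smul, body_pullback]
  change _ • body (contractFrame (fun i => LinearMap.inr ℝ V V (e i)) _) = _
  rw [h2, smul_eq_mul]
  -- The exponent is n(2n - 1), of the same parity as n; n = 0 is separate because of the truncated
  -- subtraction.
  have h3 : ((-1 : ℂ)) ^ (2 * n * (2 * n - 1) / 2) = (-1) ^ n := by
    rw [mul_assoc, Nat.mul_div_cancel_left _ two_pos, pow_mul]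
    rcases n with _ | n
    · simp
    · have : 2 * (n + 1) - 1 = 2 * n + 1 := by omega
      rw [this, ← pow_mul, mul_comm, pow_mul, Odd.neg_one_pow ⟨n, rfl⟩]
  rw [h3, mul_right_comm, ← mul_pow, ← mul_pow, Complex.I_mul_I]
  simp

/-- The kernel `exp g(θ - χ, χ_J^{0,1})` reproduces the holomorphic functions. -/
theorem kernelOp_eq_self {J : V →L[ℝ] V} (hJ : J ∈ compatibleJ e.toBasis.orientation)
    {φ : FermFun V} (hφ : ∀ x, contract x φ + Complex.I • contract (J x) φ = 0) :
    kernelOp e J φ = φ := by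
  have h1 : kernelOp e J 1 = 1 := by
    rw [kernelOp_one e hJ.1 (compatibleJ_skew hJ), body_kernelOp_one e hJ, one_smul]
  rw [← proj10_eq_self hφ, kernelOp_proj10 e hJ.1 (compatibleJ_skew hJ) h1]

end Adapted

end FermionicTransport

end

open scoped TensorProduct

noncomputable section

set_option linter.unusedSectionVars false

namespace FermionicTransport

/-! ### The transport operator on coherent states and on integrals -/

section Formulas

variable {V : Type*} [NormedAddCommGroup V] [InnerProductSpace ℝ V] [FiniteDimensional ℝ V]

theorem cayley_mul_flow {B : V →L[ℝ] V} {t : ℝ} (hu : IsUnit (1 + flow B t)) :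
    cayley B t * flow B t = flow B t * cayley B t := by
  rw [cayley, sub_mul, mul_sub, smul_mul_assoc, mul_smul_comm, flow_mul_inverse hu,
    inverse_mul_flow hu, one_mul, mul_one]

/-- An operator `T` which relates `J₀` to `J₁` as the Cayley transform of `J₁ J₀⁻¹` does. -/
structure IsCayley (J₀ J₁ T : V →L[ℝ] V) : Prop where
  sq₀ : J₀ * J₀ = -1
  sq₁ : J₁ * J₁ = -1
  skew₀ : IsSkew J₀
  skew₁ : IsSkew J₁
  skew : IsSkew T
  anticomm₀ : T * J₀ = -(J₀ * T)
  anticomm₁ : T * J₁ = -(J₁ * T)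
  intertwine : J₁ * (1 + T) = (1 + T) * J₀
  inverse_eq : Ring.inverse ((1 / 2 : ℝ) • (J₀ + J₁)) = -(J₀ * (1 - T))

theorem isCayley_cayley {n : ℕ} {o : Orientation ℝ V (Fin (2 * n))} {J B : V →L[ℝ] V}
    (hJ : J ∈ compatibleJ o) (hB : IsSkew B) (hBJ : B * J = -(J * B)) {t : ℝ}
    (hu : IsUnit (1 + flow B t)) : IsCayley J (flow B t * J) (cayley B t) where
  sq₀ := compatibleJ_sq hJ
  sq₁ := compatibleJ_sq (compatibleJ_flow hJ hB hBJ t)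
  skew₀ := compatibleJ_skew hJ
  skew₁ := compatibleJ_skew (compatibleJ_flow hJ hB hBJ t)
  skew := isSkew_cayley hB hu
  anticomm₀ := cayley_mul_J hu hBJ
  anticomm₁ := by
    rw [← mul_assoc, cayley_mul_flow hu, mul_assoc, cayley_mul_J hu hBJ, mul_neg, mul_assoc]
  intertwine := flow_mul_J_mul_one_add_cayley hu hBJ
  inverse_eq := inverse_half_add hu (compatibleJ_sq hJ)

variable {ι : Type*} [Fintype ι] (b : OrthonormalBasis ι ℝ V) {J₀ J₁ T : V →L[ℝ] V}

theorem varpi_fermVec_mem_quad {W : Type*} [AddCommGroup W] [Module ℝ W] {J : V →L[ℝ] V}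
    (hs : IsSkew J) (f : W →ₗ[ℝ] V) (c : ℂ) : c • varpi J (fermVec f) ∈ quad := by
  rw [varpi_fermVec hs]
  exact quad.smul_mem _ (quad.neg_mem (gform_mem_quad _ _ _))

theorem pullback_varpi {W W' : Type*} [AddCommGroup W] [Module ℝ W] [AddCommGroup W'] [Module ℝ W']
    {J : V →L[ℝ] V} (hs : IsSkew J) (f : W →ₗ[ℝ] V) (k : W' →ₗ[ℝ] W) :
    pullback k (varpi J (fermVec f)) = varpi J (fermVec (f ∘ₗ k)) := by
  rw [varpi_fermVec hs, varpi_fermVec hs, map_neg, pullback_gform]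

theorem IsCayley.apply_apply₀ (h : IsCayley J₀ J₁ T) (x : V) : J₀ (J₀ x) = -x :=
  congrArg (fun A : V →L[ℝ] V => A x) h.sq₀

theorem IsCayley.exponent_eq (h : IsCayley J₀ J₁ T) :
    (Complex.I / 4) • varpi J₁ theta + transportExponent J₀ J₁ =
      coherentExponent J₀ + shiftExponent J₀ T :=
  exponent_identity h.sq₀ h.sq₁ h.skew₀ h.skew₁ h.skew h.anticomm₀ h.anticomm₁ h.intertwine
    h.inverse_eq

theorem IsCayley.transportExponent_mem_quad (h : IsCayley J₀ J₁ T) :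
    transportExponent J₀ J₁ ∈ quad := by
  rw [eq_sub_of_add_eq' h.exponent_eq]
  exact quad.sub_mem (quad.add_mem (coherentExponent_mem_quad J₀) (shiftExponent_mem_quad J₀ T))
    (varpi_fermVec_mem_quad h.skew₁ _ _)

theorem IsCayley.exp_quadOp_coherent (h : IsCayley J₀ J₁ T) :
    IsNilpotent.exp (quadOp b nablaTheta J₀ T) (IsNilpotent.exp (coherentExponent J₀)) =
      IsNilpotent.exp ((Complex.I / 4) • varpi J₁ theta) *
        IsNilpotent.exp (transportExponent J₀ J₁) := by
  rw [FermionicTransport.exp_quadOp_coherent b h.sq₀ h.skew₀ h.skew h.anticomm₀, ← h.exponent_eq,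
    exp_add_quad (show (Complex.I / 4) • varpi J₁ theta ∈ quad from
      varpi_fermVec_mem_quad h.skew₁ _ _) h.transportExponent_mem_quad]

/-- By the reproducing kernel the state is an integral over χ of coherent states, with weight
depending on χ only. The operator commutes with the integral and with the weight, so it acts just on
the coherent state. -/
theorem IsCayley.exp_quadOp_holomorphic (h : IsCayley J₀ J₁ T) {n : ℕ}
    (e : OrthonormalBasis (Fin (2 * n)) ℝ V) (hJ : J₀ ∈ compatibleJ e.toBasis.orientation)
    {φ : FermFun V} (hφ : ∀ x, contract x φ + Complex.I • contract (J₀ x) φ = 0) :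
    IsNilpotent.exp (quadOp b nablaReal J₀ T) (IsNilpotent.exp (vacuumExponent J₀) * φ) =
      IsNilpotent.exp ((Complex.I / 4) • varpi J₁ theta₁) *
        fermIntegral e (IsNilpotent.exp (transportExponent J₀ J₁ +
          (Complex.I / 2) • varpi J₀ chi) * pullback (LinearMap.snd ℝ V V) φ) := by
  set w : FermFun V := (Complex.I / 2) • varpi J₀ theta₁
  have hw : w ∈ quad := varpi_fermVec_mem_quad h.skew₀ _ _
  have hchi : (Complex.I / 2) • varpi J₀ chi = pullback (LinearMap.snd ℝ V V) w := by
    rw [map_smul, theta₁, pullback_varpi h.skew₀, LinearMap.id_comp, chi]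
  have hv : (Complex.I / 4) • varpi J₁ theta₁ ∈ quad (W := V) :=
    varpi_fermVec_mem_quad h.skew₁ _ _
  have htheta : (Complex.I / 4) • varpi J₁ theta =
      pullback (LinearMap.fst ℝ V V) ((Complex.I / 4) • varpi J₁ theta₁) := by
    rw [map_smul, theta₁, pullback_varpi h.skew₁, LinearMap.id_comp, theta]
  -- Vacuum in θ times reproducing kernel is the coherent state times the Gaussian weight in χ.
  have hk : pullback (LinearMap.fst ℝ V V) (vacuumExponent J₀) + kernelExponent J₀ =
      coherentExponent J₀ + pullback (LinearMap.snd ℝ V V) w := by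
    rw [coherentExponent_eq, kernelExponent, ← hchi, chi, varpi_fermVec h.skew₀]
    module
  have hl : IsNilpotent.exp (vacuumExponent J₀) * φ = fermIntegralₗ e
      (IsNilpotent.exp (coherentExponent J₀) *
        pullback (LinearMap.snd ℝ V V) (IsNilpotent.exp w * φ)) := by
    conv_lhs => rw [← kernelOp_eq_self e hJ hφ, kernelOp_apply, ← fermIntegralₗ_fst_mul,
      ← mul_assoc, pullback_exp _ (vacuumExponent_mem_quad J₀),
      ← exp_add_quad (pullback_mem_quad _ (vacuumExponent_mem_quad J₀))
        (kernelExponent_mem_quad J₀), hk,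
      exp_add_quad (coherentExponent_mem_quad J₀) (pullback_mem_quad _ hw), mul_assoc,
      ← pullback_exp _ hw, ← map_mul]
  rw [hl, exp_quadOp_intertwine b h.apply_apply₀ h.skew₀ T isClifford_nablaTheta
    isClifford_nablaReal (nablaReal_fermIntegralₗ e), exp_quadOp_mul_snd b h.apply_apply₀ h.skew₀,
    h.exp_quadOp_coherent, htheta, ← pullback_exp _ hv, mul_assoc, fermIntegralₗ_fst_mul,
    map_mul (pullback _), ← mul_assoc (IsNilpotent.exp _) (pullback _ _), pullback_exp _ hw,
    ← exp_add_quad h.transportExponent_mem_quad (pullback_mem_quad _ hw), hchi]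
  rfl

end Formulas

end FermionicTransport

end

open FermionicTransport in
theorem mainTheorem3 {V : Type*} [NormedAddCommGroup V] [InnerProductSpace ℝ V]
    [FiniteDimensional ℝ V] (n : ℕ) (o : Orientation ℝ V (Fin (2 * n)))
    (e : OrthonormalBasis (Fin (2 * n)) ℝ V) (he : e.toBasis.orientation = o)
    (J₀ J₁ : V →L[ℝ] V) (γ : ℝ → V →L[ℝ] V)
    (hγ : IsGeodesicOn o γ (Set.Icc 0 1)) (hγ₀ : γ 0 = J₀) (hγ₁ : γ 1 = J₁)
    (hcut : ∀ t ∈ Set.Icc (0 : ℝ) 1, γ t ∉ cutLocus o J₀) :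
    0 < ((1 / 2 : ℝ) • (J₀ + J₁)).det ∧
    ∃ U : quantumSpace J₀ →ₗ[ℂ] quantumSpace J₁, IsParallelTransport e γ U ∧
      SendsParamState U (coherentState J₀)
        ((((((1 / 2 : ℝ) • (J₀ + J₁)).det ^ (1 / 4 : ℝ) : ℝ) : ℂ)) •
          (IsNilpotent.exp ((Complex.I / 4) • varpi J₁ theta) *
            IsNilpotent.exp (transportExponent J₀ J₁))) ∧
      ∀ (φ : FermFun V)
        (hφ : IsNilpotent.exp ((Complex.I / 4) • varpi J₀ theta₁) * φ ∈ quantumSpace J₀),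
        (U ⟨IsNilpotent.exp ((Complex.I / 4) • varpi J₀ theta₁) * φ, hφ⟩ : FermFun V) =
          ((((1 / 2 : ℝ) • (J₀ + J₁)).det ^ (1 / 4 : ℝ) : ℝ) : ℂ) •
            (IsNilpotent.exp ((Complex.I / 4) • varpi J₁ theta₁) *
              fermIntegral e
                (IsNilpotent.exp (transportExponent J₀ J₁ +
                    (Complex.I / 2) • varpi J₀ chi) *
                  pullback (LinearMap.snd ℝ V V) φ)) := by
  subst he hγ₁ hγ₀
  have hJ : γ 0 ∈ compatibleJ e.toBasis.orientation := hγ.2.1 0 (by norm_num)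
  obtain ⟨B, hB, hBJ, hflow⟩ := geodesic_eq_flow hγ
  obtain ⟨b, hb⟩ := exists_eigenbasis hB
  have hdet : ∀ t ∈ Set.Icc (0 : ℝ) 1, (1 + flow B t).det ≠ 0 := fun t ht =>
    isUnit_one_add_flow hB hb
      (norm_lt_pi_of_notMem_cutLocus hJ hB hBJ hb fun s hs => hflow s hs ▸ hcut s hs) ht
  have hu : ∀ t ∈ Set.Icc (0 : ℝ) 1, IsUnit (1 + flow B t) := fun t ht =>
    isUnit_of_det_ne_zero (hdet t ht)
  have hpos := det_half_add_pos (compatibleJ_sq hJ) hdet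
  have h1 : (1 : ℝ) ∈ Set.Icc (0 : ℝ) 1 := by norm_num
  have hγ1 := hflow 1 h1
  have hc : IsCayley (γ 0) (γ 1) (cayley B 1) := hγ1 ▸ isCayley_cayley hJ hB hBJ (hu 1 h1)
  have hfac : (transportFactor (γ 0) B 1 : ℂ) =
      ((((1 / 2 : ℝ) • (γ 0 + γ 1)).det ^ (1 / 4 : ℝ) : ℝ) : ℂ) := by
    rw [transportFactor, ← hγ1]
  -- The transport operator is defined on all functions, and only its restriction to the fibre at J₀
  -- lands in the fibre at J₁.
  let U : quantumSpace (γ 0) →ₗ[ℂ] quantumSpace (γ 1) :=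
    (transportOp e (γ 0) B 1).restrict fun ψ hψ => by
      rw [hγ1]
      exact Submodule.smul_mem _ _ (exp_quadOp_mem_quantumSpace e (compatibleJ_sq hJ)
        (compatibleJ_skew hJ) hB hBJ (hu 1 h1) (compatibleJ_flow hJ hB hBJ 1).1 hψ)
  have hU : ∀ ψ, (U ψ : FermFun V) = ((((1 / 2 : ℝ) • (γ 0 + γ 1)).det ^ (1 / 4 : ℝ) : ℝ) : ℂ) •
      IsNilpotent.exp (quadOp e nablaReal (γ 0) (cayley B 1)) (ψ : FermFun V) := fun ψ => by
    rw [← hfac]; rfl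
  refine ⟨by rw [hγ1]; exact hpos 1 h1, U, fun ψ₀ ψ₁ => ⟨?_, ?_⟩, ⟨?_, ?_⟩, fun φ hφ => ?_⟩
  · rintro ⟨ψ, hψ, hψ0, rfl⟩
    refine hψ.eq_of_eq (isParallelAlong_transportOp e hJ hB hBJ hu hpos hflow ψ₀.2) ?_
    rw [hψ0, transportOp_zero e (compatibleJ_sq hJ)]
    rfl
  · rintro rfl
    refine ⟨_, isParallelAlong_transportOp e hJ hB hBJ hu hpos hflow ψ₀.2, ?_, rfl⟩
    rw [transportOp_zero e (compatibleJ_sq hJ)]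
    rfl
  · rw [coherentState_eq hc.sq₀ hc.skew₀]
    exact coherent_mem_range hc.apply_apply₀ hc.skew₀
  -- The formula holds for every representing tensor at once, so injectivity of the identification
  -- plays no role.
  · intro Z hZ
    rw [paramState_rTensor e hc.apply_apply₀ hc.skew₀ (cayley B 1) hU, hZ,
      coherentState_eq hc.sq₀ hc.skew₀, hc.exp_quadOp_coherent]
  · rw [hU]
    congr 1
    rw [varpi_theta₁ hc.skew₀] at hφ
    simp only [varpi_theta₁ hc.skew₀]
    exact hc.exp_quadOp_holomorphic e e hJ
      ((exp_vacuum_mul_mem_iff hc.apply_apply₀ hc.skew₀ φ).mp hφ)
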